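/- **Setting.** For integers $t\ge 1$, $n\ge1$, let $\rho_{\mathrm{unique},n}^{(t)}$ be the uniform mixture of $|T\rangle\langle T|$ over all sets $T$ of $t$ distinct $n$-bit strings, where $|T\rangle=\frac1{\sqrt{t!}}\sum|v_1,\dots,v_t\rangle$, the sum being over the orderings $(v_1,\dots,v_t)$ of $T$. For a permutation $p$ of $\{0,1\}^n$ let $U_p|x\rangle=|p(x)\rangle$. Let $k\le n$ and $m\le k$. **Random circuit $U_p$.** Cut the $n$ bits into $R=\lceil n/k\rceil$ registers $0,\dots,R-1$ of $k$ consecutive bits (the last one may be shorter), and put $L=\lceil\log_2 R\rceil$. Sample independently and uniformly, for $j=1,\dots,\alpha$, a tuple $S_j$ of $m$ distinct positions in $\{1,\dots,k\}$ and a string $c_j\in\{0,1\}^m$, and for every bit $q$ and every $j$ a fair coin $b_{q,j}$. *Randomizing* bit $q$ from register $r$ means: for each $j$ with $b_{q,j}=1$, apply the multi-controlled NOT (MCX) gate that flips $q$ exactly when the bits of register $r$ at the positions $S_j$ equal $c_j$. The circuit is: (1) for $i=0,\dots,L-2$, copy by CNOT gates register $r-2^i$ to register $r$, for all $2^i\le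 r<2^{i+1}$; (2) for $i=L-1,\dots,0$, randomize every bit of register $r$ from register $r-2^i$, for all $2^i\le r<2^{i+1}$, $r<R$; (3) if $2k\le n$, randomize every bit of register $0$ from register $1$. **Depth.** A permutation unitary is implementable in depth $D$ with $a$ ancillas if a circuit of at most $D$ layers of single-qubit and CNOT gates, those in one layer acting on disjoint qubits, on $n+a$ qubits, maps $|x\rangle|0^a\rangle$ to $(U_p|x\rangle)|0^a\rangle$ for all $x$. **Statement.** There are absolute constants $C>0$ and $c\in\mathbb N$ such that the following holds for all integers $t\ge1$ and all $0<\epsilon\le 1$ with $t<1/\epsilon$ and $t\log t\ge\log(1/\epsilon)$, for $k=\lceil 8\log_2(6t^2/\epsilon)\rceil$, every $n\ge k$ and $m=\lceil\log_2 t\rceil$. There is $\alpha\le C\,t\log(t/\epsilon)$ such that the random circuit above maps a random unique-type state on the first $k$ bits to $\rho^{(t)}_{\mathrm{unique},n}$ with failure probability below $\epsilon$, that is, with $\mathrm{TD}$ the trace distance, $$\mathrm{TD}\Big(\mathbb E_p\big[U_p^{\otimes t}\big(\rho^{(t)}_{\mathrm{unique},k}\otimes|0\rangle\langle0|^{\otimes(n-k)t}\big)U_p^{\otimes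 t,\dagger}\big],\ \rho^{(t)}_{\mathrm{unique},n}\Big)<\epsilon .$$ Moreover there is a set of outcomes of the sampling, of probability larger than $1-\epsilon$, such that the same inequality holds for the average over this set only, and such that for every outcome in this set $U_p$ can be implemented in depth at most $C\,t(\log t)^3\log n\,\log(1/\epsilon)$ without ancillas, and in depth at most $C\,t(\log t)^2\log n\,\log(1/\epsilon)\,[\log(2+\log t)]^{c}$ with $\lceil n/k\rceil$ ancillas. -/

import Mathlib

open scoped Matrix

namespace RandomMCX

/-! ### Bit strings, permutations and their unitaries -/

/-- Bit strings of length `n`; they label the computational basis of `n` qubits. -/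
abbrev Bits (n : ℕ) : Type := Fin n → Bool

/-- The unitary `U_p |x⟩ = |p x⟩` of a permutation `p` of basis labels. -/
def permUnitary {ι : Type} [DecidableEq ι] (p : Equiv.Perm ι) : Matrix ι ι ℂ :=
  Matrix.of fun y x => if y = p x then 1 else 0

/-- The multi-controlled NOT gate with control bits `ctrl`, control conditions `val` and target
`q`: it flips bit `q` exactly when bit `ctrl l` has the value `val l` for every `l`. -/
def mcx {n m : ℕ} (ctrl : Fin m → Fin n) (val : Fin m → Bool) (q : Fin n)
    (hq : ∀ l, ctrl l ≠ q) : Equiv.Perm (Bits n) :=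
  Function.Involutive.toPerm
    (fun x => if ∀ l, x (ctrl l) = val l then Function.update x q (!x q) else x)
    (by
      intro x
      by_cases h : ∀ l, x (ctrl l) = val l
      · have h' : ∀ l, Function.update x q (!x q) (ctrl l) = val l := fun l => by
          rw [Function.update_of_ne (hq l)]; exact h l
        simp only [if_pos h, if_pos h', Function.update_self, Bool.not_not,
          Function.update_idem, Function.update_eq_self]
      · simp only [if_neg h])

/-- The CNOT gate with control `c` and target `q`. -/
def cnot {n : ℕ} (c q : Fin n) (h : c ≠ q) : Equiv.Perm (Bits n) :=
  mcx (fun _ : Fin 1 => c) (fun _ => true) q (fun _ => h)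

/-! ### The random circuit

The `n` bits are cut into `⌈n / k⌉` registers of `k` consecutive bits, numbered from `0` (only the
last one can be shorter): bit `q` lies in register `q / k`. -/

/-- The number of registers. -/
def numReg (n k : ℕ) : ℕ := n ⌈/⌉ k

/-- The number of doublings that lead from one register to all registers. -/
def numRounds (n k : ℕ) : ℕ := Nat.clog 2 (numReg n k)

/-- The random data of the circuit. First the output of the sampling subroutine: for each of the
`α` MCX gates, `m` distinct positions in a `k`-bit register and `m` control conditions. Then the
coins: whether the `j`-th of these gates is applied to the target bit `q`. -/
abbrev Seed (n k m α : ℕ) : Type :=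
  (Fin α → (Fin m ↪ Fin k) × (Fin m → Bool)) × (Fin n → Fin α → Bool)

/-- Bit `s` of register `r`, for a register of full length. -/
def regBit {n k : ℕ} (r : ℕ) (h : (r + 1) * k ≤ n) (s : Fin k) : Fin n :=
  ⟨r * k + s, by have := s.isLt; rw [Nat.add_mul] at h; omega⟩

theorem regBit_div {n k : ℕ} (r : ℕ) (h : (r + 1) * k ≤ n) (s : Fin k) :
    (regBit r h s : ℕ) / k = r := by
  have hk : 0 < k := lt_of_le_of_lt (Nat.zero_le _) s.isLt
  simp only [regBit]
  rw [Nat.add_comm, Nat.add_mul_div_right _ _ hk, Nat.div_eq_of_lt s.isLt, Nat.zero_add]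

/-- The sampled MCX gates, each one applied or not according to its coin, conditioned on
register `r` and targeting the bit `q` outside that register. -/
def randomizeBit {n k m α : ℕ} (ω : Seed n k m α) (r : ℕ) (h : (r + 1) * k ≤ n)
    (q : Fin n) (hq : (q : ℕ) / k ≠ r) : List (Equiv.Perm (Bits n)) :=
  (List.finRange α).flatMap fun j =>
    if ω.2 q j then
      [mcx (fun l => regBit r h ((ω.1 j).1 l)) (ω.1 j).2 q
        (fun l e => hq (by rw [← e]; exact regBit_div r h _))]
    else []

/-- Doubling step `i` of the copying tree: register `r`, for `2 ^ i ≤ r < 2 ^ (i + 1)`, receives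
by CNOT gates a copy of register `r - 2 ^ i`. -/
def copyStep (n k i : ℕ) : List (Equiv.Perm (Bits n)) :=
  (List.finRange n).flatMap fun q : Fin n =>
    if h : 2 ^ i ≤ (q : ℕ) / k ∧ (q : ℕ) / k < 2 ^ (i + 1) then
      [cnot ⟨q - 2 ^ i * k, by omega⟩ q (by
        intro e
        have e' : (q : ℕ) - 2 ^ i * k = q := congrArg Fin.val e
        have hp : 0 < 2 ^ i := Nat.two_pow_pos i
        have hk : 0 < k := by
          rcases Nat.eq_zero_or_pos k with rfl | hk
          · simp only [Nat.div_zero] at h; omega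
          · exact hk
        have hle : 2 ^ i * k ≤ q := (Nat.le_div_iff_mul_le hk).1 h.1
        have := Nat.mul_pos hp hk
        omega)]
    else []

/-- Randomization step `i`: every bit of register `r`, for `2 ^ i ≤ r < 2 ^ (i + 1)`, is targeted
by the random MCX gates conditioned on register `r - 2 ^ i`. -/
def randomizeStep {n k m α : ℕ} (ω : Seed n k m α) (i : ℕ) : List (Equiv.Perm (Bits n)) :=
  (List.finRange n).flatMap fun q : Fin n =>
    if h : 2 ^ i ≤ (q : ℕ) / k ∧ (q : ℕ) / k < 2 ^ (i + 1) then
      randomizeBit ω ((q : ℕ) / k - 2 ^ i)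
        (by
          have hp : 0 < 2 ^ i := Nat.two_pow_pos i
          have h1 : (q : ℕ) / k - 2 ^ i + 1 ≤ (q : ℕ) / k := by omega
          exact ((Nat.mul_le_mul_right k h1).trans (Nat.div_mul_le_self _ _)).trans q.isLt.le)
        q (by have hp : 0 < 2 ^ i := Nat.two_pow_pos i; omega)
    else []

/-- Last step: the bits of register `0` are targeted by the random MCX gates conditioned on
register `1` (nothing is done if there is no second register of full length). -/
def finalStep {n k m α : ℕ} (ω : Seed n k m α) : List (Equiv.Perm (Bits n)) :=
  (List.finRange n).flatMap fun q : Fin n =>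
    if h : (q : ℕ) < k ∧ (1 + 1) * k ≤ n then
      randomizeBit ω 1 h.2 q (by rw [Nat.div_eq_of_lt h.1]; exact zero_ne_one)
    else []

/-- The gates in temporal order. With `2 ^ (L - 1) < numReg n k ≤ 2 ^ L`: the copying tree fills
the registers below `2 ^ (L - 1)` with copies of register `0`; then the registers `≥ 2 ^ (L - 1)`
are randomized, then the registers from `2 ^ (L - 2)` on, and so on down to register `1`; finally
register `0` is randomized. -/
def algorithmGates {n k m α : ℕ} (ω : Seed n k m α) : List (Equiv.Perm (Bits n)) :=
  (List.range (numRounds n k - 1)).flatMap (copyStep n k) ++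
    ((List.range (numRounds n k)).reverse.flatMap (randomizeStep ω) ++ finalStep ω)

/-- The permutation `p` realized by the algorithm (first gate of the list applied first). -/
def algorithmPerm {n k m α : ℕ} (ω : Seed n k m α) : Equiv.Perm (Bits n) :=
  (algorithmGates ω).reverse.prod

/-! ### States on `t` copies -/

/-- `U ^ ⊗ t`. -/
def tensorPower {ι : Type} (t : ℕ) (U : Matrix ι ι ℂ) : Matrix (Fin t → ι) (Fin t → ι) ℂ :=
  Matrix.of fun w v => ∏ a, U (w a) (v a)

/-- The unique-type state `|T⟩ = (t!)^(-1/2) ∑ |v₁, …, v_t⟩`, where the sum is over the orderings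
`v` of the set `T` of `t` distinct bit strings. -/
noncomputable def typeVec (n t : ℕ) (T : Finset (Bits n)) : (Fin t → Bits n) → ℂ :=
  fun v => if Finset.univ.image v = T then ((Real.sqrt (t.factorial : ℝ) : ℝ) : ℂ)⁻¹ else 0

/-- `ρ_unique,n`: the uniform mixture of `|T⟩⟨T|` over all sets `T` of `t` distinct `n`-bit
strings. -/
noncomputable def rhoUnique (n t : ℕ) : Matrix (Fin t → Bits n) (Fin t → Bits n) ℂ :=
  ((Finset.univ.powersetCard t : Finset (Finset (Bits n))).card : ℂ)⁻¹ •
    ∑ T ∈ (Finset.univ.powersetCard t : Finset (Finset (Bits n))),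
      Matrix.vecMulVec (typeVec n t T) (star (typeVec n t T))

/-- Append `n - k` zeros to a `k`-bit string. -/
def pad (n : ℕ) {k : ℕ} (x : Bits k) : Bits n :=
  fun q => if h : (q : ℕ) < k then x ⟨q, h⟩ else false

/-- The isometry `|v₁, …, v_t⟩ ↦ |v₁ 0^(n-k), …, v_t 0^(n-k)⟩`. -/
def padIsometry (n k t : ℕ) : Matrix (Fin t → Bits n) (Fin t → Bits k) ℂ :=
  Matrix.of fun w v => if w = fun a => pad n (v a) then 1 else 0

/-- `ρ_unique,k ⊗ |0⟩⟨0| ^ ⊗ (n - k) t`. -/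
noncomputable def inputState (n k t : ℕ) : Matrix (Fin t → Bits n) (Fin t → Bits n) ℂ :=
  padIsometry n k t * rhoUnique k t * (padIsometry n k t)ᴴ

/-- The average of `U_p ^ ⊗ t ρ (U_p ^ ⊗ t)†`, with `ρ = ρ_unique,k ⊗ |0⟩⟨0| ^ ⊗ (n - k) t`, over
a seed chosen uniformly from `G`. -/
noncomputable def outputState {n k m α : ℕ} (t : ℕ) (G : Finset (Seed n k m α)) :
    Matrix (Fin t → Bits n) (Fin t → Bits n) ℂ :=
  (G.card : ℂ)⁻¹ • ∑ ω ∈ G,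
    tensorPower t (permUnitary (algorithmPerm ω)) * inputState n k t *
      (tensorPower t (permUnitary (algorithmPerm ω)))ᴴ

/-- The trace norm: the sum of the singular values. -/
noncomputable def traceNorm {ι : Type} [Fintype ι] [DecidableEq ι] (A : Matrix ι ι ℂ) : ℝ :=
  ∑ i, Real.sqrt ((Matrix.isHermitian_conjTranspose_mul_self A).eigenvalues i)

/-- The trace distance. -/
noncomputable def traceDist {ι : Type} [Fintype ι] [DecidableEq ι] (A B : Matrix ι ι ℂ) : ℝ :=
  traceNorm (A - B) / 2

/-! ### Quantum circuits and depth -/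

/-- Elementary gates on `N` qubits: arbitrary single-qubit gates and CNOT gates. -/
inductive Gate (N : ℕ) : Type
  | single (i : Fin N) (u : Matrix.unitaryGroup Bool ℂ) : Gate N
  | cnot (c q : Fin N) (h : c ≠ q) : Gate N

/-- The qubits on which a gate acts. -/
def Gate.support {N : ℕ} : Gate N → Finset (Fin N)
  | .single i _ => {i}
  | .cnot c q _ => {c, q}

/-- The unitary of a gate on the whole register. -/
def Gate.toMatrix {N : ℕ} : Gate N → Matrix (Bits N) (Bits N) ℂ
  | .single i u => Matrix.of fun y x => if ∀ j, j ≠ i → y j = x j then u.1 (y i) (x i) else 0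
  | .cnot c q h => permUnitary (RandomMCX.cnot c q h)

/-- A layer: gates on pairwise disjoint sets of qubits, executed in one time step. -/
structure Layer (N : ℕ) : Type where
  gates : List (Gate N)
  disjoint : gates.Pairwise fun g g' => Disjoint g.support g'.support

/-- The unitary of a layer (its gates commute). -/
def Layer.toMatrix {N : ℕ} (L : Layer N) : Matrix (Bits N) (Bits N) ℂ :=
  (L.gates.map Gate.toMatrix).prod

/-- The unitary of a circuit, given as the list of its layers in temporal order; its depth is the
length of this list. -/
def circuitMatrix {N : ℕ} (c : List (Layer N)) : Matrix (Bits N) (Bits N) ℂ :=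
  (c.map Layer.toMatrix).reverse.prod

/-- `U` can be implemented exactly by a circuit of depth at most `D` with `a` ancilla qubits, which
start in `|0⟩` and are returned to `|0⟩`: the circuit maps `|x⟩|0^a⟩` to `(U |x⟩)|0^a⟩`. -/
def ImplementableInDepth {n : ℕ} (U : Matrix (Bits n) (Bits n) ℂ) (a : ℕ) (D : ℝ) : Prop :=
  ∃ c : List (Layer (n + a)), (c.length : ℝ) ≤ D ∧
    ∀ (x y : Bits n) (z : Bits a),
      circuitMatrix c (Fin.append y z) (Fin.append x fun _ => false) =
        if z = fun _ => false then U y x else 0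

end RandomMCX

namespace RandomMCX

/-! ### Analytic estimates -/

/-! The proof separates the quantum state from a counting problem. `U_p` permutes basis labels, so
it carries the type state of a set to the type state of the image set, and type states are
orthonormal. Hence the trace distance is at most the total variation distance between two laws on
tables of `t` strings: the output table and the uniform table with distinct rows (`conj_inputState`,
`traceDist_le_of_lower_bound`).

Say that the sampled gates separate a table if every row has a gate that fires on it and on no other
row. Over the field with two elements the coins of one target bit then map onto all `t`-tuples of
flips, so fair coins give `t` independent uniform bits (`IsSeparating.card_coins`). Every register
is randomized while its source still holds the input, so all bits outside register `0` become
uniform once the gates separate the input. Register `1` is then a uniform table, and if the gates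
separate it too, the last step makes register `0` uniform. If a uniform table fails to be separated
with probability at most `β`, the output law therefore dominates a function of mass at least `1 -
2β`, below the uniform law as well (`exists_lower_bound_wide`; `exists_lower_bound_narrow` when `2k
> n`).

It remains to get `β ≤ ε / 3` from `O(t log (t/ε))` gates. A random gate isolates a given row with
probability at least a constant over `2 ^ m`, provided a constant fraction of the `m`-tuples of
positions distinguish that row from all others. This must hold for all rows outside an event of
probability about `ε / t`, which a first moment cannot give. Fix a row and look at `m - 3`
positions: the sum, over the other rows, of the fraction of tuples at which they agree with it has
an exponential moment with parameter `k / 31`, obtained from a quadratic bound on `v ^ l` and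
Gaussian linearization (`sum_exp_agreeFrac_le`, `card_le_sum_agreeFrac_le`). So at least `1 / 28` of
these tuples leave at most 13 agreeing rows. Three more positions reduce 13 to 6, to 2 and to 0,
each for at least `1 / 72` of the choices, by a Chernoff bound on columns and a union bound over
small sets of rows (`card_few_sparseColumns_le`, `IsSpread.card_embedding_le`).

The depth bound holds for every outcome, so the good set is everything. The gate `j` is the same for
all bits of a register, hence one MCX per register, built from Toffoli gates with unused source bits
as dirty work bits and spread by a CNOT fan-out, serves all its targets (`Realizes.register`); the
registers of one step run in parallel. Each sampled gate costs `O(log t + log k) = O(log t)` layers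
per step, a single power of `log t`, so both depth bounds follow without using any ancilla. -/

theorem add_pow_le_tangent_add_sq {x y : ℝ} (hx : 0 ≤ x) (hv : 0 ≤ x + y) (hv1 : x + y ≤ 1)
    (l : ℕ) :
    (x + y) ^ l ≤ x ^ l + l * x ^ (l - 1) * y +
      (∑ j ∈ Finset.range l, (j : ℝ) * x ^ (j - 1)) * y ^ 2 := by
  induction l with
  | zero => simp
  | succ l ih =>
    have hκ : 0 ≤ ∑ j ∈ Finset.range l, (j : ℝ) * x ^ (j - 1) :=
      Finset.sum_nonneg fun j _ => by positivity
    have hx' : (l : ℝ) * x ^ (l - 1) * x = l * x ^ l := by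
      cases l with
      | zero => simp
      | succ l => simp [pow_succ]; ring
    rw [Finset.sum_range_succ, pow_succ]
    set κ := ∑ j ∈ Finset.range l, (j : ℝ) * x ^ (j - 1)
    have h1 := mul_le_mul_of_nonneg_right ih hv
    have h2 : κ * y ^ 2 * (x + y) ≤ κ * y ^ 2 := mul_le_of_le_one_right (by positivity) hv1
    have h3 : (x ^ l + l * x ^ (l - 1) * y + κ * y ^ 2) * (x + y) =
        x ^ l * x + x ^ l * y + (l * x ^ (l - 1) * x) * y + l * x ^ (l - 1) * y ^ 2 +
          κ * y ^ 2 * (x + y) := by ring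
    rw [h3, hx'] at h1
    refine h1.trans ?_
    push_cast
    rw [pow_succ x l]
    nlinarith

/-- The parabola of the previous lemma touches `v ^ l` at `x`, and its quadratic coefficient is the
one that makes it pass through the point `(1, 1)`; the right side over `(1 - x) ^ 2` is the closed
form of that coefficient. -/
theorem sum_mul_pow_mul_sq_le (x : ℝ) (l : ℕ) :
    (∑ j ∈ Finset.range l, (j : ℝ) * x ^ (j - 1)) * (1 - x) ^ 2 ≤
      1 - l * x ^ (l - 1) + (l - 1) * x ^ l := by
  induction l with
  | zero => simp
  | succ l ih =>
    have hx' : (l : ℝ) * x ^ (l - 1) * x = l * x ^ l := by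
      cases l with
      | zero => simp
      | succ l => simp [pow_succ]; ring
    rw [Finset.sum_range_succ, add_mul]
    push_cast
    rw [pow_succ x l]
    have h3 : (l : ℝ) * x ^ (l - 1) * (1 - x) ^ 2 =
        l * x ^ (l - 1) - 2 * (l * x ^ (l - 1) * x) + (l * x ^ (l - 1) * x) * x := by ring
    rw [h3, hx']
    nlinarith

/-- Serves to complete the square in the linear term of the parabola. From `l = 3` on, the left side
shrinks by a factor at most `x` at each step, and at `l = 3` the bound reads `9 x ≤ 4.7`, where `9 *
25 / 48` is just below `4.7`. -/
theorem sq_mul_pow_le {x : ℝ} (hx : 1 / 2 ≤ x) (hx1 : x ≤ 25 / 48) (l : ℕ) (hl : 1 ≤ l) :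
    (l * x ^ (l - 1)) ^ 2 ≤ 4.7 * x ^ l := by
  have key : ∀ j : ℕ, (((j + 3 : ℕ) : ℝ) * x ^ (j + 2)) ^ 2 ≤ 4.7 * x ^ (j + 3) := by
    intro j
    induction j with
    | zero =>
      have : 0 ≤ x ^ 3 := by positivity
      push_cast
      nlinarith
    | succ j ih =>
      have hj : (0 : ℝ) ≤ j := Nat.cast_nonneg j
      have h0 : 0 < x ^ (j + 3) := by positivity
      have h1 : ((j : ℝ) + 4) ^ 2 * x ≤ (j + 3) ^ 2 := by
        have : ((j : ℝ) + 4) ^ 2 * x ≤ (j + 4) ^ 2 * (25 / 48) := by gcongr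
        nlinarith
      push_cast at ih ⊢
      have e1 : (((j : ℝ) + 1 + 3) * x ^ (j + 1 + 2)) ^ 2 =
          (((j : ℝ) + 4) ^ 2 * x) * (x ^ (j + 2)) ^ 2 * x := by ring
      have e2 : (4.7 : ℝ) * x ^ (j + 1 + 3) = 4.7 * x ^ (j + 3) * x := by ring
      rw [e1, e2]
      refine mul_le_mul_of_nonneg_right ?_ (by linarith)
      refine le_trans (mul_le_mul_of_nonneg_right h1 (by positivity)) ?_
      rw [← mul_pow]
      exact ih
  obtain rfl | rfl | h : l = 1 ∨ l = 2 ∨ 3 ≤ l := by omega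
  · norm_num; linarith
  · norm_num; nlinarith
  · obtain ⟨j, rfl⟩ := Nat.exists_eq_add_of_le' h
    exact key j

theorem sq_mul_pow_small (l : ℕ) (hl : 6 ≤ l) :
    (l : ℝ) ^ 2 * (25 / 48 : ℝ) ^ l ≤ 0.75 := by
  induction l, hl using Nat.le_induction with
  | base => norm_num
  | succ l hl ih =>
    have h6 : (6 : ℝ) ≤ l := by exact_mod_cast hl
    have h1 : ((l : ℝ) + 1) ^ 2 * (25 / 48) ≤ l ^ 2 := by nlinarith
    push_cast
    calc ((l : ℝ) + 1) ^ 2 * (25 / 48 : ℝ) ^ (l + 1)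
        = (((l : ℝ) + 1) ^ 2 * (25 / 48)) * (25 / 48 : ℝ) ^ l := by ring
      _ ≤ (l : ℝ) ^ 2 * (25 / 48 : ℝ) ^ l := by gcongr
      _ ≤ _ := ih

/-- Two regimes. If `l ^ 2 / k` is small, then `(1 + l / k) ^ l ≤ exp 0.22` and `1.083 * 1.2462 <
1.35`. Otherwise `k` is at most a multiple of `l ^ 2`, and the power, at most `(25 / 48) ^ l`, is
already below `3.72 / k`. -/
theorem shifted_pow_le {k : ℝ} {l : ℕ} (hl : 1 ≤ l) (hk : 24 * (l : ℝ) ≤ k) :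
    1.083 * (1 / 2 + l / (2 * k)) ^ l ≤ 1.35 * (1 / 2 : ℝ) ^ l + 3.72 / k := by
  have hl' : (1 : ℝ) ≤ l := by exact_mod_cast hl
  have hk0 : 0 < k := by linarith
  have hx : (1 / 2 + l / (2 * k) : ℝ) = (1 / 2) * (l / k + 1) := by field_simp; ring
  have hlk : (l : ℝ) / k ≤ 1 / 24 := by rw [div_le_iff₀ hk0]; linarith
  rcases le_or_gt ((l : ℝ) ^ 2 / k) 0.22 with h | h
  · have h1 : ((l : ℝ) / k + 1) ^ l ≤ Real.exp 0.22 := by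
      calc ((l : ℝ) / k + 1) ^ l ≤ Real.exp (l / k) ^ l := by
            gcongr; exact Real.add_one_le_exp _
        _ = Real.exp (l ^ 2 / k) := by rw [← Real.exp_nat_mul]; ring_nf
        _ ≤ _ := Real.exp_le_exp.2 h
    have h2 : Real.exp 0.22 ≤ 1.2462 := by
      have := Real.exp_bound' (x := 0.22) (by norm_num) (by norm_num) (n := 5) (by norm_num)
      refine this.trans ?_
      norm_num [Finset.sum_range_succ, Nat.factorial]
    have h3 : 0 < 3.72 / k := by positivity
    have h4 : (0 : ℝ) < (1 / 2) ^ l := by positivity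
    rw [hx, mul_pow]
    nlinarith
  · rw [lt_div_iff₀ hk0] at h
    have h6 : 6 ≤ l := by
      by_contra hc
      have : (l : ℝ) ≤ 5 := by exact_mod_cast (by omega : l ≤ 5)
      nlinarith
    have h7 := sq_mul_pow_small l h6
    have h8 : (1 / 2 + l / (2 * k) : ℝ) ^ l ≤ (25 / 48) ^ l := by
      rw [hx]; gcongr; linarith
    have h9 : 1.083 * (25 / 48 : ℝ) ^ l ≤ 3.72 / k := by
      rw [le_div_iff₀ hk0]
      have h10 : (0 : ℝ) < (25 / 48) ^ l := by positivity
      have h11 : k ≤ l ^ 2 / 0.22 := by rw [le_div_iff₀ (by norm_num)]; linarith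
      calc 1.083 * (25 / 48 : ℝ) ^ l * k ≤ 1.083 * (25 / 48 : ℝ) ^ l * (l ^ 2 / 0.22) := by gcongr
        _ = 1.083 / 0.22 * (l ^ 2 * (25 / 48 : ℝ) ^ l) := by ring
        _ ≤ 1.083 / 0.22 * 0.75 := by gcongr
        _ ≤ 3.72 := by norm_num
    have h12 : (0 : ℝ) < (1 / 2) ^ l := by positivity
    nlinarith

/-- The centre `1 / 2 + l / (2k)` is the mean agreement density of a random string forced to agree
at `l` of `k` positions, so the quadratic term is a variance term. To its left monotonicity
suffices; to its right the tangent parabola is used. The coefficient `18.6` is `4.4` from the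
curvature plus `14.2` from completing the square. -/
theorem pow_le_quadratic {k v : ℝ} {l : ℕ} (hl : 1 ≤ l) (hk : 24 * (l : ℝ) ≤ k) (hv : 0 ≤ v)
    (hv1 : v ≤ 1) :
    v ^ l ≤ 1.35 * (1 / 2 : ℝ) ^ l + 18.6 * (v - (1 / 2 + l / (2 * k))) ^ 2 + 3.72 / k := by
  have hl' : (1 : ℝ) ≤ l := by exact_mod_cast hl
  have hk0 : 0 < k := by linarith
  have h0 := shifted_pow_le hl hk
  have hx1 : (1 / 2 + l / (2 * k) : ℝ) ≤ 25 / 48 := by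
    have : (l : ℝ) / (2 * k) ≤ 1 / 48 := by rw [div_le_iff₀ (by positivity)]; linarith
    linarith
  have hx0 : (1 / 2 : ℝ) ≤ 1 / 2 + l / (2 * k) := by
    have : 0 ≤ (l : ℝ) / (2 * k) := by positivity
    linarith
  set x : ℝ := 1 / 2 + l / (2 * k)
  have hxl : 0 < x ^ l := by positivity
  rcases le_or_gt v x with h | h
  · have h1 : v ^ l ≤ x ^ l := by gcongr
    nlinarith [sq_nonneg (v - x)]
  · have h1 := add_pow_le_tangent_add_sq (x := x) (y := v - x) (by linarith) (by linarith)
      (by linarith) l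
    rw [add_sub_cancel] at h1
    have h2 := sum_mul_pow_mul_sq_le x l
    set κ := ∑ j ∈ Finset.range l, (j : ℝ) * x ^ (j - 1)
    have hκ : 0 ≤ κ := Finset.sum_nonneg fun j _ => by positivity
    -- Since `x ≤ 25 / 48`, the closed form gives at most `(48 / 23) ^ 2`.
    have h3 : κ ≤ 4.4 := by
      have h4 : ((l : ℝ) - 1) * x ^ l ≤ l * x ^ (l - 1) := by
        have : x ^ l ≤ x ^ (l - 1) := pow_le_pow_of_le_one (by linarith) (by linarith) (by omega)
        nlinarith
      have h5 : (23 / 48 : ℝ) ^ 2 ≤ (1 - x) ^ 2 := by gcongr; linarith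
      nlinarith
    have h6 := sq_mul_pow_le hx0 hx1 l hl
    set w := (l : ℝ) * x ^ (l - 1)
    set d := v - x
    -- The weights satisfy `4 * (71 / 5) * (5 / 284) = 1`, and `5 / 284 * 4.7 < 0.083` produces the
    -- factor `1.083` of `shifted_pow_le`.
    have h7 : w * d ≤ 71 / 5 * d ^ 2 + 5 / 284 * w ^ 2 := by
      nlinarith [sq_nonneg (5 / 142 * w - d)]
    have h8 : κ * d ^ 2 ≤ 4.4 * d ^ 2 := by gcongr
    linarith

/-- The range `s ≤ k / 31` turns the coefficients into `18.6 / 31 = 0.6` and `3.72 / 31 = 0.12`. The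
first is small enough for the Gaussian integral below to converge. -/
theorem mul_pow_le_quadratic {k v s : ℝ} {l : ℕ} (hl : 1 ≤ l) (hk : 24 * (l : ℝ) ≤ k)
    (hv : 0 ≤ v) (hv1 : v ≤ 1) (hs : 0 ≤ s) (hsk : s ≤ k / 31) :
    s * v ^ l ≤ 1.35 * s * (1 / 2 : ℝ) ^ l +
      (0.6 * k * (v - (1 / 2 + l / (2 * k))) ^ 2 + 0.12) := by
  have hl' : (1 : ℝ) ≤ l := by exact_mod_cast hl
  have hk0 : 0 < k := by linarith
  have h := mul_le_mul_of_nonneg_left (pow_le_quadratic hl hk hv hv1) hs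
  set q := (v - (1 / 2 + l / (2 * k))) ^ 2
  have hq : 0 ≤ q := sq_nonneg _
  have h1 : s * (18.6 * q + 3.72 / k) ≤ k / 31 * (18.6 * q + 3.72 / k) := by gcongr
  have h2 : k / 31 * (18.6 * q + 3.72 / k) = 0.6 * k * q + 0.12 := by field_simp; ring
  nlinarith

/-! ### Squares of Gaussian and of Rademacher sums -/

-- The integrand times the density is an unnormalized Gaussian of variance `1 / (1 - c)`.
open MeasureTheory ProbabilityTheory in
theorem integrable_exp_sq_gaussianReal {c : ℝ} (hc : c < 1) :
    Integrable (fun g : ℝ => Real.exp (c * g ^ 2 / 2)) (gaussianReal 0 1) ∧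
      ∫ g : ℝ, Real.exp (c * g ^ 2 / 2) ∂gaussianReal 0 1 = (Real.sqrt (1 - c))⁻¹ := by
  have hfun : (fun g : ℝ => gaussianPDFReal 0 1 g * Real.exp (c * g ^ 2 / 2)) =
      fun g => (Real.sqrt (2 * Real.pi))⁻¹ * Real.exp (-((1 - c) / 2) * g ^ 2) := by
    ext g
    simp only [gaussianPDFReal, NNReal.coe_one, mul_one, sub_zero]
    rw [mul_assoc, ← Real.exp_add]
    congr 2
    ring
  constructor
  · rw [gaussianReal_of_var_ne_zero _ one_ne_zero]
    rw [integrable_withDensity_iff_integrable_smul₀' (measurable_gaussianPDF _ _).aemeasurable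
      (ae_of_all _ fun x => gaussianPDF_lt_top)]
    simp only [toReal_gaussianPDF, smul_eq_mul]
    rw [hfun]
    exact (integrable_exp_neg_mul_sq (by linarith)).const_mul _
  · rw [integral_gaussianReal_eq_integral_smul one_ne_zero]
    simp only [smul_eq_mul]
    rw [hfun, integral_const_mul, integral_gaussian, ← Real.sqrt_inv, ← Real.sqrt_mul (by positivity),
      ← Real.sqrt_inv]
    congr 1
    have : 1 - c ≠ 0 := by linarith
    field_simp

/-- The sign that records whether two bits agree. -/
def agreeSign (a b : Bool) : ℝ := if a = b then 1 else -1

-- Gaussian linearization: `exp (c u ^ 2 / 2)` is the mean of `exp (√c u g)` over a standard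
-- Gaussian `g`. For fixed `g` the sum over `y` factors over the positions into hyperbolic cosines,
-- and `cosh z ≤ exp (z ^ 2 / 2)` leads back to the Gaussian integral above.
open MeasureTheory ProbabilityTheory in
theorem sum_exp_sq_agreeSign_le {k : ℕ} (x : Bits k) (R : Finset (Fin k)) {c : ℝ} (hc : 0 ≤ c)
    (hck : c * Rᶜ.card < 1) :
    ∑ y : Bits k, (if ∀ i ∈ R, y i = x i then
        Real.exp (c * (∑ i ∈ Rᶜ, agreeSign (y i) (x i)) ^ 2 / 2) else 0) ≤
      2 ^ Rᶜ.card * (Real.sqrt (1 - c * Rᶜ.card))⁻¹ := by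
  have hI : ∀ u : ℝ, Integrable (fun g : ℝ => Real.exp (u * g)) (gaussianReal 0 1) :=
    fun u => integrable_exp_mul_gaussianReal u
  have hlift : ∀ u : ℝ, Real.exp (c * u ^ 2 / 2) =
      ∫ g : ℝ, Real.exp (Real.sqrt c * u * g) ∂gaussianReal 0 1 := by
    intro u
    have := congrFun (mgf_id_gaussianReal (μ := 0) (v := 1)) (Real.sqrt c * u)
    simp only [mgf, id, zero_mul, zero_add, NNReal.coe_one, one_mul, mul_pow,
      Real.sq_sqrt hc] at this
    exact this.symm
  have hprod : ∀ g : ℝ, ∑ y : Bits k, (if ∀ i ∈ R, y i = x i then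
      Real.exp (Real.sqrt c * (∑ i ∈ Rᶜ, agreeSign (y i) (x i)) * g) else 0) =
      (2 * Real.cosh (Real.sqrt c * g)) ^ Rᶜ.card := by
    intro g
    have h1 : ∀ y : Bits k, (if ∀ i ∈ R, y i = x i then
      Real.exp (Real.sqrt c * (∑ i ∈ Rᶜ, agreeSign (y i) (x i)) * g) else 0) =
      ∏ i, (if i ∈ R then (if y i = x i then 1 else 0) else
        Real.exp (Real.sqrt c * g * agreeSign (y i) (x i))) := by
      intro y
      rw [Finset.prod_ite, Finset.prod_ite_zero, ← Real.exp_sum, ← Finset.mul_sum]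
      have e1 : Finset.univ.filter (fun i => i ∈ R) = R := by ext; simp
      have e2 : Finset.univ.filter (fun i => i ∉ R) = Rᶜ := by ext; simp
      rw [e1, e2]
      by_cases h : ∀ i ∈ R, y i = x i
      · simp only [if_pos h, Finset.prod_const_one, one_mul]; congr 1; ring
      · simp only [if_neg h, zero_mul]
    simp only [h1]
    rw [← Fintype.prod_sum (fun i b => (if i ∈ R then (if b = x i then (1 : ℝ) else 0) else
        Real.exp (Real.sqrt c * g * agreeSign b (x i))))]
    have h2 : ∀ i, ∑ b : Bool, (if i ∈ R then (if b = x i then (1 : ℝ) else 0) else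
        Real.exp (Real.sqrt c * g * agreeSign b (x i))) =
        if i ∈ Rᶜ then 2 * Real.cosh (Real.sqrt c * g) else 1 := by
      intro i
      by_cases h : i ∈ R
      · simp [h]
      · have : i ∈ Rᶜ := by simpa using h
        rw [if_pos this]
        simp only [h, if_false, Fintype.sum_bool, agreeSign, Real.cosh_eq]
        cases x i <;> simp <;> ring
    simp only [h2]
    rw [Finset.prod_ite_mem, Finset.univ_inter, Finset.prod_const]
  have hsum : ∑ y : Bits k, (if ∀ i ∈ R, y i = x i then
        Real.exp (c * (∑ i ∈ Rᶜ, agreeSign (y i) (x i)) ^ 2 / 2) else 0) =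
      ∫ g : ℝ, (2 * Real.cosh (Real.sqrt c * g)) ^ Rᶜ.card ∂gaussianReal 0 1 := by
    simp only [← hprod]
    rw [integral_finsetSum]
    · refine Finset.sum_congr rfl fun y _ => ?_
      split_ifs
      · exact hlift _
      · simp
    · intro y _
      split_ifs
      · exact hI _
      · simp
  rw [hsum]
  obtain ⟨hi, he⟩ := integrable_exp_sq_gaussianReal hck
  rw [← he, ← integral_const_mul]
  refine integral_mono_of_nonneg (ae_of_all _ fun g => ?_) (hi.const_mul _) (ae_of_all _ fun g => ?_)
  · have := Real.cosh_pos (Real.sqrt c * g)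
    simp only [Pi.zero_apply]; positivity
  · simp only [mul_pow]
    refine mul_le_mul_of_nonneg_left ?_ (by positivity)
    calc Real.cosh (Real.sqrt c * g) ^ Rᶜ.card
        ≤ Real.exp ((Real.sqrt c * g) ^ 2 / 2) ^ Rᶜ.card := by
          gcongr
          exact Real.cosh_le_exp_half_sq _
      _ = _ := by
          rw [← Real.exp_nat_mul, mul_pow, Real.sq_sqrt hc]; congr 1; ring

/-! ### The agreement fraction of two strings -/

/-- The two strings agree at the sampled positions. -/
def Agrees {l k : ℕ} (S : Fin l ↪ Fin k) (x y : Bits k) : Prop := ∀ i, y (S i) = x (S i)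

instance {l k : ℕ} (S : Fin l ↪ Fin k) (x y : Bits k) : Decidable (Agrees S x y) :=
  inferInstanceAs (Decidable (∀ i, y (S i) = x (S i)))

/-- The fraction of the `l`-tuples of positions at which the two strings agree. -/
noncomputable def agreeFrac {k : ℕ} (l : ℕ) (x y : Bits k) : ℝ :=
  (Finset.univ.filter fun S : Fin l ↪ Fin k => Agrees S x y).card /
    (Fintype.card (Fin l ↪ Fin k) : ℝ)

theorem card_filter_agrees {k : ℕ} (l : ℕ) (x y : Bits k) :
    (Finset.univ.filter fun S : Fin l ↪ Fin k => Agrees S x y).card =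
      (Finset.univ.filter fun i => y i = x i).card.descFactorial l := by
  have h := Fintype.card_embedding_eq (α := Fin l) (β := {i // y i = x i})
  rw [Fintype.card_subtype, Fintype.card_fin] at h
  rw [← h, ← Fintype.card_subtype]
  refine Fintype.card_congr ⟨fun S => ⟨fun i => ⟨S.1 i, S.2 i⟩, fun a b hab => ?_⟩,
    fun S => ⟨⟨fun i => (S i).1, fun a b hab => ?_⟩, fun i => (S i).2⟩, fun S => rfl, fun S => rfl⟩
  · exact S.1.injective (congrArg Subtype.val hab)
  · exact S.injective (Subtype.ext hab)

/-- Sampling without replacement hits a subset less often than sampling with replacement: `(d - i) /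
(k - i) ≤ d / k` factor by factor. -/
theorem descFactorial_mul_pow_le {d k : ℕ} (h : d ≤ k) (l : ℕ) :
    d.descFactorial l * k ^ l ≤ d ^ l * k.descFactorial l := by
  induction l with
  | zero => simp
  | succ l ih =>
    rw [Nat.descFactorial_succ, Nat.descFactorial_succ, pow_succ, pow_succ]
    have h1 : (d - l) * k ≤ d * (k - l) := by
      rw [Nat.sub_mul, Nat.mul_sub]
      have : d * l ≤ l * k := by rw [mul_comm d l]; exact Nat.mul_le_mul_left l h
      omega
    calc (d - l) * d.descFactorial l * (k ^ l * k)
        = (d.descFactorial l * k ^ l) * ((d - l) * k) := by ring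
      _ ≤ (d ^ l * k.descFactorial l) * (d * (k - l)) := Nat.mul_le_mul ih h1
      _ = _ := by ring

theorem agreeFrac_le_pow {k l : ℕ} (hl : l ≤ k) (x y : Bits k) :
    agreeFrac l x y ≤ (((Finset.univ.filter fun i => y i = x i).card : ℝ) / k) ^ l := by
  unfold agreeFrac
  rw [card_filter_agrees, Fintype.card_embedding_eq, Fintype.card_fin, Fintype.card_fin]
  have hd : (Finset.univ.filter fun i => y i = x i).card ≤ k := by
    simpa using Finset.card_le_univ (Finset.univ.filter fun i => y i = x i)
  have h := descFactorial_mul_pow_le hd l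
  have h0 : 0 < k.descFactorial l := Nat.descFactorial_pos.2 hl
  rcases Nat.eq_zero_or_pos l with rfl | hl0
  · simp
  have hk : 0 < k := by omega
  rw [div_pow, div_le_div_iff₀ (by exact_mod_cast h0) (by positivity)]
  exact_mod_cast h

/-- Agreement at `S` fixes `l` bits and leaves the others free, so the agreement density is its mean
plus a Rademacher sum over `2k`. The quadratic bound reduces the exponential to that of a square of
this sum. -/
theorem sum_agrees_exp_agreeFrac_le {k l : ℕ} (hl : 1 ≤ l) (hk : 24 * l ≤ k) (x : Bits k)
    (S : Fin l ↪ Fin k) {s : ℝ} (hs : 0 ≤ s) (hsk : s ≤ k / 31) :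
    ∑ y : Bits k, (if Agrees S x y then Real.exp (s * agreeFrac l x y) else 0) ≤
      2 ^ k * (1 / 2) ^ l * (1.35 * Real.exp (1.35 * s * (1 / 2) ^ l)) := by
  have hk0 : 0 < k := by omega
  have hkr : (0 : ℝ) < k := by exact_mod_cast hk0
  have hkl : 24 * (l : ℝ) ≤ k := by exact_mod_cast hk
  set R : Finset (Fin k) := Finset.univ.map S
  have hR : R.card = l := by simp [R]
  have hRc : Rᶜ.card = k - l := by rw [Finset.card_compl, hR, Fintype.card_fin]
  have hRcr : (Rᶜ.card : ℝ) = k - l := by rw [hRc, Nat.cast_sub (by omega)]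
  -- A deviation `Σ / (2k)` of the density contributes `0.6 k (Σ / (2k)) ^ 2`, which is `c Σ ^ 2 /
  -- 2` for this `c`. Then `1 - c * (k - l) ≥ 0.7`, whose root exceeds `0.8366`.
  set c : ℝ := 0.3 / k
  have hc : 0 ≤ c := by positivity
  have hcR : c * Rᶜ.card ≤ 0.3 := by
    rw [hRcr]; simp only [c]; rw [div_mul_eq_mul_div, div_le_iff₀ hkr]
    have : (0 : ℝ) ≤ l := Nat.cast_nonneg l
    linarith
  have hAg : ∀ y, Agrees S x y ↔ ∀ i ∈ R, y i = x i := by intro y; simp [R, Agrees]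
  have key : ∀ y, Agrees S x y → s * agreeFrac l x y ≤
      1.35 * s * (1 / 2) ^ l + 0.12 +
        c * (∑ i ∈ Rᶜ, agreeSign (y i) (x i)) ^ 2 / 2 := by
    intro y hy
    rw [hAg] at hy
    set D := (Finset.univ.filter fun i => y i = x i).card
    have hD : (D : ℝ) = l + (Rᶜ.card + ∑ i ∈ Rᶜ, agreeSign (y i) (x i)) / 2 := by
      have h1 : (D : ℝ) = ∑ i, if y i = x i then 1 else 0 := by simp [D]
      rw [h1, ← Finset.sum_add_sum_compl R]
      have h2 : ∑ i ∈ R, (if y i = x i then (1 : ℝ) else 0) = l := by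
        rw [Finset.sum_congr rfl fun i hi => if_pos (hy i hi)]; simp [hR]
      have h3 : ∑ i ∈ Rᶜ, (if y i = x i then (1 : ℝ) else 0) =
          ∑ i ∈ Rᶜ, (1 + agreeSign (y i) (x i)) / 2 :=
        Finset.sum_congr rfl fun i _ => by unfold agreeSign; split_ifs <;> norm_num
      rw [h2, h3, ← Finset.sum_div, Finset.sum_add_distrib]
      simp
    have hDk : D ≤ k := by simpa using Finset.card_le_univ (Finset.univ.filter fun i => y i = x i)
    have h1 : s * agreeFrac l x y ≤ s * ((D : ℝ) / k) ^ l :=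
      mul_le_mul_of_nonneg_left (agreeFrac_le_pow (by omega) x y) hs
    have h2 := mul_pow_le_quadratic (v := (D : ℝ) / k) hl hkl (by positivity)
      (by rw [div_le_one hkr]; exact_mod_cast hDk) hs hsk
    have h3 : 0.6 * (k : ℝ) * ((D : ℝ) / k - (1 / 2 + l / (2 * k))) ^ 2 =
        c * (∑ i ∈ Rᶜ, agreeSign (y i) (x i)) ^ 2 / 2 := by
      rw [hD, hRcr]; simp only [c]; field_simp; ring
    linarith
  calc ∑ y : Bits k, (if Agrees S x y then Real.exp (s * agreeFrac l x y) else 0)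
      ≤ ∑ y : Bits k, Real.exp (1.35 * s * (1 / 2) ^ l + 0.12) * (if ∀ i ∈ R, y i = x i then
        Real.exp (c * (∑ i ∈ Rᶜ, agreeSign (y i) (x i)) ^ 2 / 2) else 0) := by
        refine Finset.sum_le_sum fun y _ => ?_
        by_cases h : Agrees S x y
        · rw [if_pos h, if_pos ((hAg y).1 h), ← Real.exp_add]
          exact Real.exp_le_exp.2 (key y h)
        · rw [if_neg h, if_neg (fun h' => h ((hAg y).2 h')), mul_zero]
    _ ≤ Real.exp (1.35 * s * (1 / 2) ^ l + 0.12) *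
        (2 ^ Rᶜ.card * (Real.sqrt (1 - c * Rᶜ.card))⁻¹) := by
        rw [← Finset.mul_sum]
        exact mul_le_mul_of_nonneg_left (sum_exp_sq_agreeSign_le x R hc (by linarith))
          (Real.exp_pos _).le
    _ ≤ Real.exp (1.35 * s * (1 / 2) ^ l + 0.12) *
        (2 ^ Rᶜ.card * (0.8366 : ℝ)⁻¹) := by
        gcongr
        apply Real.le_sqrt_of_sq_le
        norm_num; linarith
    _ = 2 ^ Rᶜ.card * ((Real.exp 0.12 * (0.8366 : ℝ)⁻¹) * Real.exp (1.35 * s * (1 / 2) ^ l)) := by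
        rw [Real.exp_add]; ring
    _ ≤ 2 ^ Rᶜ.card * (1.35 * Real.exp (1.35 * s * (1 / 2) ^ l)) := by
        have h2 : Real.exp 0.12 ≤ 1.1276 := by
          have := Real.exp_bound' (x := 0.12) (by norm_num) (by norm_num) (n := 5) (by norm_num)
          refine this.trans ?_
          norm_num [Finset.sum_range_succ, Nat.factorial]
        gcongr
        calc Real.exp 0.12 * (0.8366 : ℝ)⁻¹ ≤ 1.1276 * (0.8366 : ℝ)⁻¹ := by gcongr
          _ ≤ 1.35 := by norm_num
    _ = _ := by
        congr 1
        rw [hRc, one_div, inv_pow, ← div_eq_mul_inv]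
        exact pow_sub₀ 2 two_ne_zero (by omega)

/-- Size biasing: the factor `agreeFrac` is an average over tuples `S` of the indicator of agreement
at `S`, so the previous bound applies for each `S` separately. -/
theorem sum_agreeFrac_mul_exp_le {k l : ℕ} (hl : 1 ≤ l) (hk : 24 * l ≤ k) (x : Bits k)
    {s : ℝ} (hs : 0 ≤ s) (hsk : s ≤ k / 31) :
    ∑ y : Bits k, agreeFrac l x y * Real.exp (s * agreeFrac l x y) ≤
      2 ^ k * (1 / 2) ^ l * (1.35 * Real.exp (1.35 * s * (1 / 2) ^ l)) := by
  have hE : 0 < (Fintype.card (Fin l ↪ Fin k) : ℝ) := by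
    rw [Fintype.card_embedding_eq, Fintype.card_fin, Fintype.card_fin]
    exact_mod_cast Nat.descFactorial_pos.2 (by omega)
  have h1 : ∀ y : Bits k, agreeFrac l x y * Real.exp (s * agreeFrac l x y) =
      (∑ S : Fin l ↪ Fin k, if Agrees S x y then Real.exp (s * agreeFrac l x y) else 0) /
        Fintype.card (Fin l ↪ Fin k) := by
    intro y
    rw [← Finset.sum_filter, Finset.sum_const, nsmul_eq_mul]
    generalize Real.exp (s * agreeFrac l x y) = e
    rw [agreeFrac]
    ring
  simp only [h1]
  rw [← Finset.sum_div, div_le_iff₀ hE, Finset.sum_comm]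
  calc _ ≤ ∑ S : Fin l ↪ Fin k,
        2 ^ k * (1 / 2 : ℝ) ^ l * (1.35 * Real.exp (1.35 * s * (1 / 2) ^ l)) :=
        Finset.sum_le_sum fun S _ => sum_agrees_exp_agreeFrac_le hl hk x S hs hsk
    _ = _ := by rw [Finset.sum_const, nsmul_eq_mul, Finset.card_univ]; ring

/-- The previous lemma bounds the derivative in `s` of the left side, with `s` in place of `k / 31`,
by the derivative of the right side. Both sides equal `2 ^ k` at `s = 0`, so it suffices to
integrate up to `k / 31`. -/
theorem sum_exp_agreeFrac_le {k l : ℕ} (hk : 24 * l ≤ k) (x : Bits k) :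
    ∑ y : Bits k, Real.exp (k / 31 * agreeFrac l x y) ≤
      2 ^ k * Real.exp (1.35 * (k / 31) * (1 / 2) ^ l) := by
  rcases Nat.eq_zero_or_pos l with rfl | hl
  · have : ∀ y : Bits k, agreeFrac 0 x y = 1 := by
      intro y; simp [agreeFrac, Agrees]
    simp only [this]
    rw [Finset.sum_const, nsmul_eq_mul]
    simp only [Finset.card_univ, Fintype.card_pi, Fintype.card_bool, Finset.prod_const,
      Fintype.card_fin]
    push_cast
    gcongr
    have : (0 : ℝ) ≤ k / 31 := by positivity
    · linarith
    · simp
  set F : ℝ → ℝ := fun s => 2 ^ k * Real.exp (1.35 * s * (1 / 2) ^ l) -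
    ∑ y : Bits k, Real.exp (s * agreeFrac l x y)
  have hd : ∀ s, HasDerivAt F (2 ^ k * (Real.exp (1.35 * s * (1 / 2) ^ l) * (1.35 * (1 / 2) ^ l)) -
      ∑ y : Bits k, Real.exp (s * agreeFrac l x y) * agreeFrac l x y) s := by
    intro s
    refine HasDerivAt.sub (HasDerivAt.const_mul _ (HasDerivAt.exp ?_))
      (HasDerivAt.fun_sum fun y _ => HasDerivAt.exp ?_)
    · have := ((hasDerivAt_id s).const_mul (1.35 : ℝ)).mul_const ((1 / 2 : ℝ) ^ l)
      simpa using this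
    · simpa using (hasDerivAt_id s).mul_const (agreeFrac l x y)
  have hmono : MonotoneOn F (Set.Icc 0 (k / 31)) := by
    apply monotoneOn_of_deriv_nonneg (convex_Icc _ _)
    · exact fun s _ => (hd s).continuousAt.continuousWithinAt
    · exact fun s _ => (hd s).differentiableAt.differentiableWithinAt
    · intro s hs
      rw [interior_Icc] at hs
      rw [(hd s).deriv, sub_nonneg]
      have := sum_agreeFrac_mul_exp_le hl hk x hs.1.le hs.2.le
      simp only [mul_comm (Real.exp (_ * agreeFrac l x _))]
      refine this.trans (le_of_eq ?_)
      ring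
  have h0 : (0 : ℝ) ≤ k / 31 := by positivity
  have := hmono ⟨le_refl _, h0⟩ ⟨h0, le_refl _⟩ h0
  have hF0 : F 0 = 0 := by simp [F]
  rw [hF0] at this
  simp only [F] at this
  linarith

/-! ### Columns of a random table -/

/-- The number of rows in `W` whose entry in the column `col` agrees with that of row `a`. -/
def agreeCount {t : ℕ} (a : Fin t) (W : Finset (Fin t)) (col : Fin t → Bool) : ℕ :=
  (W.filter fun b => col b = col a).card

/-- Flipping the entry of row `b` exchanges agreement and disagreement with row `a` and preserves
`P`. -/
theorem card_flip_half {t : ℕ} {a b : Fin t} (hab : b ≠ a) (P : (Fin t → Bool) → Prop)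
    [DecidablePred P] (hP : ∀ col, P (Function.update col b (!col b)) ↔ P col) :
    2 * (Finset.univ.filter fun col => col b = col a ∧ P col).card =
        (Finset.univ.filter P).card ∧
      2 * (Finset.univ.filter fun col => ¬ col b = col a ∧ P col).card =
        (Finset.univ.filter P).card := by
  have h1 : (Finset.univ.filter fun col : Fin t → Bool => col b = col a ∧ P col).card =
      (Finset.univ.filter fun col => ¬ col b = col a ∧ P col).card := by
    have hinv : ∀ col : Fin t → Bool, Function.update (Function.update col b (!col b)) b
        (!(Function.update col b (!col b)) b) = col := by intro col; simp
    have hne : ∀ col : Fin t → Bool, Function.update col b (!col b) a = col a :=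
      fun col => Function.update_of_ne (Ne.symm hab) _ _
    refine Finset.card_bij' (fun col _ => Function.update col b (!col b))
      (fun col _ => Function.update col b (!col b)) ?_ ?_ (fun col _ => hinv col)
      (fun col _ => hinv col)
    · intro col hc
      simp only [Finset.mem_filter, Finset.mem_univ, true_and] at hc ⊢
      rw [hP, hne, Function.update_self, ← hc.1]
      exact ⟨by simp, hc.2⟩
    · intro col hc
      simp only [Finset.mem_filter, Finset.mem_univ, true_and] at hc ⊢
      rw [hP, hne, Function.update_self]
      refine ⟨?_, hc.2⟩
      have := hc.1
      revert this
      cases col b <;> cases col a <;> simp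
  have h2 := Finset.card_filter_add_card_filter_not (s := Finset.univ.filter P)
    (fun col => col b = col a)
  rw [Finset.filter_filter, Finset.filter_filter] at h2
  simp only [and_comm (a := P _)] at h2
  omega

/-- In a uniform column the agreements of the rows of `W` with row `a` are independent fair coins,
so the count is binomial. The induction adds one row and is Pascal's rule. -/
theorem card_agreeCount_le {t : ℕ} (a : Fin t) (W : Finset (Fin t)) (ha : a ∉ W) (j : ℕ) :
    (Finset.univ.filter fun col => agreeCount a W col ≤ j).card * 2 ^ W.card =
      2 ^ t * ∑ i ∈ Finset.range (j + 1), W.card.choose i := by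
  induction W using Finset.induction_on generalizing j with
  | empty =>
    simp [agreeCount, Finset.sum_range_succ']
  | insert b W hb ih =>
    have hba : b ≠ a := by rintro rfl; exact ha (Finset.mem_insert_self _ _)
    have haW : a ∉ W := fun h => ha (Finset.mem_insert_of_mem h)
    have hflip : ∀ col : Fin t → Bool,
        agreeCount a W (Function.update col b (!col b)) = agreeCount a W col := by
      intro col
      unfold agreeCount
      congr 1
      refine Finset.filter_congr fun c hc => ?_
      have : c ≠ b := by rintro rfl; exact hb hc
      rw [Function.update_of_ne this, Function.update_of_ne (Ne.symm hba)]
    have hins : ∀ col : Fin t → Bool, agreeCount a (insert b W) col =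
        agreeCount a W col + if col b = col a then 1 else 0 := by
      intro col
      unfold agreeCount
      rw [Finset.filter_insert]
      split_ifs
      · rw [Finset.card_insert_of_notMem (by simp [hb])]
      · simp
    have hhalf := fun j => card_flip_half hba (fun col => agreeCount a W col ≤ j)
      (fun col => by rw [hflip])
    rw [Finset.card_insert_of_notMem hb, pow_succ]
    cases j with
    | zero =>
      have e : (Finset.univ.filter fun col => agreeCount a (insert b W) col ≤ 0) =
          Finset.univ.filter fun col => ¬ col b = col a ∧ agreeCount a W col ≤ 0 := by
        ext col
        simp only [Finset.mem_filter, Finset.mem_univ, true_and, hins]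
        split_ifs <;> simp_all
      have h1 := (hhalf 0).2
      have h2 := ih haW 0
      rw [e]
      simp only [zero_add, Finset.range_one, Finset.sum_singleton, Nat.choose_zero_right] at h2 ⊢
      rw [← h1] at h2
      linarith
    | succ j =>
      have e : (Finset.univ.filter fun col => agreeCount a (insert b W) col ≤ j + 1) =
          (Finset.univ.filter fun col => col b = col a ∧ agreeCount a W col ≤ j) ∪
          Finset.univ.filter fun col => ¬ col b = col a ∧ agreeCount a W col ≤ j + 1 := by
        ext col
        simp only [Finset.mem_filter, Finset.mem_univ, true_and, hins, Finset.mem_union]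
        split_ifs <;> simp_all
      have hdis : Disjoint
          (Finset.univ.filter fun col : Fin t → Bool => col b = col a ∧ agreeCount a W col ≤ j)
          (Finset.univ.filter fun col => ¬ col b = col a ∧ agreeCount a W col ≤ j + 1) := by
        rw [Finset.disjoint_left]
        intro col h1 h2
        simp only [Finset.mem_filter] at h1 h2
        exact h2.2.1 h1.2.1
      rw [e, Finset.card_union_of_disjoint hdis]
      have h1 := (hhalf j).1
      have h1' := (hhalf (j + 1)).2
      have h2 := ih haW j
      have h2' := ih haW (j + 1)
      rw [← h1] at h2
      rw [← h1'] at h2'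
      have h3 : ∑ i ∈ Finset.range (j + 1 + 1), (W.card + 1).choose i =
          ∑ i ∈ Finset.range (j + 1), W.card.choose i +
            ∑ i ∈ Finset.range (j + 1 + 1), W.card.choose i := by
        rw [Finset.sum_range_succ', Finset.sum_range_succ' (fun i => W.card.choose i) (j + 1)]
        simp only [Nat.choose_succ_succ', Finset.sum_add_distrib, Nat.choose_zero_right]
        ring
      rw [h3, mul_add, ← h2, ← h2']
      ring

/-- The columns at which at most `w'` rows of `W` agree with row `a`. -/
def sparseColumns {t k : ℕ} (v : Fin t → Bits k) (a : Fin t) (W : Finset (Fin t)) (w' : ℕ) :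
    Finset (Fin k) :=
  Finset.univ.filter fun i => agreeCount a W (fun b => v b i) ≤ w'

theorem card_few_sparseColumns_le {t k w w' : ℕ} (a : Fin t) (W : Finset (Fin t)) (ha : a ∉ W)
    (hW : W.card ≤ w) {h : ℝ}
    (hh : ∀ n ≤ w, 1 - 63 / 64 * (((∑ i ∈ Finset.range (w' + 1), n.choose i : ℕ) : ℝ) / 2 ^ n) ≤ h)
    (hnum : h ^ 24 * 2 ^ (w + 6) ≤ 1) :
    ((Finset.univ.filter fun v : Fin t → Bits k => 72 * (sparseColumns v a W w').card < k).card : ℝ)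
      ≤ 2 ^ (t * k) * (2 : ℝ) ^ (-(((w : ℝ) + 4) / 24 * k)) := by
  set ψ : (Fin t → Bool) → ℝ := fun col => if agreeCount a W col ≤ w' then 1 / 64 else 1
  have hψ : ∑ col, ψ col ≤ 2 ^ t * h := by
    have e : ∀ col, ψ col = 1 - 63 / 64 * (if agreeCount a W col ≤ w' then 1 else 0) := by
      intro col; simp only [ψ]; split_ifs <;> norm_num
    simp only [e]
    rw [Finset.sum_sub_distrib, ← Finset.mul_sum, Finset.sum_boole]
    have h1 := card_agreeCount_le a W ha w'
    have h2 : ((Finset.univ.filter fun col => agreeCount a W col ≤ w').card : ℝ) =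
        2 ^ t * (((∑ i ∈ Finset.range (w' + 1), W.card.choose i : ℕ) : ℝ) / 2 ^ W.card) := by
      rw [mul_div_assoc', eq_div_iff (by positivity)]
      exact_mod_cast h1
    rw [h2]
    have h3 := hh _ hW
    have h4 : (0 : ℝ) < 2 ^ t := by positivity
    simp only [Finset.sum_const, Finset.card_univ, Fintype.card_pi, Fintype.card_bool,
      Finset.prod_const, Fintype.card_fin, nsmul_eq_mul, mul_one]
    push_cast at h3 ⊢
    nlinarith
  have hsum : ∑ v : Fin t → Bits k, (1 / 64 : ℝ) ^ (sparseColumns v a W w').card =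
      (∑ col, ψ col) ^ k := by
    have h1 : ∀ v : Fin t → Bits k, (1 / 64 : ℝ) ^ (sparseColumns v a W w').card =
        ∏ i, ψ (fun b => v b i) := by
      intro v
      simp only [ψ]
      rw [Finset.prod_ite, Finset.prod_const, Finset.prod_const_one, mul_one]
      rfl
    simp only [h1]
    rw [Fintype.sum_equiv (Equiv.piComm fun (_ : Fin t) (_ : Fin k) => Bool)
      (fun v => ∏ i, ψ (fun b => v b i)) (fun u => ∏ i, ψ (u i)) (fun v => rfl),
      ← Fintype.prod_sum (fun _ => ψ), Finset.prod_const, Finset.card_univ, Fintype.card_fin]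
  have hlow : ((Finset.univ.filter fun v : Fin t → Bits k =>
      72 * (sparseColumns v a W w').card < k).card : ℝ) * (2 : ℝ) ^ (-((k : ℝ) / 12)) ≤
      ∑ v : Fin t → Bits k, (1 / 64 : ℝ) ^ (sparseColumns v a W w').card := by
    rw [← nsmul_eq_mul, ← Finset.sum_const]
    refine (Finset.sum_le_sum (fun v hv => ?_)).trans
      (Finset.sum_le_sum_of_subset_of_nonneg (Finset.subset_univ _) fun v _ _ => by positivity)
    have hv' : 72 * (sparseColumns v a W w').card < k := (Finset.mem_filter.1 hv).2
    have hvr : 72 * ((sparseColumns v a W w').card : ℝ) ≤ k := by exact_mod_cast hv'.le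
    have : (1 / 64 : ℝ) = (2 : ℝ) ^ (-6 : ℝ) := by
      rw [Real.rpow_neg (by norm_num)]; norm_num
    rw [this, ← Real.rpow_natCast, ← Real.rpow_mul (by norm_num)]
    apply Real.rpow_le_rpow_of_exponent_le (by norm_num)
    linarith
  have hh2 : h ≤ (2 : ℝ) ^ (-(((w : ℝ) + 6) / 24)) := by
    apply le_of_pow_le_pow_left₀ (n := 24) (by norm_num) (by positivity)
    rw [← Real.rpow_natCast ((2 : ℝ) ^ _), ← Real.rpow_mul (by norm_num)]
    have : -(((w : ℝ) + 6) / 24) * (24 : ℕ) = -((w + 6 : ℕ) : ℝ) := by push_cast; ring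
    rw [this, Real.rpow_neg (by norm_num), Real.rpow_natCast, ← one_div, le_div_iff₀ (by positivity)]
    exact hnum
  have hcol : ∑ v : Fin t → Bits k, (1 / 64 : ℝ) ^ (sparseColumns v a W w').card ≤
      2 ^ (t * k) * (2 : ℝ) ^ (-(((w : ℝ) + 6) / 24) * k) := by
    rw [hsum, pow_mul, Real.rpow_mul (by norm_num), Real.rpow_natCast, ← mul_pow]
    have : 0 ≤ ∑ col, ψ col := Finset.sum_nonneg fun col _ => by
      simp only [ψ]; split_ifs <;> norm_num
    gcongr
    exact hψ.trans (by gcongr)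
  have hfin := hlow.trans hcol
  rw [← le_div_iff₀ (by positivity), mul_div_assoc, ← Real.rpow_sub (by norm_num)] at hfin
  have he : -(((w : ℝ) + 6) / 24) * k - -((k : ℝ) / 12) = -(((w : ℝ) + 4) / 24 * k) := by ring
  rwa [he] at hfin

/-! ### Rows that agree with a given row at many positions -/

/-- Given row `a` the other rows are independent, so the exponential moment is a product of the
bounds of `sum_exp_agreeFrac_le`. With `t ≤ 8 * 2 ^ l` the exponent is at most `1.35 * 8 θ = 10.8
θ`, and the Markov threshold gains `13.5 θ`. The difference `2.7 k / 31` is just above `(log 2) k /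
8`. -/
theorem card_le_sum_agreeFrac_le {t k l : ℕ} (hk : 24 * l ≤ k) (ht : t ≤ 8 * 2 ^ l) (a : Fin t) :
    ((Finset.univ.filter fun v : Fin t → Bits k =>
        (13.5 : ℝ) ≤ ∑ b ∈ Finset.univ.erase a, agreeFrac l (v a) (v b)).card : ℝ) ≤
      2 ^ (t * k) * (2 : ℝ) ^ (-((k : ℝ) / 8)) := by
  set θ : ℝ := k / 31
  have hθ : 0 ≤ θ := by positivity
  set M : ℝ := 2 ^ k * Real.exp (1.35 * θ * (1 / 2) ^ l)
  have hsum : ∑ v : Fin t → Bits k,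
      Real.exp (θ * ∑ b ∈ Finset.univ.erase a, agreeFrac l (v a) (v b)) ≤ 2 ^ k * M ^ (t - 1) := by
    have h1 : ∀ v : Fin t → Bits k,
        Real.exp (θ * ∑ b ∈ Finset.univ.erase a, agreeFrac l (v a) (v b)) =
        -- Summing over the value `x` of row `a` makes the summand a product over rows.
        ∑ x : Bits k, ∏ b, if b = a then (if v b = x then 1 else 0) else
          Real.exp (θ * agreeFrac l x (v b)) := by
      intro v
      rw [Finset.sum_eq_single (v a)]
      · rw [← Finset.mul_prod_erase _ _ (Finset.mem_univ a), if_pos rfl, if_pos rfl, one_mul,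
          Finset.mul_sum, Real.exp_sum]
        refine Finset.prod_congr rfl fun b hb => ?_
        rw [if_neg (Finset.ne_of_mem_erase hb)]
      · intro x _ hx
        exact Finset.prod_eq_zero (Finset.mem_univ a) (by simp [Ne.symm hx])
      · simp
    simp only [h1]
    rw [Finset.sum_comm]
    have h2 : ∀ x : Bits k, ∑ v : Fin t → Bits k, (∏ b, if b = a then (if v b = x then (1 : ℝ) else 0)
        else Real.exp (θ * agreeFrac l x (v b))) ≤ M ^ (t - 1) := by
      intro x
      rw [← Fintype.prod_sum (fun b y => if b = a then (if y = x then (1 : ℝ) else 0)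
        else Real.exp (θ * agreeFrac l x y)), ← Finset.mul_prod_erase _ _ (Finset.mem_univ a)]
      simp only [if_true, Finset.sum_ite_eq', Finset.mem_univ, one_mul]
      refine (Finset.prod_le_prod (fun b _ => Finset.sum_nonneg fun y _ => ?_)
        (fun b hb => ?_)).trans_eq (b := ∏ b ∈ Finset.univ.erase a, M) ?_
      · split_ifs <;> positivity
      · simp only [if_neg (Finset.ne_of_mem_erase hb)]
        exact sum_exp_agreeFrac_le hk x
      · rw [Finset.prod_const, Finset.card_erase_of_mem (Finset.mem_univ a), Finset.card_univ,
          Fintype.card_fin]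
    refine (Finset.sum_le_sum fun x _ => h2 x).trans_eq ?_
    rw [Finset.sum_const, nsmul_eq_mul]
    simp
  have hlow : ((Finset.univ.filter fun v : Fin t → Bits k =>
        (13.5 : ℝ) ≤ ∑ b ∈ Finset.univ.erase a, agreeFrac l (v a) (v b)).card : ℝ) *
      Real.exp (θ * 13.5) ≤ ∑ v : Fin t → Bits k,
      Real.exp (θ * ∑ b ∈ Finset.univ.erase a, agreeFrac l (v a) (v b)) := by
    rw [← nsmul_eq_mul, ← Finset.sum_const]
    refine (Finset.sum_le_sum (fun v hv => ?_)).trans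
      (Finset.sum_le_sum_of_subset_of_nonneg (Finset.subset_univ _) fun v _ _ => by positivity)
    have := (Finset.mem_filter.1 hv).2
    gcongr
  have ht1 : 1 ≤ t := by have := a.isLt; omega
  have hM : 2 ^ k * M ^ (t - 1) ≤ 2 ^ (t * k) * Real.exp (10.8 * θ) := by
    simp only [M]
    rw [mul_pow, ← mul_assoc, ← pow_mul, ← pow_add, ← Real.exp_nat_mul]
    have : k + k * (t - 1) = t * k := by
      obtain ⟨t', rfl⟩ := Nat.exists_eq_add_of_le' ht1
      simp; ring
    rw [this]
    refine mul_le_mul_of_nonneg_left (Real.exp_le_exp.2 ?_) (by positivity)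
    have h1 : ((t - 1 : ℕ) : ℝ) * (1 / 2) ^ l ≤ 8 := by
      have h2 : ((t - 1 : ℕ) : ℝ) ≤ 8 * 2 ^ l := by
        exact_mod_cast (Nat.sub_le t 1).trans ht
      calc ((t - 1 : ℕ) : ℝ) * (1 / 2) ^ l ≤ (8 * 2 ^ l) * (1 / 2) ^ l := by gcongr
        _ = 8 := by rw [mul_assoc, ← mul_pow]; norm_num
    calc ((t - 1 : ℕ) : ℝ) * (1.35 * θ * (1 / 2) ^ l)
        = 1.35 * θ * (((t - 1 : ℕ) : ℝ) * (1 / 2) ^ l) := by ring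
      _ ≤ 1.35 * θ * 8 := by gcongr
      _ = 10.8 * θ := by ring
  have hfin := hlow.trans (hsum.trans hM)
  rw [← le_div_iff₀ (Real.exp_pos _), mul_div_assoc, ← Real.exp_sub] at hfin
  refine hfin.trans ?_
  gcongr
  rw [Real.rpow_def_of_pos (by norm_num)]
  apply Real.exp_le_exp.2
  have h2 := Real.log_two_lt_d9
  have hk0 : (0 : ℝ) ≤ k := Nat.cast_nonneg k
  simp only [θ]
  nlinarith

/-! ### Sampled positions that separate one row from all others -/

/-- The rows other than `a` that agree with row `a` at the positions `S`. -/
def agreeRows {t k l : ℕ} (v : Fin t → Bits k) (a : Fin t) (S : Fin l ↪ Fin k) : Finset (Fin t) :=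
  (Finset.univ.erase a).filter fun b => Agrees S (v a) (v b)

theorem mem_agreeRows {t k l : ℕ} {v : Fin t → Bits k} {a b : Fin t} {S : Fin l ↪ Fin k} :
    b ∈ agreeRows v a S ↔ b ≠ a ∧ Agrees S (v a) (v b) := by
  simp [agreeRows]

/-- The tuples of positions at which at most `K` other rows agree with row `a`. -/
noncomputable def fewAgreeing {t k : ℕ} (v : Fin t → Bits k) (a : Fin t) (l K : ℕ) : Finset (Fin l ↪ Fin k) :=
  Finset.univ.filter fun S => (agreeRows v a S).card ≤ K

/-- Extend a tuple by one new position at which at most `K'` of the remaining agreeing rows still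
agree. There are at least `k / 72` such positions for each tuple, and distinct extensions are
distinct tuples. -/
theorem card_fewAgreeing_step {t k l K K' : ℕ} (v : Fin t → Bits k) (a : Fin t)
    (hl : k ≤ 72 * (k - l))
    (hcol : ∀ W : Finset (Fin t), a ∉ W → W.card ≤ K → k ≤ 72 * (sparseColumns v a W K').card) :
    k * (fewAgreeing v a l K).card ≤ 72 * (fewAgreeing v a (l + 1) K').card := by
  classical
  set ext : (S : Fin l ↪ Fin k) → Finset {i // i ∉ Set.range S} := fun S =>
    Finset.univ.filter fun i => agreeCount a (agreeRows v a S) (fun b => v b i.1) ≤ K'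
  have hext : ∀ S ∈ fewAgreeing v a l K, k ≤ 72 * (ext S).card := by
    intro S hS
    have hS' : (agreeRows v a S).card ≤ K := (Finset.mem_filter.1 hS).2
    by_cases hc : (agreeRows v a S).card ≤ K'
    · have : ext S = Finset.univ := by
        ext i
        simp only [ext, Finset.mem_filter, Finset.mem_univ, true_and, iff_true]
        exact (Finset.card_filter_le _ _).trans hc
      rw [this, Finset.card_univ]
      have h1 : Fintype.card {i // i ∉ Set.range S} = k - l := by
        rw [Fintype.card_subtype_compl, Fintype.card_fin]
        congr 1
        exact (Fintype.card_congr (Equiv.ofInjective S S.injective)).symm.trans (Fintype.card_fin l)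
      rw [h1]; exact hl
    · refine (hcol (agreeRows v a S) (by simp [agreeRows]) hS').trans ?_
      refine Nat.mul_le_mul_left _ ?_
      -- At a position already in `S` all agreeing rows agree, and these are more than `K'`; so a
      -- sparse column is automatically a new position.
      have hnot : ∀ i ∈ sparseColumns v a (agreeRows v a S) K', i ∉ Set.range S := by
        rintro i hi ⟨j, rfl⟩
        apply hc
        have := (Finset.mem_filter.1 hi).2
        rw [agreeCount, Finset.filter_true_of_mem] at this
        · exact this
        · intro b hb
          exact (Finset.mem_filter.1 hb).2 j
      rw [← Finset.card_map (Function.Embedding.subtype _) (s := ext S)]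
      refine Finset.card_le_card fun i hi => ?_
      rw [Finset.mem_map]
      exact ⟨⟨i, hnot i hi⟩, by simpa [ext] using (Finset.mem_filter.1 hi).2, rfl⟩
  have hle : ∑ S ∈ fewAgreeing v a l K, (ext S).card ≤ (fewAgreeing v a (l + 1) K').card := by
    rw [← Finset.card_sigma]
    refine Finset.card_le_card_of_injOn (fun p => (Equiv.embeddingFinSucc l (Fin k)).symm p) ?_
      (Equiv.injective _).injOn
    rintro ⟨S, i⟩ hp
    have hi := (Finset.mem_filter.1 (Finset.mem_sigma.1 (Finset.mem_coe.1 hp)).2).2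
    simp only [fewAgreeing, Finset.coe_filter, Finset.mem_univ, true_and, Set.mem_ofPred_eq]
    refine le_trans (le_of_eq ?_) hi
    rw [agreeCount]
    congr 1
    ext b
    rw [Finset.mem_filter, mem_agreeRows, mem_agreeRows]
    simp only [Agrees, Equiv.coe_embeddingFinSucc_symm,
      Fin.forall_fin_succ, Fin.cons_zero, Fin.cons_succ]
    tauto
  calc k * (fewAgreeing v a l K).card = ∑ S ∈ fewAgreeing v a l K, k := by
        rw [Finset.sum_const, smul_eq_mul, mul_comm]
    _ ≤ ∑ S ∈ fewAgreeing v a l K, 72 * (ext S).card := Finset.sum_le_sum hext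
    _ ≤ _ := by rw [← Finset.mul_sum]; exact Nat.mul_le_mul_left _ hle

/-- Markov's inequality: the mean number of agreeing rows is below `13.5`, so at most a fraction
`13.5 / 14 = 27 / 28` of the tuples have 14 or more. -/
theorem card_embedding_le_fewAgreeing {t k l : ℕ} (hl : l ≤ k) (v : Fin t → Bits k) (a : Fin t)
    (hX : ∑ b ∈ Finset.univ.erase a, agreeFrac l (v a) (v b) < 13.5) :
    Fintype.card (Fin l ↪ Fin k) ≤ 28 * (fewAgreeing v a l 13).card := by
  have hE : 0 < (Fintype.card (Fin l ↪ Fin k) : ℝ) := by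
    rw [Fintype.card_embedding_eq, Fintype.card_fin, Fintype.card_fin]
    exact_mod_cast Nat.descFactorial_pos.2 hl
  have h1 : ∑ b ∈ Finset.univ.erase a, agreeFrac l (v a) (v b) =
      ((∑ S : Fin l ↪ Fin k, (agreeRows v a S).card : ℕ) : ℝ) /
        Fintype.card (Fin l ↪ Fin k) := by
    simp only [agreeFrac]
    rw [← Finset.sum_div, ← Nat.cast_sum]
    congr 2
    simp only [agreeRows, Finset.card_filter]
    exact Finset.sum_comm
  rw [h1, div_lt_iff₀ hE] at hX
  have h2 : 14 * (Fintype.card (Fin l ↪ Fin k) - (fewAgreeing v a l 13).card) ≤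
      ∑ S : Fin l ↪ Fin k, (agreeRows v a S).card := by
    rw [← Finset.card_compl, mul_comm, ← smul_eq_mul, ← Finset.sum_const]
    refine (Finset.sum_le_sum fun S hS => ?_).trans
      (Finset.sum_le_sum_of_subset (Finset.subset_univ _))
    simp only [fewAgreeing, Finset.mem_compl, Finset.mem_filter, Finset.mem_univ, true_and] at hS
    omega
  have h3 : (fewAgreeing v a l 13).card ≤ Fintype.card (Fin l ↪ Fin k) := Finset.card_le_univ _
  have h4 : (14 : ℝ) * (Fintype.card (Fin l ↪ Fin k) - (fewAgreeing v a l 13).card) ≤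
      ((∑ S : Fin l ↪ Fin k, (agreeRows v a S).card : ℕ) : ℝ) := by
    rw [← Nat.cast_sub h3]; exact_mod_cast h2
  have h5 : (Fintype.card (Fin l ↪ Fin k) : ℝ) ≤ 28 * (fewAgreeing v a l 13).card := by linarith
  exact_mod_cast h5

/-- In every small set of rows other than `a`, many columns agree with row `a` only rarely. -/
def HasSparseColumns {t k : ℕ} (v : Fin t → Bits k) (w w' : ℕ) : Prop :=
  ∀ a W, a ∉ W → W.card ≤ w → k ≤ 72 * (sparseColumns v a W w').card

/-- The combinatorial properties of a random table that make its rows separable. -/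
structure IsSpread {t k : ℕ} (m : ℕ) (v : Fin t → Bits k) : Prop where
  two : HasSparseColumns v 2 0
  six : HasSparseColumns v 6 2
  thirteen : HasSparseColumns v 13 6
  agree : ∀ a, ∑ b ∈ Finset.univ.erase a, agreeFrac (m - 3) (v a) (v b) < 13.5

theorem card_embedding_succ_le (l k : ℕ) :
    Fintype.card (Fin (l + 1) ↪ Fin k) ≤ k * Fintype.card (Fin l ↪ Fin k) := by
  simp only [Fintype.card_embedding_eq, Fintype.card_fin, Nat.descFactorial_succ]
  exact Nat.mul_le_mul_right _ (Nat.sub_le _ _)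

/-- The chain 13, 6, 2, 0 uses the last three positions and costs a factor 72 each, after the factor
28 for the first `m - 3`. For `m < 3` there are at most `2 ^ m - 1` other rows, so the chain starts
further down. -/
theorem IsSpread.card_embedding_le {t k m : ℕ} {v : Fin t → Bits k} (hv : IsSpread m v)
    (hk : 24 * (m - 1) + 20 ≤ k) (ht : t ≤ 2 ^ m) (a : Fin t) :
    Fintype.card (Fin m ↪ Fin k) ≤ 28 * 72 ^ 3 * (fewAgreeing v a m 0).card := by
  have ht1 : 1 ≤ t := by have := a.isLt; omega
  have step : ∀ {l K K' c : ℕ}, HasSparseColumns v K K' → k ≤ 72 * (k - l) → 0 < k →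
      Fintype.card (Fin l ↪ Fin k) ≤ c * (fewAgreeing v a l K).card →
      Fintype.card (Fin (l + 1) ↪ Fin k) ≤ c * 72 * (fewAgreeing v a (l + 1) K').card := by
    intro l K K' c hs hl hk0 h
    have h1 := card_fewAgreeing_step v a hl (hs a)
    calc Fintype.card (Fin (l + 1) ↪ Fin k) ≤ k * Fintype.card (Fin l ↪ Fin k) :=
          card_embedding_succ_le l k
      _ ≤ k * (c * (fewAgreeing v a l K).card) := Nat.mul_le_mul_left _ h
      _ = c * (k * (fewAgreeing v a l K).card) := by ring
      _ ≤ c * (72 * (fewAgreeing v a (l + 1) K').card) := Nat.mul_le_mul_left _ h1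
      _ = _ := by ring
  have hrows : ∀ (S : Fin 0 ↪ Fin k), (agreeRows v a S).card ≤ t - 1 := by
    intro S
    refine (Finset.card_filter_le _ _).trans ?_
    rw [Finset.card_erase_of_mem (Finset.mem_univ a), Finset.card_univ, Fintype.card_fin]
  have base : ∀ K, t - 1 ≤ K →
      Fintype.card (Fin 0 ↪ Fin k) ≤ 1 * (fewAgreeing v a 0 K).card := by
    intro K hK
    have : fewAgreeing v a 0 K = Finset.univ := by
      ext S
      simp only [fewAgreeing, Finset.mem_filter, Finset.mem_univ, true_and, iff_true]
      exact (hrows S).trans hK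
    rw [this, one_mul, Finset.card_univ]
  match m, hk, ht, hv with
  | 0, _, ht, _ =>
    refine (base 0 (by simp at ht; omega)).trans (Nat.mul_le_mul_right _ (by norm_num))
  | 1, hk, ht, hv =>
    have h1 := step hv.two (by omega) (by omega) (base 2 (by norm_num at ht; omega))
    exact h1.trans (Nat.mul_le_mul_right _ (by norm_num))
  | 2, hk, ht, hv =>
    have h1 := step hv.six (by omega) (by omega) (base 6 (by norm_num at ht; omega))
    have h2 := step hv.two (by omega) (by omega) h1
    exact h2.trans (Nat.mul_le_mul_right _ (by norm_num))
  | m + 3, hk, ht, hv =>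
    have h0 := card_embedding_le_fewAgreeing (l := m) (by omega) v a (hv.agree a)
    have h1 := step hv.thirteen (by omega) (by omega) h0
    have h2 := step hv.six (by omega) (by omega) h1
    have h3 := step hv.two (by omega) (by omega) h2
    exact h3.trans (Nat.mul_le_mul_right _ (by norm_num))

/-! ### Union bound over the bad events for a random table. -/

theorem exists_image_eq_of_card_le {t w : ℕ} {W : Finset (Fin t)} (hne : W.Nonempty)
    (hW : W.card ≤ w) : ∃ τ : Fin w → Fin t, Finset.univ.image τ = W := by
  obtain ⟨b, hb⟩ := hne
  refine ⟨fun i => if h : (i : ℕ) < W.card then (W.equivFin.symm ⟨i, h⟩ : Fin t) else b, ?_⟩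
  ext c
  simp only [Finset.mem_image, Finset.mem_univ, true_and]
  constructor
  · rintro ⟨i, rfl⟩
    split_ifs
    · exact Finset.coe_mem _
    · exact hb
  · intro hc
    refine ⟨⟨W.equivFin ⟨c, hc⟩, (W.equivFin ⟨c, hc⟩).isLt.trans_le hW⟩, ?_⟩
    simp

-- Union bound over the row `a` and over `W`, listed as a `w`-tuple with repetitions: `t ^ (w + 1) ≤
-- 2 ^ ((w + 1) k / 24)` events, each of probability at most `2 ^ (-(w + 4) k / 24)`. What remains
-- is `2 ^ (-3 k / 24)`.
open Classical in
theorem card_not_hasSparseColumns_le {t k w w' : ℕ} (ht : (t : ℝ) ≤ 2 ^ ((k : ℝ) / 24)) {h : ℝ}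
    (hh : ∀ n ≤ w, 1 - 63 / 64 * (((∑ i ∈ Finset.range (w' + 1), n.choose i : ℕ) : ℝ) / 2 ^ n) ≤ h)
    (hnum : h ^ 24 * 2 ^ (w + 6) ≤ 1) :
    ((Finset.univ.filter fun v : Fin t → Bits k => ¬ HasSparseColumns v w w').card : ℝ) ≤
      2 ^ (t * k) * (2 : ℝ) ^ (-((k : ℝ) / 8)) := by
  set bad : Fin t × (Fin w → Fin t) → Finset (Fin t → Bits k) := fun p =>
    if p.1 ∈ Finset.univ.image p.2 then ∅ else
      Finset.univ.filter fun v => 72 * (sparseColumns v p.1 (Finset.univ.image p.2) w').card < k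
  have hsub : (Finset.univ.filter fun v : Fin t → Bits k => ¬ HasSparseColumns v w w') ⊆
      Finset.univ.biUnion bad := by
    intro v hv
    have hv' := (Finset.mem_filter.1 hv).2
    simp only [HasSparseColumns, not_forall, not_le] at hv'
    obtain ⟨a, W, ha, hW, hlt⟩ := hv'
    have hne : W.Nonempty := by
      rw [Finset.nonempty_iff_ne_empty]
      rintro rfl
      have : sparseColumns v a ∅ w' = Finset.univ := by ext; simp [sparseColumns, agreeCount]
      rw [this, Finset.card_univ, Fintype.card_fin] at hlt
      omega
    obtain ⟨τ, rfl⟩ := exists_image_eq_of_card_le hne hW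
    refine Finset.mem_biUnion.2 ⟨(a, τ), Finset.mem_univ _, ?_⟩
    simp only [bad, if_neg ha, Finset.mem_filter, Finset.mem_univ, true_and]
    exact hlt
  set q : ℝ := 2 ^ (t * k) * (2 : ℝ) ^ (-(((w : ℝ) + 4) / 24 * k))
  have hq : 0 ≤ q := by positivity
  have hbad : ∀ p, ((bad p).card : ℝ) ≤ q := by
    intro p
    simp only [bad]
    split_ifs with hp
    · simpa using hq
    · refine card_few_sparseColumns_le p.1 _ hp ?_ hh hnum
      exact Finset.card_image_le.trans (by simp)
  calc ((Finset.univ.filter fun v : Fin t → Bits k => ¬ HasSparseColumns v w w').card : ℝ)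
      ≤ ∑ p, ((bad p).card : ℝ) := by
        exact_mod_cast (Finset.card_le_card hsub).trans Finset.card_biUnion_le
    _ ≤ ∑ _p : Fin t × (Fin w → Fin t), q := Finset.sum_le_sum fun p _ => hbad p
    _ = (t : ℝ) ^ (w + 1) * q := by
        rw [Finset.sum_const, nsmul_eq_mul, Finset.card_univ, Fintype.card_prod]
        simp [pow_succ, mul_comm]
    _ ≤ ((2 : ℝ) ^ ((k : ℝ) / 24)) ^ (w + 1) * q := by gcongr
    _ = _ := by
        rw [← Real.rpow_natCast ((2 : ℝ) ^ _), ← Real.rpow_mul (by norm_num)]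
        simp only [q]
        rw [mul_left_comm, ← Real.rpow_add (by norm_num)]
        congr 2
        push_cast
        ring

open Classical in
theorem card_not_isSpread_le {t k m : ℕ} (ht : (t : ℝ) ≤ 2 ^ ((k : ℝ) / 24))
    (hk : 24 * (m - 3) ≤ k) (htm : t ≤ 2 ^ m) :
    ((Finset.univ.filter fun v : Fin t → Bits k => ¬ IsSpread m v).card : ℝ) ≤
      2 ^ (t * k) * ((3 + t) * (2 : ℝ) ^ (-((k : ℝ) / 8))) := by
  set A := fun w w' => Finset.univ.filter fun v : Fin t → Bits k => ¬ HasSparseColumns v w w'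
  set B : Finset (Fin t → Bits k) := Finset.univ.biUnion fun a => Finset.univ.filter
    fun v : Fin t → Bits k =>
        (13.5 : ℝ) ≤ ∑ b ∈ Finset.univ.erase a, agreeFrac (m - 3) (v a) (v b)
  have hsub : (Finset.univ.filter fun v : Fin t → Bits k => ¬ IsSpread m v) ⊆
      A 2 0 ∪ A 6 2 ∪ A 13 6 ∪ B := by
    intro v hv
    have hv' := (Finset.mem_filter.1 hv).2
    by_contra hc
    apply hv'
    simp only [A, B, Finset.mem_union, Finset.mem_filter, Finset.mem_univ, true_and, not_or,
      not_not, Finset.mem_biUnion, not_exists, not_le] at hc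
    exact ⟨hc.1.1.1, hc.1.1.2, hc.1.2, hc.2⟩
  set q : ℝ := 2 ^ (t * k) * (2 : ℝ) ^ (-((k : ℝ) / 8))
  have h2 : ((A 2 0).card : ℝ) ≤ q := by
    -- The three values of `h` are `1 - 63 / 64 * P` rounded up, with `P` the probability of at most
    -- `w'` heads among `w` fair coins: `1 / 4`, `22 / 64` and `1 / 2`. Fewer coins only increase
    -- `P`.
    refine card_not_hasSparseColumns_le ht (h := 0.7539063) (fun n hn => ?_) (by norm_num)
    interval_cases n <;> norm_num [Finset.sum_range_succ, Nat.choose]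
  have h6 : ((A 6 2).card : ℝ) ≤ q := by
    refine card_not_hasSparseColumns_le ht (h := 0.6617) (fun n hn => ?_) (by norm_num)
    interval_cases n <;> norm_num [Finset.sum_range_succ, Nat.choose]
  have h13 : ((A 13 6).card : ℝ) ≤ q := by
    refine card_not_hasSparseColumns_le ht (h := 0.5079) (fun n hn => ?_) (by norm_num)
    interval_cases n <;> norm_num [Finset.sum_range_succ, Nat.choose]
  have htm' : t ≤ 8 * 2 ^ (m - 3) := by
    refine htm.trans ?_
    calc 2 ^ m ≤ 2 ^ (3 + (m - 3)) := Nat.pow_le_pow_right (by norm_num) (by omega)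
      _ = 8 * 2 ^ (m - 3) := by rw [pow_add]; norm_num
  have hB : (B.card : ℝ) ≤ t * q := by
    calc (B.card : ℝ) ≤ ∑ a : Fin t, ((Finset.univ.filter fun v : Fin t → Bits k =>
        (13.5 : ℝ) ≤ ∑ b ∈ Finset.univ.erase a, agreeFrac (m - 3) (v a) (v b)).card : ℝ) := by
          exact_mod_cast Finset.card_biUnion_le
      _ ≤ ∑ _a : Fin t, q := Finset.sum_le_sum fun a _ => card_le_sum_agreeFrac_le hk htm' a
      _ = t * q := by simp
  have hcard : ((Finset.univ.filter fun v : Fin t → Bits k => ¬ IsSpread m v).card : ℝ) ≤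
      (A 2 0).card + (A 6 2).card + (A 13 6).card + B.card := by
    exact_mod_cast (Finset.card_le_card hsub).trans ((Finset.card_union_le _ _).trans
      (Nat.add_le_add_right ((Finset.card_union_le _ _).trans
        (Nat.add_le_add_right (Finset.card_union_le _ _) _)) _))
  have : 2 ^ (t * k) * ((3 + t) * (2 : ℝ) ^ (-((k : ℝ) / 8))) = q + q + q + t * q := by
    simp only [q]; ring
  rw [this]
  linarith

/-! ### Sampled gates that separate the rows of a table -/

/-- Whether the sampled control condition holds. -/
def fires {k m : ℕ} (p : (Fin m ↪ Fin k) × (Fin m → Bool)) (x : Bits k) : Bool :=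
  decide (∀ l, x (p.1 l) = p.2 l)

/-- Every row is singled out by one of the sampled gates. -/
def IsSeparating {k m α t : ℕ} (f : Fin α → (Fin m ↪ Fin k) × (Fin m → Bool))
    (v : Fin t → Bits k) : Prop :=
  ∀ a, ∃ j, ∀ b, fires (f j) (v b) = decide (b = a)

theorem IsSeparating.injective {k m α t : ℕ} {f : Fin α → (Fin m ↪ Fin k) × (Fin m → Bool)}
    {v : Fin t → Bits k} (h : IsSeparating f v) : Function.Injective v := by
  intro a b hab
  obtain ⟨j, hj⟩ := h a
  have h1 := hj a
  have h2 := hj b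
  rw [← hab, h1] at h2
  simpa [eq_comm] using h2

/-- A tuple at which no other row agrees gives an isolating gate when the control values are read
off from row `a`. -/
theorem card_fewAgreeing_le {k m t : ℕ} (v : Fin t → Bits k) (a : Fin t) :
    (fewAgreeing v a m 0).card ≤ (Finset.univ.filter
      fun p : (Fin m ↪ Fin k) × (Fin m → Bool) => ∀ b, fires p (v b) = decide (b = a)).card := by
  refine Finset.card_le_card_of_injOn (fun S => (S, fun l => v a (S l))) ?_
    (fun S _ S' _ h => congrArg Prod.fst h)
  intro S hS
  have hS' : (agreeRows v a S).card ≤ 0 := (Finset.mem_filter.1 (Finset.mem_coe.1 hS)).2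
  have h0 : agreeRows v a S = ∅ := Finset.card_eq_zero.1 (Nat.le_zero.1 hS')
  refine Finset.mem_coe.2 (Finset.mem_filter.2 ⟨Finset.mem_univ _, fun b => ?_⟩)
  unfold fires
  rw [decide_eq_decide]
  constructor
  · intro h
    by_contra hba
    have : b ∈ agreeRows v a S := mem_agreeRows.2 ⟨hba, h⟩
    simp [h0] at this
  · rintro rfl
    exact fun l => rfl

-- For each row, a sampled gate isolates it with probability at least `1 / (28 * 72 ^ 3 * 2 ^ m)`:
-- the tuple is good with the first factor and the control values match with probability `2 ^ (-m)`.
-- The `α` gates are independent.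
open Classical in
theorem card_not_isSeparating_le {k m α t : ℕ} {v : Fin t → Bits k} (hv : IsSpread m v)
    (hk : 24 * (m - 1) + 20 ≤ k) (ht : t ≤ 2 ^ m) :
    ((Finset.univ.filter fun f : Fin α → (Fin m ↪ Fin k) × (Fin m → Bool) =>
        ¬ IsSeparating f v).card : ℝ) ≤
      t * (1 - 1 / (28 * 72 ^ 3 * 2 ^ m)) ^ α *
        Fintype.card (Fin α → (Fin m ↪ Fin k) × (Fin m → Bool)) := by
  set P : Fin t → Finset ((Fin m ↪ Fin k) × (Fin m → Bool)) := fun a =>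
    Finset.univ.filter fun p => ∀ b, fires p (v b) = decide (b = a)
  set N : ℝ := (Fintype.card ((Fin m ↪ Fin k) × (Fin m → Bool)) : ℝ)
  have hN : N = Fintype.card (Fin m ↪ Fin k) * 2 ^ m := by
    simp only [N, Fintype.card_prod]; simp
  have hP : ∀ a, ((P a)ᶜ.card : ℝ) ≤ (1 - 1 / (28 * 72 ^ 3 * 2 ^ m)) * N := by
    intro a
    have h1 : Fintype.card (Fin m ↪ Fin k) ≤ 28 * 72 ^ 3 * (P a).card :=
      (hv.card_embedding_le hk ht a).trans (Nat.mul_le_mul_left _ (card_fewAgreeing_le v a))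
    have h1' : (Fintype.card (Fin m ↪ Fin k) : ℝ) ≤ 28 * 72 ^ 3 * (P a).card := by
      exact_mod_cast h1
    rw [Finset.card_compl, Nat.cast_sub (Finset.card_le_univ _)]
    have h2 : 1 / (28 * 72 ^ 3 * 2 ^ m) * N ≤ (P a).card := by
      rw [hN, div_mul_eq_mul_div, one_mul, div_le_iff₀ (by positivity)]
      have : (0 : ℝ) < 2 ^ m := by positivity
      nlinarith
    simp only [N] at h2 ⊢
    linarith
  have hsub : (Finset.univ.filter fun f : Fin α → (Fin m ↪ Fin k) × (Fin m → Bool) =>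
      ¬ IsSeparating f v) ⊆ Finset.univ.biUnion fun a => Fintype.piFinset fun _ => (P a)ᶜ := by
    intro f hf
    have hf' := (Finset.mem_filter.1 hf).2
    simp only [IsSeparating, not_forall, not_exists] at hf'
    obtain ⟨a, ha⟩ := hf'
    refine Finset.mem_biUnion.2 ⟨a, Finset.mem_univ _, Fintype.mem_piFinset.2 fun j => ?_⟩
    simp only [P, Finset.mem_compl, Finset.mem_filter, Finset.mem_univ, true_and, not_forall]
    exact ha j
  calc ((Finset.univ.filter fun f : Fin α → (Fin m ↪ Fin k) × (Fin m → Bool) =>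
        ¬ IsSeparating f v).card : ℝ)
      ≤ ∑ a, (((P a)ᶜ.card : ℝ)) ^ α := by
        refine (Nat.cast_le.2 ((Finset.card_le_card hsub).trans Finset.card_biUnion_le)).trans ?_
        push_cast
        simp [Fintype.card_piFinset]
    _ ≤ ∑ _a : Fin t, ((1 - 1 / (28 * 72 ^ 3 * 2 ^ m)) * N) ^ α := by
        gcongr with a
        exact hP a
    _ = _ := by
        simp only [Finset.sum_const, Finset.card_univ, Fintype.card_fin, nsmul_eq_mul,
          Fintype.card_pi, Finset.prod_const, mul_pow, N]
        push_cast
        ring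

-- This is the quantity `β`, for gates and table both uniform; rows are not required to be distinct
-- here, since a separated table has distinct rows anyway.
open Classical in
theorem card_pairs_not_isSeparating_le {k m α t : ℕ} (ht : (t : ℝ) ≤ 2 ^ ((k : ℝ) / 24))
    (hk : 24 * (m - 1) + 20 ≤ k) (htm : t ≤ 2 ^ m) :
    ((Finset.univ.filter fun p : (Fin α → (Fin m ↪ Fin k) × (Fin m → Bool)) × (Fin t → Bits k) =>
        ¬ IsSeparating p.1 p.2).card : ℝ) ≤
      ((3 + t) * (2 : ℝ) ^ (-((k : ℝ) / 8)) + t * (1 - 1 / (28 * 72 ^ 3 * 2 ^ m)) ^ α) *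
        (Fintype.card (Fin α → (Fin m ↪ Fin k) × (Fin m → Bool)) * 2 ^ (t * k)) := by
  set F : ℝ := (Fintype.card (Fin α → (Fin m ↪ Fin k) × (Fin m → Bool)) : ℝ)
  set r : ℝ := t * (1 - 1 / (28 * 72 ^ 3 * 2 ^ m)) ^ α
  have hr : 0 ≤ r := by
    have : (1 : ℝ) / (28 * 72 ^ 3 * 2 ^ m) ≤ 1 := by
      rw [div_le_one (by positivity)]
      have : (1 : ℝ) ≤ 2 ^ m := one_le_pow₀ (by norm_num)
      linarith
    have : (0 : ℝ) ≤ 1 - 1 / (28 * 72 ^ 3 * 2 ^ m) := by linarith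
    positivity
  have h1 : ((Finset.univ.filter fun p : (Fin α → (Fin m ↪ Fin k) × (Fin m → Bool)) ×
        (Fin t → Bits k) => ¬ IsSeparating p.1 p.2).card : ℝ) =
      ∑ v : Fin t → Bits k, ((Finset.univ.filter
        fun f : Fin α → (Fin m ↪ Fin k) × (Fin m → Bool) => ¬ IsSeparating f v).card : ℝ) := by
    simp only [Finset.card_filter, Fintype.sum_prod_type_right, Nat.cast_sum]
  have h2 : ∀ v : Fin t → Bits k, ((Finset.univ.filter
        fun f : Fin α → (Fin m ↪ Fin k) × (Fin m → Bool) => ¬ IsSeparating f v).card : ℝ) ≤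
      (if ¬ IsSpread m v then 1 else 0) * F + r * F := by
    intro v
    by_cases hv : IsSpread m v
    · simp only [hv, not_true, if_false, zero_mul, zero_add]
      exact card_not_isSeparating_le hv hk htm
    · simp only [hv, not_false_iff, if_true, one_mul]
      have : ((Finset.univ.filter
        fun f : Fin α → (Fin m ↪ Fin k) × (Fin m → Bool) => ¬ IsSeparating f v).card : ℝ) ≤ F :=
        Nat.cast_le.2 (Finset.card_le_univ _)
      have : 0 ≤ r * F := by positivity
      linarith
  rw [h1]
  refine (Finset.sum_le_sum fun v _ => h2 v).trans ?_
  rw [Finset.sum_add_distrib, ← Finset.sum_mul, Finset.sum_boole, Finset.sum_const, nsmul_eq_mul]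
  have h3 := card_not_isSpread_le (m := m) ht (by omega) htm
  have h4 : ((Finset.univ : Finset (Fin t → Bits k)).card : ℝ) = 2 ^ (t * k) := by
    simp [pow_mul, mul_comm t k]
  rw [h4]
  have h5 := mul_le_mul_of_nonneg_right h3 (by positivity : 0 ≤ F)
  linarith

/-! ### The coins -/

/-- The parity of the conditions that hold among the gates selected by the coins. -/
def coinXor {k m α : ℕ} (f : Fin α → (Fin m ↪ Fin k) × (Fin m → Bool)) (js : List (Fin α))
    (b : Fin α → Bool) (x : Bits k) : Bool :=
  js.foldr (fun j acc => xor (b j && fires (f j) x) acc) false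

section
variable {k m α : ℕ} (f : Fin α → (Fin m ↪ Fin k) × (Fin m → Bool))

theorem coinXor_cons (j : Fin α) (js : List (Fin α)) (b : Fin α → Bool) (x : Bits k) :
    coinXor f (j :: js) b x = xor (b j && fires (f j) x) (coinXor f js b x) := rfl

theorem coinXor_xor (js : List (Fin α)) (b b' : Fin α → Bool) (x : Bits k) :
    coinXor f js (fun j => xor (b j) (b' j)) x = xor (coinXor f js b x) (coinXor f js b' x) := by
  induction js with
  | nil => rfl
  | cons j js ih =>
    simp only [coinXor_cons, ih]
    cases b j <;> cases b' j <;> cases fires (f j) x <;> cases coinXor f js b x <;>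
      cases coinXor f js b' x <;> rfl

theorem coinXor_eq_single {js : List (Fin α)} (hjs : js.Nodup) {b : Fin α → Bool} {x : Bits k}
    {j₀ : Fin α} {w : Bool} (h : ∀ j, (b j && fires (f j) x) = (decide (j = j₀) && w)) :
    coinXor f js b x = (decide (j₀ ∈ js) && w) := by
  induction js with
  | nil => rfl
  | cons j js ih =>
    rw [coinXor_cons, ih (List.nodup_cons.1 hjs).2, h]
    have hj := (List.nodup_cons.1 hjs).1
    by_cases h1 : j = j₀
    · subst h1; simp [hj]
    · simp [h1, Ne.symm h1]

end

-- The parities depend linearly on the coins over the field with two elements. Isolating gates make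
-- this map surjective, so all its fibres have the same size.
open Classical in
theorem IsSeparating.card_coins {k m α t : ℕ} {f : Fin α → (Fin m ↪ Fin k) × (Fin m → Bool)}
    {v : Fin t → Bits k} (h : IsSeparating f v) (w : Fin t → Bool) :
    (Finset.univ.filter fun b : Fin α → Bool =>
        ∀ a, coinXor f (List.finRange α) b (v a) = w a).card * 2 ^ t = 2 ^ α := by
  choose J hJ using h
  have hJinj : ∀ a c, fires (f (J a)) (v c) = true → a = c := by
    intro a c hc
    rw [hJ] at hc
    exact (of_decide_eq_true hc).symm
  -- A right inverse of the parity map: heads exactly at the isolating gates of the rows with value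
  -- `true`.
  set δ : (Fin t → Bool) → Fin α → Bool := fun w j => decide (∃ a, J a = j ∧ w a = true)
  have hδ : ∀ w a, coinXor f (List.finRange α) (δ w) (v a) = w a := by
    intro w a
    rw [coinXor_eq_single f (List.nodup_finRange α) (j₀ := J a) (w := w a)]
    · simp
    · intro j
      rw [Bool.eq_iff_iff]
      simp only [δ, Bool.and_eq_true, decide_eq_true_eq]
      constructor
      · rintro ⟨⟨c, rfl, hc⟩, hf⟩
        obtain rfl := hJinj c a hf
        exact ⟨rfl, hc⟩
      · rintro ⟨rfl, hw⟩
        exact ⟨⟨a, rfl, hw⟩, by rw [hJ]; simp⟩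
  set S : (Fin t → Bool) → Finset (Fin α → Bool) := fun w => Finset.univ.filter fun b =>
        ∀ a, coinXor f (List.finRange α) b (v a) = w a
  have hS : ∀ w', (S w').card = (S w).card := by
    intro w'
    set d : Fin α → Bool := δ (fun a => xor (w a) (w' a))
    have hinv : ∀ b : Fin α → Bool, (fun j => xor (xor (b j) (d j)) (d j)) = b := by
      intro b; ext j; simp
    refine Finset.card_bij' (fun b _ j => xor (b j) (d j)) (fun b _ j => xor (b j) (d j)) ?_ ?_
      (fun b _ => hinv b) (fun b _ => hinv b)
    all_goals
      intro b hb
      simp only [S, Finset.mem_filter, Finset.mem_univ, true_and] at hb ⊢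
      intro a
      rw [coinXor_xor, hb, hδ]
      cases w a <;> cases w' a <;> rfl
  have htot : ∑ w', (S w').card = 2 ^ α := by
    have := Finset.card_eq_sum_card_fiberwise (s := (Finset.univ : Finset (Fin α → Bool)))
      (t := (Finset.univ : Finset (Fin t → Bool)))
      (f := fun b a => coinXor f (List.finRange α) b (v a)) (fun _ _ => by simp)
    rw [Finset.card_univ] at this
    simp only [Fintype.card_pi, Fintype.card_bool, Finset.prod_const, Finset.card_univ,
      Fintype.card_fin] at this
    rw [this]
    refine Finset.sum_congr rfl fun w' _ => ?_
    congr 1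
    ext b
    simp only [S, Finset.mem_filter, Finset.mem_univ, true_and, funext_iff]
  simp only [hS, Finset.sum_const, Finset.card_univ, Fintype.card_pi, Fintype.card_bool,
      Finset.prod_const, Fintype.card_fin, smul_eq_mul] at htot
  rw [mul_comm]
  exact htot

/-! ### The action of the circuit on basis labels -/

theorem reverse_prod_append {n : ℕ} (l l' : List (Equiv.Perm (Bits n))) (x : Bits n) :
    (l ++ l').reverse.prod x = l'.reverse.prod (l.reverse.prod x) := by
  rw [List.reverse_append, List.prod_append, Equiv.Perm.mul_apply]

theorem mcx_apply {n m : ℕ} (ctrl : Fin m → Fin n) (val : Fin m → Bool) (q : Fin n)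
    (hq : ∀ l, ctrl l ≠ q) (x : Bits n) :
    mcx ctrl val q hq x =
      Function.update x q (xor (x q) (decide (∀ l, x (ctrl l) = val l))) := by
  show (if ∀ l, x (ctrl l) = val l then Function.update x q (!x q) else x) = _
  by_cases h : ∀ l, x (ctrl l) = val l
  · rw [if_pos h, decide_eq_true h, Bool.xor_true]
  · rw [if_neg h, decide_eq_false h, Bool.xor_false, Function.update_eq_self]

theorem cnot_apply {n : ℕ} (c q : Fin n) (h : c ≠ q) (x : Bits n) :
    cnot c q h x = Function.update x q (xor (x q) (x c)) := by
  rw [cnot, mcx_apply]; simp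

/-- The map that adds `h q x` to every bit `q` in `P`. -/
def xorMap {n : ℕ} (P : Fin n → Prop) [DecidablePred P] (h : Fin n → Bits n → Bool)
    (x : Bits n) : Bits n :=
  fun q => if P q then xor (x q) (h q x) else x q

/-- The flip of a bit in `P` reads only bits outside `P`, which no gate of the step changes, so the
order of the targets is irrelevant and the step acts as one simultaneous addition. -/
theorem reverse_prod_flatMap_eq_xorMap {n : ℕ} (P : Fin n → Prop) [DecidablePred P]
    (h : Fin n → Bits n → Bool)
    (hloc : ∀ q, P q → ∀ x y : Bits n, (∀ i, ¬ P i → x i = y i) → h q x = h q y)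
    (G : Fin n → List (Equiv.Perm (Bits n)))
    (hG : ∀ q x, (G q).reverse.prod x =
      if P q then Function.update x q (xor (x q) (h q x)) else x) (x : Bits n) :
    ((List.finRange n).flatMap G).reverse.prod x = xorMap P h x := by
  have key : ∀ qs : List (Fin n), qs.Nodup →
      (qs.flatMap G).reverse.prod x = xorMap (fun q => P q ∧ q ∈ qs) h x := by
    intro qs
    induction qs using List.reverseRecOn with
    | nil => intro _; ext q; simp [xorMap]
    | append_singleton qs q ih =>
      intro hnd
      rw [List.flatMap_append, reverse_prod_append, ih (hnd.of_append_left)]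
      have hq : q ∉ qs := by
        intro hq
        exact (List.nodup_append.1 hnd).2.2 q hq q (by simp) rfl
      simp only [List.flatMap_cons, List.flatMap_nil, List.append_nil, hG]
      have hsame : P q → h q (xorMap (fun q => P q ∧ q ∈ qs) h x) = h q x := fun hP =>
        hloc q hP _ _ fun i hi => by simp [xorMap, hi]
      by_cases hP : P q
      · rw [if_pos hP, hsame hP]
        ext i
        by_cases hi : i = q
        · subst hi
          rw [Function.update_self]
          simp [xorMap, hP, hq]
        · rw [Function.update_of_ne hi]
          simp [xorMap, hi]
      · rw [if_neg hP]
        ext i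
        by_cases hi : i = q
        · subst hi; simp [xorMap, hP]
        · simp [xorMap, hi]
  rw [key _ (List.nodup_finRange n)]
  ext q
  simp [xorMap]

/-- The content of register `r`. -/
def regStr {n : ℕ} (k r : ℕ) (x : Bits n) : Bits k :=
  fun s => if h : r * k + s < n then x ⟨r * k + s, h⟩ else false

theorem regStr_apply {n k r : ℕ} (h : (r + 1) * k ≤ n) (x : Bits n) (s : Fin k) :
    regStr k r x s = x (regBit r h s) := by
  have hlt : r * k + s < n := (regBit r h s).isLt
  rw [regStr, dif_pos hlt]; rfl

theorem randomizeBit_apply {n k m α : ℕ} (ω : Seed n k m α) (r : ℕ) (h : (r + 1) * k ≤ n)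
    (q : Fin n) (hq : (q : ℕ) / k ≠ r) (x : Bits n) :
    (randomizeBit ω r h q hq).reverse.prod x =
      Function.update x q
        (xor (x q) (coinXor ω.1 (List.finRange α) (ω.2 q) (regStr k r x))) := by
  have hreg : ∀ (y : Bits n) b, regStr k r (Function.update y q b) = regStr k r y := by
    intro y b
    ext s
    rw [regStr_apply h, regStr_apply h, Function.update_of_ne]
    rintro rfl
    exact hq (regBit_div r h s)
  have key : ∀ (js : List (Fin α)) (x : Bits n),
      (js.flatMap fun j => if ω.2 q j then
        [mcx (fun l => regBit r h ((ω.1 j).1 l)) (ω.1 j).2 q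
          (fun l e => hq (by rw [← e]; exact regBit_div r h _))] else []).reverse.prod x =
      Function.update x q (xor (x q) (coinXor ω.1 js (ω.2 q) (regStr k r x))) := by
    intro js
    induction js with
    | nil => intro x; simp [coinXor]
    | cons j js ih =>
      intro x
      rw [List.flatMap_cons, reverse_prod_append, ih, coinXor_cons]
      split_ifs with hb
      · rw [List.reverse_singleton, List.prod_singleton, mcx_apply, hreg, Function.update_self,
          Function.update_idem, hb, Bool.true_and, Bool.xor_assoc]
        simp only [fires, regStr_apply h]
      · simp only [List.reverse_nil, List.prod_nil, Equiv.Perm.one_apply]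
        rw [Bool.eq_false_iff.2 hb, Bool.false_and, Bool.false_xor]
  exact key _ x

theorem div_sub_lt {n k i : ℕ} {q : Fin n} (h : 2 ^ i ≤ (q : ℕ) / k) :
    ((q : ℕ) / k - 2 ^ i + 1) * k ≤ n := by
  have hp : 0 < 2 ^ i := Nat.two_pow_pos i
  have h1 : (q : ℕ) / k - 2 ^ i + 1 ≤ (q : ℕ) / k := by omega
  exact ((Nat.mul_le_mul_right k h1).trans (Nat.div_mul_le_self _ _)).trans q.isLt.le

theorem copyStep_apply {n k i : ℕ} (x : Bits n) :
    (copyStep n k i).reverse.prod x =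
      xorMap (fun q => 2 ^ i ≤ (q : ℕ) / k ∧ (q : ℕ) / k < 2 ^ (i + 1))
        (fun q x => x ⟨q - 2 ^ i * k, by omega⟩) x := by
  refine reverse_prod_flatMap_eq_xorMap _ _ ?_ _ ?_ x
  · intro q hq x y hxy
    refine hxy _ ?_
    simp only [not_and, not_lt]
    intro h
    have hk : 0 < k := by
      rcases Nat.eq_zero_or_pos k with rfl | hk
      · have := Nat.two_pow_pos i; simp at hq
      · exact hk
    rw [Nat.mul_comm, Nat.sub_mul_div] at h
    rw [pow_succ] at hq
    omega
  · intro q x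
    split_ifs with h
    · rw [List.reverse_singleton, List.prod_singleton, cnot_apply]
    · simp

theorem randomizeStep_apply {n k m α : ℕ} (ω : Seed n k m α) (i : ℕ) (x : Bits n) :
    (randomizeStep ω i).reverse.prod x =
      xorMap (fun q => 2 ^ i ≤ (q : ℕ) / k ∧ (q : ℕ) / k < 2 ^ (i + 1))
        (fun q x => coinXor ω.1 (List.finRange α) (ω.2 q) (regStr k ((q : ℕ) / k - 2 ^ i) x)) x := by
  refine reverse_prod_flatMap_eq_xorMap _ _ ?_ _ ?_ x
  · intro q hq x y hxy
    congr 1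
    ext s
    rw [regStr_apply (div_sub_lt hq.1), regStr_apply (div_sub_lt hq.1)]
    refine hxy _ ?_
    rw [regBit_div, pow_succ] at *
    omega
  · intro q x
    split_ifs with h
    · rw [randomizeBit_apply]
    · simp

theorem finalStep_apply {n k m α : ℕ} (ω : Seed n k m α) (x : Bits n) :
    (finalStep ω).reverse.prod x =
      xorMap (fun q => (q : ℕ) < k ∧ (1 + 1) * k ≤ n)
        (fun q x => coinXor ω.1 (List.finRange α) (ω.2 q) (regStr k 1 x)) x := by
  refine reverse_prod_flatMap_eq_xorMap _ _ ?_ _ ?_ x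
  · intro q hq x y hxy
    congr 1
    ext s
    rw [regStr_apply hq.2, regStr_apply hq.2]
    refine hxy _ ?_
    simp only [regBit]
    omega
  · intro q x
    split_ifs with h
    · rw [randomizeBit_apply]
    · simp

/-- The state of bit `q` after the copying tree. -/
def copyBit {k : ℕ} (hk : 0 < k) (L : ℕ) (v : Bits k) (q : ℕ) : Bool :=
  if q / k < 2 ^ L then v ⟨q % k, Nat.mod_lt _ hk⟩ else false

theorem copyTree_apply {n k : ℕ} (hk : 0 < k) (v : Bits k) (L : ℕ) :
    ((List.range L).flatMap (copyStep n k)).reverse.prod (pad n v) =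
      fun q : Fin n => copyBit hk L v q := by
  induction L with
  | zero =>
    ext q
    simp only [List.range_zero, List.flatMap_nil, List.reverse_nil, List.prod_nil,
      Equiv.Perm.one_apply, pad, copyBit, pow_zero, Nat.lt_one_iff, Nat.div_eq_zero_iff_lt hk]
    split_ifs with h
    · simp [Nat.mod_eq_of_lt h]
    · rfl
  | succ L ih =>
    rw [List.range_succ, List.flatMap_append, reverse_prod_append, ih]
    simp only [List.flatMap_cons, List.flatMap_nil, List.append_nil]
    rw [copyStep_apply]
    ext q
    simp only [xorMap, copyBit]
    have hmod : 2 ^ L ≤ (q : ℕ) / k → ((q : ℕ) - 2 ^ L * k) % k = q % k := by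
      intro h
      have h1 : 2 ^ L * k ≤ q := (Nat.le_div_iff_mul_le hk).1 h
      conv_rhs => rw [← Nat.sub_add_cancel h1, Nat.add_mul_mod_self_right]
    have hdiv : ((q : ℕ) - 2 ^ L * k) / k = q / k - 2 ^ L := by
      rw [Nat.mul_comm, Nat.sub_mul_div]
    rw [hdiv]
    have hp : 2 ^ (L + 1) = 2 ^ L + 2 ^ L := by rw [pow_succ]; ring
    have hp0 := Nat.two_pow_pos L
    by_cases h1 : (q : ℕ) / k < 2 ^ L
    · have h2 : ¬ 2 ^ L ≤ (q : ℕ) / k := by omega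
      have h3 : (q : ℕ) / k < 2 ^ (L + 1) := by omega
      simp [h1, h2, h3]
    · have h2 : 2 ^ L ≤ (q : ℕ) / k := by omega
      by_cases h3 : (q : ℕ) / k < 2 ^ (L + 1)
      · have h4 : (q : ℕ) / k - 2 ^ L < 2 ^ L := by omega
        simp only [h1, h2, h3, h4, hmod h2, if_true, if_false, and_self, Bool.false_xor]
      · simp [h1, h3]

theorem div_lt_numReg {n k : ℕ} (hk : 0 < k) (q : Fin n) : (q : ℕ) / k < numReg n k := by
  rw [Nat.div_lt_iff_lt_mul hk, mul_comm]
  refine q.isLt.trans_le ?_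
  have := le_smul_ceilDiv (a := k) (b := n) hk
  simpa [numReg, smul_eq_mul] using this

/-- Invariant of the downward pass: when step `i` is reached, the registers below `2 ^ (i + 1)`
still hold what the copying tree left, so the sources `r - 2 ^ i < 2 ^ i` all hold the input `v`. -/
theorem randomizeTree_apply {n k m α : ℕ} (hk : 0 < k) (ω : Seed n k m α) (v : Bits k) (i : ℕ)
    (hi : i ≤ numRounds n k) :
    ((List.range i).reverse.flatMap (randomizeStep ω)).reverse.prod
        (fun q : Fin n => if (q : ℕ) / k < 2 ^ i then copyBit hk (numRounds n k - 1) v q else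
          xor (copyBit hk (numRounds n k - 1) v q)
            (coinXor ω.1 (List.finRange α) (ω.2 q) v)) =
      fun q : Fin n => if (q : ℕ) / k < 1 then copyBit hk (numRounds n k - 1) v q else
          xor (copyBit hk (numRounds n k - 1) v q)
            (coinXor ω.1 (List.finRange α) (ω.2 q) v) := by
  induction i with
  | zero => simp
  | succ i ih =>
    rw [List.range_succ, List.reverse_append, List.flatMap_append, reverse_prod_append]
    simp only [List.reverse_singleton, List.flatMap_cons, List.flatMap_nil, List.append_nil]
    rw [randomizeStep_apply, ← ih (by omega)]
    congr 1
    ext q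
    simp only [xorMap]
    have hp : 2 ^ (i + 1) = 2 ^ i + 2 ^ i := by rw [pow_succ]; ring
    have hp0 := Nat.two_pow_pos i
    have hpL : 2 ^ i ≤ 2 ^ (numRounds n k - 1) := Nat.pow_le_pow_right (by norm_num) (by omega)
    by_cases h1 : (q : ℕ) / k < 2 ^ i
    · have h2 : ¬ 2 ^ i ≤ (q : ℕ) / k := by omega
      have h3 : (q : ℕ) / k < 2 ^ (i + 1) := by omega
      simp [h1, h2, h3]
    · have h2 : 2 ^ i ≤ (q : ℕ) / k := by omega
      by_cases h3 : (q : ℕ) / k < 2 ^ (i + 1)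
      · simp only [h1, h2, h3, if_true, if_false, and_self]
        congr 2
        ext s
        rw [regStr_apply (div_sub_lt h2), regBit_div, if_pos (by omega), copyBit, regBit_div,
          if_pos (by omega)]
        congr 1
        simp only [regBit, Fin.ext_iff]
        rw [Nat.add_comm, Nat.add_mul_mod_self_right, Nat.mod_eq_of_lt s.isLt]
      · simp [h1, h3]

theorem algorithmPerm_pad {n k m α : ℕ} (hk : 0 < k) (ω : Seed n k m α) (v : Bits k) :
    algorithmPerm ω (pad n v) =
      xorMap (fun q => (q : ℕ) < k ∧ (1 + 1) * k ≤ n)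
        (fun q x => coinXor ω.1 (List.finRange α) (ω.2 q) (regStr k 1 x))
        (fun q : Fin n => if (q : ℕ) / k < 1 then copyBit hk (numRounds n k - 1) v q else
          xor (copyBit hk (numRounds n k - 1) v q)
            (coinXor ω.1 (List.finRange α) (ω.2 q) v)) := by
  rw [algorithmPerm, algorithmGates, reverse_prod_append, reverse_prod_append, finalStep_apply,
    copyTree_apply hk, ← randomizeTree_apply hk ω v (numRounds n k) le_rfl]
  congr 3
  ext q
  rw [if_pos]
  exact (div_lt_numReg hk q).trans_le (Nat.le_pow_clog (by norm_num) _)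

theorem algorithmPerm_pad_high {n k m α : ℕ} (hk : 0 < k) (ω : Seed n k m α) (v : Bits k)
    (q : Fin n) (hq : k ≤ q) :
    algorithmPerm ω (pad n v) q = xor (copyBit hk (numRounds n k - 1) v q)
      (coinXor ω.1 (List.finRange α) (ω.2 q) v) := by
  rw [algorithmPerm_pad hk, xorMap, if_neg (by omega), if_neg]
  rw [Nat.lt_one_iff, Nat.div_eq_zero_iff_lt hk]
  omega

/-- The last step does not change register `1`, so its control content can be read from the output.
Once the output table is prescribed, the conditions on the coins of different bits therefore
decouple. -/
theorem algorithmPerm_pad_low {n k m α : ℕ} (hk : 0 < k) (ω : Seed n k m α) (v : Bits k)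
    (q : Fin n) (hq : (q : ℕ) < k) :
    algorithmPerm ω (pad n v) q = xor (v ⟨q, hq⟩) (decide ((1 + 1) * k ≤ n) &&
      coinXor ω.1 (List.finRange α) (ω.2 q) (regStr k 1 (algorithmPerm ω (pad n v)))) := by
  have h0 : (q : ℕ) / k = 0 := Nat.div_eq_of_lt hq
  have hv : copyBit hk (numRounds n k - 1) v q = v ⟨q, hq⟩ := by
    simp [copyBit, h0, Nat.mod_eq_of_lt hq]
  by_cases h : (1 + 1) * k ≤ n
  · have hreg : ∀ x : Bits n, regStr k 1 (xorMap (fun q => (q : ℕ) < k ∧ (1 + 1) * k ≤ n)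
        (fun q x => coinXor ω.1 (List.finRange α) (ω.2 q) (regStr k 1 x)) x) = regStr k 1 x := by
      intro x
      ext s
      rw [regStr_apply h, regStr_apply h, xorMap, if_neg]
      simp only [regBit]
      omega
    rw [algorithmPerm_pad hk, hreg, xorMap, if_pos ⟨hq, h⟩, h0, if_pos one_pos, hv,
      decide_eq_true h, Bool.true_and]
  · rw [algorithmPerm_pad hk, xorMap, if_neg (fun h' => h h'.2), h0, if_pos one_pos, hv,
      decide_eq_false h, Bool.false_and, Bool.xor_false]

/-! ### The law of the output table -/

/-- The number of pairs of a seed and a table of distinct rows that produce the table `y`. -/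
noncomputable def outcomeCount {n k m α t : ℕ} (y : Fin t → Bits n) : ℕ :=
  open Classical in
  (Finset.univ.filter fun p : Seed n k m α × (Fin t → Bits k) =>
    Function.Injective p.2 ∧ ∀ a, algorithmPerm p.1 (pad n (p.2 a)) = y a).card

/-- The number of tables of distinct rows. -/
noncomputable def injCount (n t : ℕ) : ℕ :=
  open Classical in (Finset.univ.filter fun y : Fin t → Bits n => Function.Injective y).card

theorem injCount_le (n t : ℕ) : (injCount n t : ℝ) ≤ 2 ^ (t * n) := by
  classical
  have h : injCount n t ≤ Fintype.card (Fin t → Bits n) := Finset.card_le_univ _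
  have h2 : Fintype.card (Fin t → Bits n) = 2 ^ (t * n) := by simp [pow_mul, mul_comm t n]
  rw [h2] at h
  exact_mod_cast h

/-- The coins of bit `q` that lead from the table `v` to the table `y`. -/
def goodCoins {n k m α t : ℕ} (hk : 0 < k) (f : Fin α → (Fin m ↪ Fin k) × (Fin m → Bool))
    (v : Fin t → Bits k) (y : Fin t → Bits n) (q : Fin n) : Finset (Fin α → Bool) :=
  Finset.univ.filter fun b =>
    if h : (q : ℕ) < k then
      if (1 + 1) * k ≤ n then
        ∀ a, coinXor f (List.finRange α) b (regStr k 1 (y a)) = xor (v a ⟨q, h⟩) (y a q)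
      else ∀ a, v a ⟨q, h⟩ = y a q
    else ∀ a, coinXor f (List.finRange α) b (v a) =
      xor (copyBit hk (numRounds n k - 1) (v a) q) (y a q)

theorem algorithmPerm_eq_of_mem_goodCoins {n k m α t : ℕ} (hk : 0 < k)
    {f : Fin α → (Fin m ↪ Fin k) × (Fin m → Bool)} {v : Fin t → Bits k} {y : Fin t → Bits n}
    {b : Fin n → Fin α → Bool} (hb : ∀ q, b q ∈ goodCoins hk f v y q) (a : Fin t) :
    algorithmPerm ((f, b) : Seed n k m α) (pad n (v a)) = y a := by
  have hb' := fun q => (Finset.mem_filter.1 (hb q)).2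
  have high : ∀ q : Fin n, k ≤ q →
      algorithmPerm ((f, b) : Seed n k m α) (pad n (v a)) q = y a q := by
    intro q hq
    have h1 := hb' q
    rw [dif_neg (by omega)] at h1
    rw [algorithmPerm_pad_high hk _ _ _ hq, h1 a]
    simp
  ext q
  by_cases hq : (q : ℕ) < k
  · have h1 := hb' q
    rw [dif_pos hq] at h1
    rw [algorithmPerm_pad_low hk _ _ _ hq]
    by_cases hn : (1 + 1) * k ≤ n
    · rw [if_pos hn] at h1
      have hreg : regStr k 1 (algorithmPerm ((f, b) : Seed n k m α) (pad n (v a))) =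
          regStr k 1 (y a) := by
        ext s
        rw [regStr_apply hn, regStr_apply hn, high]
        simp [regBit]
      rw [hreg, h1 a, decide_eq_true hn]
      simp
    · rw [if_neg hn] at h1
      rw [decide_eq_false hn, h1 a]
      simp
  · exact high q (by omega)

theorem prod_goodCoins_le {n k m α t : ℕ} (hk : 0 < k)
    (f : Fin α → (Fin m ↪ Fin k) × (Fin m → Bool)) (v : Fin t → Bits k) (y : Fin t → Bits n) :
    ∏ q, (goodCoins hk f v y q).card ≤ (Finset.univ.filter fun b : Fin n → Fin α → Bool =>
      ∀ a, algorithmPerm ((f, b) : Seed n k m α) (pad n (v a)) = y a).card := by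
  rw [← Fintype.card_piFinset]
  refine Finset.card_le_card fun b hb => ?_
  rw [Fintype.mem_piFinset] at hb
  exact Finset.mem_filter.2 ⟨Finset.mem_univ _, algorithmPerm_eq_of_mem_goodCoins hk hb⟩

theorem IsSeparating.card_coins_real {k m α t : ℕ}
    {f : Fin α → (Fin m ↪ Fin k) × (Fin m → Bool)}
    {v : Fin t → Bits k} (h : IsSeparating f v) (w : Fin t → Bool) :
    ((Finset.univ.filter fun b : Fin α → Bool =>
        ∀ a, coinXor f (List.finRange α) b (v a) = w a).card : ℝ) = 2 ^ α / 2 ^ t := by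
  rw [eq_div_iff (by positivity)]
  have := h.card_coins w
  norm_cast

/-- The condition on the coins of each bit prescribes the parities on a separated table: the input
for bits beyond register `0`, register `1` of the output for the others. Each bit contributes a
factor `2 ^ (-t)`. -/
theorem card_outcome_wide {n k m α t : ℕ} (hk : 0 < k) (hn : (1 + 1) * k ≤ n)
    {f : Fin α → (Fin m ↪ Fin k) × (Fin m → Bool)} {v : Fin t → Bits k} {y : Fin t → Bits n}
    (hv : IsSeparating f v) (hy : IsSeparating f fun a => regStr k 1 (y a)) :
    ((2 : ℝ) ^ α) ^ n / 2 ^ (t * n) ≤ (Finset.univ.filter fun b : Fin n → Fin α → Bool =>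
      ∀ a, algorithmPerm ((f, b) : Seed n k m α) (pad n (v a)) = y a).card := by
  refine le_trans (le_of_eq ?_) (Nat.cast_le.2 (prod_goodCoins_le hk f v y))
  have h1 : ∀ q, ((goodCoins hk f v y q).card : ℝ) = 2 ^ α / 2 ^ t := by
    intro q
    by_cases hq : (q : ℕ) < k
    · simp only [goodCoins, dif_pos hq, if_pos hn]
      exact hy.card_coins_real _
    · simp only [goodCoins, dif_neg hq]
      exact hv.card_coins_real _
  push_cast
  simp only [h1, Finset.prod_const, Finset.card_univ, Fintype.card_fin, div_pow, pow_mul]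

/-- Without a full second register, register `0` is never changed: the input is forced to be
register `0` of the output, and the coins of the first `k` bits are free. Only `n - k` bits
contribute a factor `2 ^ (-t)`. -/
theorem card_outcome_narrow {n k m α t : ℕ} (hk : 0 < k) (hkn : k ≤ n) (hn : ¬ (1 + 1) * k ≤ n)
    {f : Fin α → (Fin m ↪ Fin k) × (Fin m → Bool)} {y : Fin t → Bits n}
    (hy : IsSeparating f fun a => regStr k 0 (y a)) :
    ((2 : ℝ) ^ α) ^ n / 2 ^ (t * (n - k)) ≤ (Finset.univ.filter fun b : Fin n → Fin α → Bool =>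
      ∀ a, algorithmPerm ((f, b) : Seed n k m α) (pad n (regStr k 0 (y a))) = y a).card := by
  refine le_trans (le_of_eq ?_)
    (Nat.cast_le.2 (prod_goodCoins_le hk f (fun a => regStr k 0 (y a)) y))
  have h1 : ∀ q, ((goodCoins hk f (fun a => regStr k 0 (y a)) y q).card : ℝ) =
      2 ^ α / (if (q : ℕ) < k then 1 else 2 ^ t) := by
    intro q
    by_cases hq : (q : ℕ) < k
    · simp only [goodCoins, dif_pos hq, if_neg hn, if_pos hq]
      rw [Finset.filter_true_of_mem]
      · simp
      · intro b _ a
        rw [regStr, dif_pos (by simp)]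
        congr 1
        simp
    · simp only [goodCoins, dif_neg hq, if_neg hq]
      exact hy.card_coins_real _
  push_cast
  simp only [h1, Finset.prod_div_distrib, Finset.prod_const, Finset.card_univ, Fintype.card_fin]
  congr 1
  rw [Finset.prod_ite, Finset.prod_const_one, one_mul, Finset.prod_const, ← pow_mul]
  congr 2
  have : (Finset.univ.filter fun q : Fin n => ¬ (q : ℕ) < k).card = n - k := by
    rw [Finset.filter_not, Finset.card_sdiff_of_subset (Finset.filter_subset _ _), Finset.card_univ,
      Fintype.card_fin, Fin.card_filter_val_lt, min_eq_right hkn]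
  rw [this]

/-- A register of a uniform table is uniform. Adding a fixed table to the register permutes the
tables `y`; averaging over all added tables `u` makes each summand independent of `y`. -/
theorem sum_regStr {n k r t : ℕ} (h : (r + 1) * k ≤ n) (φ : (Fin t → Bits k) → ℝ) :
    (∑ y : Fin t → Bits n, φ fun a => regStr k r (y a)) * 2 ^ (t * k) =
      2 ^ (t * n) * ∑ u, φ u := by
  set ins : Bits k → Bits n := fun u q =>
    if hq : r * k ≤ q ∧ (q : ℕ) < r * k + k then u ⟨q - r * k, by omega⟩ else false
  have hins : ∀ (x : Bits n) (u : Bits k), regStr k r (fun q => xor (x q) (ins u q)) =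
      fun s => xor (regStr k r x s) (u s) := by
    intro x u
    ext s
    rw [regStr_apply h, regStr_apply h]
    congr 1
    have hs := s.isLt
    simp only [ins, regBit]
    rw [dif_pos ⟨by omega, by omega⟩]
    congr 1
    ext
    simp
  have hshift : ∀ u : Fin t → Bits k, ∑ y : Fin t → Bits n, φ (fun a => regStr k r (y a)) =
      ∑ y : Fin t → Bits n, φ (fun a s => xor (regStr k r (y a) s) (u a s)) := by
    intro u
    have hinv : Function.Involutive
        (fun (y : Fin t → Bits n) a q => xor (y a q) (ins (u a) q)) := by
      intro y; ext a q; simp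
    rw [← Equiv.sum_comp hinv.toPerm]
    refine Finset.sum_congr rfl fun y _ => ?_
    congr 1
    ext a s
    exact congrFun (hins (y a) (u a)) s
  have h1 : ((∑ y : Fin t → Bits n, φ fun a => regStr k r (y a)) * 2 ^ (t * k)) =
      ∑ u : Fin t → Bits k, ∑ y : Fin t → Bits n,
        φ (fun a s => xor (regStr k r (y a) s) (u a s)) := by
    simp only [← hshift, Finset.sum_const, Finset.card_univ, Fintype.card_pi, Fintype.card_bool,
      Finset.prod_const, Fintype.card_fin, nsmul_eq_mul]
    rw [mul_comm t k, pow_mul, mul_comm]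
    push_cast
    rfl
  rw [h1, Finset.sum_comm]
  have h2 : ∀ y : Fin t → Bits n, ∑ u : Fin t → Bits k,
      φ (fun a s => xor (regStr k r (y a) s) (u a s)) = ∑ u, φ u := by
    intro y
    have hinv : Function.Involutive
        (fun (u : Fin t → Bits k) a s => xor (regStr k r (y a) s) (u a s)) := by
      intro u; ext a s; simp
    exact Equiv.sum_comp hinv.toPerm φ
  simp only [h2, Finset.sum_const, Finset.card_univ, Fintype.card_pi, Fintype.card_bool,
      Finset.prod_const, Fintype.card_fin, nsmul_eq_mul]
  rw [mul_comm t n, pow_mul]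
  push_cast
  rfl

theorem outcomeCount_eq {n k m α t : ℕ} (y : Fin t → Bits n) :
    (outcomeCount (k := k) (m := m) (α := α) y : ℝ) =
      open Classical in
      ∑ f : Fin α → (Fin m ↪ Fin k) × (Fin m → Bool), ∑ v : Fin t → Bits k,
        if Function.Injective v then
          ((Finset.univ.filter fun b : Fin n → Fin α → Bool =>
            ∀ a, algorithmPerm ((f, b) : Seed n k m α) (pad n (v a)) = y a).card : ℝ) else 0 := by
  classical
  rw [outcomeCount, Finset.card_filter, Fintype.sum_prod_type, Fintype.sum_prod_type]
  push_cast
  refine Finset.sum_congr rfl fun f _ => ?_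
  rw [Finset.sum_comm]
  refine Finset.sum_congr rfl fun v _ => ?_
  split_ifs with hv
  · simp only [hv, true_and, Finset.card_filter]
    push_cast
    rfl
  · simp [hv]

theorem card_seed (n k m α : ℕ) : (Fintype.card (Seed n k m α) : ℝ) =
    Fintype.card (Fin α → (Fin m ↪ Fin k) × (Fin m → Bool)) * ((2 : ℝ) ^ α) ^ n := by
  rw [Fintype.card_prod]
  push_cast
  congr 1
  simp

-- The function `g` keeps only the contribution of gates that separate both the input and register
-- `1` of the output. Normalizing by `injCount k t` instead of `2 ^ (t * k)` only helps, because
-- separated inputs have distinct rows.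
open Classical in
theorem exists_lower_bound_wide {n k m α t : ℕ} (hk : 0 < k) (hn : (1 + 1) * k ≤ n)
    (hinj : 0 < injCount k t) (hS : 0 < Fintype.card (Fin α → (Fin m ↪ Fin k) × (Fin m → Bool)))
    {β : ℝ}
    (hβ : ((Finset.univ.filter fun p : (Fin α → (Fin m ↪ Fin k) × (Fin m → Bool)) ×
      (Fin t → Bits k) => ¬ IsSeparating p.1 p.2).card : ℝ) ≤
      β * (Fintype.card (Fin α → (Fin m ↪ Fin k) × (Fin m → Bool)) * 2 ^ (t * k))) :
    ∃ g : (Fin t → Bits n) → ℝ,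
      (∀ y, g y ≤ outcomeCount (k := k) (m := m) (α := α) y /
        (Fintype.card (Seed n k m α) * injCount k t)) ∧
      (∀ y, g y ≤ if Function.Injective y then (1 : ℝ) / injCount n t else 0) ∧
      1 - 2 * β ≤ ∑ y, g y := by
  set F : ℝ := (Fintype.card (Fin α → (Fin m ↪ Fin k) × (Fin m → Bool)) : ℝ) with hF
  have hF0 : 0 < F := by simp only [F]; exact_mod_cast hS
  set s : (Fin α → (Fin m ↪ Fin k) × (Fin m → Bool)) → ℝ := fun f =>
    (∑ v : Fin t → Bits k, if IsSeparating f v then 1 else 0) / 2 ^ (t * k)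
  have hs0 : ∀ f, 0 ≤ s f := fun f => by
    refine div_nonneg (Finset.sum_nonneg fun v _ => ?_) (by positivity)
    split_ifs <;> norm_num
  have hs1 : ∀ f, s f ≤ 1 := fun f => by
    simp only [s]
    rw [div_le_one (by positivity)]
    calc (∑ v : Fin t → Bits k, if IsSeparating f v then (1 : ℝ) else 0)
        ≤ ∑ v : Fin t → Bits k, 1 := Finset.sum_le_sum fun v _ => by split_ifs <;> norm_num
      _ = _ := by simp [pow_mul, mul_comm t k]
  set g : (Fin t → Bits n) → ℝ := fun y =>
    (∑ f, s f * if IsSeparating f fun a => regStr k 1 (y a) then 1 else 0) / (F * 2 ^ (t * n))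
  have hinjr : (0 : ℝ) < injCount k t := by exact_mod_cast hinj
  refine ⟨g, fun y => ?_, fun y => ?_, ?_⟩
  · have h1 : ∑ f, s f * 2 ^ (t * k) * (if IsSeparating f fun a => regStr k 1 (y a) then 1 else 0) *
        (((2 : ℝ) ^ α) ^ n / 2 ^ (t * n)) ≤ outcomeCount (k := k) (m := m) (α := α) y := by
      rw [outcomeCount_eq]
      refine Finset.sum_le_sum fun f _ => ?_
      have e : s f * 2 ^ (t * k) = ∑ v : Fin t → Bits k, if IsSeparating f v then (1 : ℝ) else 0 := by
        simp only [s]; field_simp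
      rw [e, Finset.sum_mul, Finset.sum_mul]
      refine Finset.sum_le_sum fun v _ => ?_
      by_cases hv : IsSeparating f v
      · by_cases hy : IsSeparating f fun a => regStr k 1 (y a)
        · rw [if_pos hv, if_pos hy, if_pos hv.injective, one_mul, one_mul]
          convert card_outcome_wide hk hn hv hy
        · rw [if_neg hy, mul_zero, zero_mul]
          split_ifs <;> positivity
      · rw [if_neg hv, zero_mul, zero_mul]
        split_ifs <;> positivity
    rw [le_div_iff₀ (by rw [card_seed]; positivity), card_seed, ← hF]
    refine le_trans ?_ h1
    simp only [g]
    rw [← Finset.sum_mul]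
    have h2 : ∑ f, s f * 2 ^ (t * k) *
        (if IsSeparating f fun a => regStr k 1 (y a) then (1 : ℝ) else 0) =
        2 ^ (t * k) * ∑ f, s f * (if IsSeparating f fun a => regStr k 1 (y a) then 1 else 0) := by
      rw [Finset.mul_sum]; exact Finset.sum_congr rfl fun f _ => by ring
    rw [h2]
    set A := ∑ f, s f * (if IsSeparating f fun a => regStr k 1 (y a) then (1 : ℝ) else 0)
    have hA : 0 ≤ A := Finset.sum_nonneg fun f _ => mul_nonneg (hs0 f) (by split_ifs <;> norm_num)
    have h3 : A / (F * 2 ^ (t * n)) * (F * (2 ^ α) ^ n * injCount k t) =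
        injCount k t * A * ((2 ^ α) ^ n / 2 ^ (t * n)) := by field_simp
    rw [h3]
    gcongr
    exact injCount_le k t
  · have hsum : ∑ f, s f * (if IsSeparating f fun a => regStr k 1 (y a) then (1 : ℝ) else 0) ≤ F := by
      calc _ ≤ ∑ f : Fin α → (Fin m ↪ Fin k) × (Fin m → Bool), (1 : ℝ) := by
            refine Finset.sum_le_sum fun f _ => ?_
            split_ifs
            · simpa using hs1 f
            · simp
        _ = F := by simp [F]
    split_ifs with hy
    · have hpos : (0 : ℝ) < injCount n t := by
        have : 0 < injCount n t :=
          Finset.card_pos.2 ⟨y, Finset.mem_filter.2 ⟨Finset.mem_univ _, hy⟩⟩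
        exact_mod_cast this
      simp only [g]
      calc _ ≤ F / (F * 2 ^ (t * n)) := by gcongr
        _ = 1 / 2 ^ (t * n) := by field_simp
        _ ≤ _ := one_div_le_one_div_of_le hpos (injCount_le n t)
    · simp only [g]
      rw [Finset.sum_eq_zero, zero_div]
      intro f _
      rw [if_neg, mul_zero]
      intro h
      exact hy fun a b hab => h.injective (by simp only [hab])
  · have h1 : ∑ y : Fin t → Bits n, g y = (∑ f, s f * s f) / F := by
      simp only [g]
      rw [← Finset.sum_div, Finset.sum_comm]
      simp only [← Finset.mul_sum]
      have h2 : ∀ f, ∑ y : Fin t → Bits n,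
          (if IsSeparating f fun a => regStr k 1 (y a) then (1 : ℝ) else 0) = 2 ^ (t * n) * s f := by
        intro f
        have := sum_regStr hn (fun u : Fin t → Bits k => if IsSeparating f u then (1 : ℝ) else 0)
        simp only [s]
        rw [mul_div_assoc', eq_div_iff (by positivity)]
        exact this
      simp only [h2]
      have h3 : ∑ f, s f * (2 ^ (t * n) * s f) = 2 ^ (t * n) * ∑ f, s f * s f := by
        rw [Finset.mul_sum]; exact Finset.sum_congr rfl fun f _ => by ring
      rw [h3]
      field_simp
    have h2 : (1 - β) * F ≤ ∑ f, s f := by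
      have h3 : ∑ f, s f = ∑ f : Fin α → (Fin m ↪ Fin k) × (Fin m → Bool), (1 - (∑ v : Fin t → Bits k,
          if ¬ IsSeparating f v then (1 : ℝ) else 0) / 2 ^ (t * k)) := by
        refine Finset.sum_congr rfl fun f _ => ?_
        simp only [s]
        rw [eq_sub_iff_add_eq, ← add_div, div_eq_one_iff_eq (by positivity),
          ← Finset.sum_add_distrib]
        have : ∀ v : Fin t → Bits k, ((if IsSeparating f v then (1 : ℝ) else 0) +
            if ¬ IsSeparating f v then (1 : ℝ) else 0) = 1 := by intro v; split_ifs <;> norm_num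
        simp only [this]
        simp [pow_mul, mul_comm t k]
      rw [h3, Finset.sum_sub_distrib, ← Finset.sum_div]
      have h4 : ∑ f : Fin α → (Fin m ↪ Fin k) × (Fin m → Bool), ∑ v : Fin t → Bits k, (if ¬ IsSeparating f v then (1 : ℝ) else 0) ≤
          β * (F * 2 ^ (t * k)) := by
        refine le_trans (le_of_eq ?_) hβ
        rw [Finset.card_filter, Fintype.sum_prod_type]
        push_cast
        rfl
      have h5 : (∑ f : Fin α → (Fin m ↪ Fin k) × (Fin m → Bool), ∑ v : Fin t → Bits k, (if ¬ IsSeparating f v then (1 : ℝ) else 0)) /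
          2 ^ (t * k) ≤ β * F := by
        rw [div_le_iff₀ (by positivity)]; linarith
      have h6 : ∑ _f : Fin α → (Fin m ↪ Fin k) × (Fin m → Bool), (1 : ℝ) = F := by simp [F]
      rw [h6]
      linarith
    -- The same gates must separate two uniform tables, so the mass of `g` is the mean of `s ^ 2`,
    -- at least twice the mean of `s` minus 1.
    have h3 : ∑ f, (2 * s f - 1) ≤ ∑ f, s f * s f :=
      Finset.sum_le_sum fun f _ => by nlinarith [sq_nonneg (s f - 1)]
    rw [Finset.sum_sub_distrib, ← Finset.mul_sum] at h3
    have h6 : ∑ _f : Fin α → (Fin m ↪ Fin k) × (Fin m → Bool), (1 : ℝ) = F := by simp [F]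
    rw [h6] at h3
    rw [h1, le_div_iff₀ hF0]
    linarith

-- Here only one table has to be separated, since the input is register `0` of the output; the loss
-- is `β` instead of `2β`.
open Classical in
theorem exists_lower_bound_narrow {n k m α t : ℕ} (hk : 0 < k) (hkn : k ≤ n)
    (hn : ¬ (1 + 1) * k ≤ n)
    (hinj : 0 < injCount k t) (hS : 0 < Fintype.card (Fin α → (Fin m ↪ Fin k) × (Fin m → Bool)))
    {β : ℝ}
    (hβ : ((Finset.univ.filter fun p : (Fin α → (Fin m ↪ Fin k) × (Fin m → Bool)) ×
      (Fin t → Bits k) => ¬ IsSeparating p.1 p.2).card : ℝ) ≤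
      β * (Fintype.card (Fin α → (Fin m ↪ Fin k) × (Fin m → Bool)) * 2 ^ (t * k))) :
    ∃ g : (Fin t → Bits n) → ℝ,
      (∀ y, g y ≤ outcomeCount (k := k) (m := m) (α := α) y /
        (Fintype.card (Seed n k m α) * injCount k t)) ∧
      (∀ y, g y ≤ if Function.Injective y then (1 : ℝ) / injCount n t else 0) ∧
      1 - β ≤ ∑ y, g y := by
  set F : ℝ := (Fintype.card (Fin α → (Fin m ↪ Fin k) × (Fin m → Bool)) : ℝ) with hF
  have hF0 : 0 < F := by simp only [F]; exact_mod_cast hS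
  set c : (Fin t → Bits k) → ℝ := fun u =>
    ∑ f : Fin α → (Fin m ↪ Fin k) × (Fin m → Bool), if IsSeparating f u then 1 else 0
  have hc0 : ∀ u, 0 ≤ c u := fun u => Finset.sum_nonneg fun f _ => by split_ifs <;> norm_num
  have hinjr : (0 : ℝ) < injCount k t := by exact_mod_cast hinj
  refine ⟨fun y => c (fun a => regStr k 0 (y a)) / (F * 2 ^ (t * n)), fun y => ?_, fun y => ?_, ?_⟩
  · have h1 : c (fun a => regStr k 0 (y a)) * (((2 : ℝ) ^ α) ^ n / 2 ^ (t * (n - k))) ≤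
        outcomeCount (k := k) (m := m) (α := α) y := by
      rw [outcomeCount_eq]
      simp only [c]
      rw [Finset.sum_mul]
      refine Finset.sum_le_sum fun f _ => ?_
      refine le_trans ?_ (Finset.single_le_sum (f := fun v : Fin t → Bits k =>
        if Function.Injective v then ((Finset.univ.filter fun b : Fin n → Fin α → Bool =>
            ∀ a, algorithmPerm ((f, b) : Seed n k m α) (pad n (v a)) = y a).card : ℝ) else 0)
        (fun v _ => by split_ifs <;> positivity) (Finset.mem_univ fun a => regStr k 0 (y a)))
      by_cases hy : IsSeparating f fun a => regStr k 0 (y a)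
      · rw [if_pos hy, if_pos hy.injective, one_mul]
        convert card_outcome_narrow hk hkn hn hy
      · rw [if_neg hy, zero_mul]
        split_ifs <;> positivity
    rw [le_div_iff₀ (by rw [card_seed]; positivity), card_seed, ← hF]
    refine le_trans ?_ h1
    set A := c (fun a => regStr k 0 (y a))
    have hA : 0 ≤ A := hc0 _
    have hpow : (2 : ℝ) ^ (t * n) = 2 ^ (t * (n - k)) * 2 ^ (t * k) := by
      rw [← pow_add, ← Nat.mul_add, Nat.sub_add_cancel hkn]
    have h3 : A / (F * 2 ^ (t * n)) * (F * (2 ^ α) ^ n * injCount k t) =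
        A * ((2 ^ α) ^ n / 2 ^ (t * (n - k))) * (injCount k t / 2 ^ (t * k)) := by
      rw [hpow]; field_simp
    rw [h3]
    refine mul_le_of_le_one_right (by positivity) ?_
    rw [div_le_one (by positivity)]
    exact injCount_le k t
  · have hsum : c (fun a => regStr k 0 (y a)) ≤ F := by
      calc c (fun a => regStr k 0 (y a)) ≤
          ∑ f : Fin α → (Fin m ↪ Fin k) × (Fin m → Bool), (1 : ℝ) :=
            Finset.sum_le_sum fun f _ => by split_ifs <;> norm_num
        _ = F := by simp [F]
    show c (fun a => regStr k 0 (y a)) / (F * 2 ^ (t * n)) ≤ _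
    split_ifs with hy
    · have hpos : (0 : ℝ) < injCount n t := by
        have : 0 < injCount n t :=
          Finset.card_pos.2 ⟨y, Finset.mem_filter.2 ⟨Finset.mem_univ _, hy⟩⟩
        exact_mod_cast this
      calc _ ≤ F / (F * 2 ^ (t * n)) := by gcongr
        _ = 1 / 2 ^ (t * n) := by field_simp
        _ ≤ _ := one_div_le_one_div_of_le hpos (injCount_le n t)
    · have : c (fun a => regStr k 0 (y a)) = 0 := by
        refine Finset.sum_eq_zero fun f _ => if_neg fun h => hy fun a b hab => h.injective ?_
        simp only [hab]
      rw [this, zero_div]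
  · rw [← Finset.sum_div]
    have h1 := sum_regStr (r := 0) (by omega) c (n := n) (k := k)
    have h2 : (1 - β) * (F * 2 ^ (t * k)) ≤ ∑ u, c u := by
      have h3 : ∑ u, c u + ∑ u : Fin t → Bits k, ∑ f : Fin α → (Fin m ↪ Fin k) × (Fin m → Bool),
          (if ¬ IsSeparating f u then (1 : ℝ) else 0) = F * 2 ^ (t * k) := by
        simp only [c, ← Finset.sum_add_distrib]
        have : ∀ (u : Fin t → Bits k) (f : Fin α → (Fin m ↪ Fin k) × (Fin m → Bool)),
            ((if IsSeparating f u then (1 : ℝ) else 0) +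
            if ¬ IsSeparating f u then (1 : ℝ) else 0) = 1 := by
          intro u f; split_ifs <;> norm_num
        simp only [this, F]
        simp only [Finset.sum_const, nsmul_eq_mul, mul_one, Finset.card_univ]
        rw [mul_comm]
        congr 1
        simp [pow_mul, mul_comm t k]
      have h4 : ∑ u : Fin t → Bits k, ∑ f : Fin α → (Fin m ↪ Fin k) × (Fin m → Bool),
          (if ¬ IsSeparating f u then (1 : ℝ) else 0) ≤ β * (F * 2 ^ (t * k)) := by
        refine le_trans (le_of_eq ?_) hβ
        rw [Finset.card_filter, Fintype.sum_prod_type_right]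
        push_cast
        rfl
      linarith
    rw [le_div_iff₀ (by positivity)]
    have h5 : (0 : ℝ) < 2 ^ (t * k) := by positivity
    have h6 : (0 : ℝ) < 2 ^ (t * n) := by positivity
    refine le_of_mul_le_mul_right ?_ h5
    rw [h1]
    nlinarith

/-! ### The trace norm of a combination of orthogonal projections -/

-- The eigenvalues of `Aᴴ * A` are compared as roots of a characteristic polynomial: by the spectral
-- theorem those of `B * B` are the squares of the eigenvalues of `B`, which are nonnegative.
open scoped ComplexOrder in
theorem traceNorm_eq_trace {ι : Type} [Fintype ι] [DecidableEq ι] {A B : Matrix ι ι ℂ}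
    (hB : B.PosSemidef) (h : B * B = Aᴴ * A) : traceNorm A = B.trace.re := by
  have hH := hB.isHermitian
  have hroots : (Aᴴ * A).charpoly.roots =
      Finset.univ.val.map fun i => ((hH.eigenvalues i ^ 2 : ℝ) : ℂ) := by
    have h1 : (B * B).charpoly =
        ∏ i, (Polynomial.X - Polynomial.C (((hH.eigenvalues i ^ 2 : ℝ) : ℂ))) := by
      conv_lhs => rw [hH.spectral_theorem, ← map_mul, Unitary.conjStarAlgAut_apply,
        Matrix.charpoly_mul_comm, ← mul_assoc]
      simp [Matrix.charpoly_diagonal, sq]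
    rw [← h, h1, Polynomial.roots_prod]
    · simp only [Polynomial.roots_X_sub_C, Multiset.bind_singleton]
    · exact Finset.prod_ne_zero_iff.2 fun i _ => Polynomial.X_sub_C_ne_zero _
  rw [(Matrix.isHermitian_conjTranspose_mul_self A).roots_charpoly_eq_eigenvalues] at hroots
  have h2 := congrArg (fun s : Multiset ℂ => (s.map fun z => Real.sqrt z.re).sum) hroots
  simp only [Multiset.map_map, Function.comp_def, Complex.ofReal_re, RCLike.ofReal_eq_complex_ofReal]
    at h2
  rw [traceNorm, hH.trace_eq_sum_eigenvalues]
  simp only [RCLike.ofReal_eq_complex_ofReal, Complex.re_sum, Complex.ofReal_re]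
  refine h2.trans (Finset.sum_congr rfl fun i _ => ?_)
  exact Real.sqrt_sq (hB.eigenvalues_nonneg i)

open scoped ComplexOrder in
theorem traceNorm_sum_smul_vecMulVec {ι κ : Type} [Fintype ι] [DecidableEq ι] [DecidableEq κ]
    (s : Finset κ) (u : κ → ι → ℂ)
    (hu : ∀ a ∈ s, ∀ b ∈ s, star (u a) ⬝ᵥ u b = if a = b then 1 else 0) (c : κ → ℝ) :
    traceNorm (∑ a ∈ s, (c a : ℂ) • Matrix.vecMulVec (u a) (star (u a))) = ∑ a ∈ s, |c a| := by
  have hmul : ∀ c d : κ → ℝ, (∑ a ∈ s, (c a : ℂ) • Matrix.vecMulVec (u a) (star (u a))) *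
      (∑ a ∈ s, (d a : ℂ) • Matrix.vecMulVec (u a) (star (u a))) =
      ∑ a ∈ s, ((c a * d a : ℝ) : ℂ) • Matrix.vecMulVec (u a) (star (u a)) := by
    intro c d
    rw [Finset.sum_mul_sum]
    refine Finset.sum_congr rfl fun a ha => ?_
    rw [Finset.sum_eq_single a]
    · rw [smul_mul_smul_comm, Matrix.vecMulVec_mul_vecMulVec, hu a ha a ha, if_pos rfl]
      simp
    · intro b hb hba
      rw [smul_mul_smul_comm, Matrix.vecMulVec_mul_vecMulVec, hu a ha b hb, if_neg (Ne.symm hba)]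
      simp
    · exact fun h => absurd ha h
  have hher : (∑ a ∈ s, (c a : ℂ) • Matrix.vecMulVec (u a) (star (u a)))ᴴ =
      ∑ a ∈ s, (c a : ℂ) • Matrix.vecMulVec (u a) (star (u a)) := by
    simp [Matrix.conjTranspose_sum, Matrix.conjTranspose_vecMulVec]
  have hB : (∑ a ∈ s, ((|c a| : ℝ) : ℂ) • Matrix.vecMulVec (u a) (star (u a))).PosSemidef := by
    refine Matrix.posSemidef_sum _ fun a _ => ?_
    refine (Matrix.posSemidef_vecMulVec_self_star (u a)).smul ?_
    exact_mod_cast abs_nonneg (c a)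
  rw [traceNorm_eq_trace hB (by rw [hher, hmul, hmul]; simp only [abs_mul_abs_self])]
  rw [Matrix.trace_sum, Complex.re_sum]
  refine Finset.sum_congr rfl fun a ha => ?_
  rw [Matrix.trace_smul, Matrix.trace_vecMulVec, dotProduct_comm, hu a ha a ha]
  simp

/-! ### Type states -/

theorem card_image_eq {X : Type} [Fintype X] [DecidableEq X] {t : ℕ} {T : Finset X}
    (hT : T.card = t) :
    (Finset.univ.filter fun v : Fin t → X => Finset.univ.image v = T).card = t.factorial := by
  have h1 : Fintype.card (Fin t ≃ T) = t.factorial := by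
    rw [Fintype.card_equiv (T.equivFinOfCardEq hT).symm, Fintype.card_fin]
  rw [← h1, ← Finset.card_univ]
  symm
  refine Finset.card_nbij (fun e a => (e a : X)) ?_ ?_ ?_
  · intro e _
    simp only [Finset.coe_filter, Finset.mem_univ, true_and, Set.mem_ofPred_eq]
    ext x
    simp only [Finset.mem_image, Finset.mem_univ, true_and]
    exact ⟨fun ⟨a, ha⟩ => ha ▸ (e a).2, fun hx => ⟨e.symm ⟨x, hx⟩, by simp⟩⟩
  · intro e _ e' _ h
    ext a
    exact congrFun h a
  · intro v hv
    have hv' : Finset.univ.image v = T := by simpa using hv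
    have hmem : ∀ a, v a ∈ T := fun a => hv' ▸ Finset.mem_image_of_mem v (Finset.mem_univ a)
    have hsurj : Function.Surjective fun a => (⟨v a, hmem a⟩ : T) := by
      rintro ⟨x, hx⟩
      rw [← hv'] at hx
      obtain ⟨a, -, ha⟩ := Finset.mem_image.1 hx
      exact ⟨a, Subtype.ext ha⟩
    have hbij := (Fintype.bijective_iff_surjective_and_card _).2 ⟨hsurj, by simp [hT]⟩
    exact ⟨Equiv.ofBijective _ hbij, by simp, rfl⟩

theorem injective_iff_card_image {X : Type} [DecidableEq X] {t : ℕ} (v : Fin t → X) :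
    Function.Injective v ↔ (Finset.univ.image v).card = t := by
  have h := Finset.card_image_iff (s := (Finset.univ : Finset (Fin t))) (f := v)
  rw [Finset.card_univ, Fintype.card_fin] at h
  rw [h, Finset.coe_univ, Set.injOn_univ]

/-- Each set of `t` strings has `t!` orderings. This passes between mixtures over sets and laws on
tables. -/
theorem sum_injective_image {M : Type} [AddCommMonoid M] {n t : ℕ} (φ : Finset (Bits n) → M) :
    (open Classical in ∑ y ∈ Finset.univ.filter fun y : Fin t → Bits n => Function.Injective y,
      φ (Finset.univ.image y)) = t.factorial • ∑ T ∈ Finset.univ.powersetCard t, φ T := by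
  classical
  rw [Finset.smul_sum, ← Finset.sum_fiberwise_of_maps_to (t := Finset.univ.powersetCard t)
    (g := fun y : Fin t → Bits n => Finset.univ.image y)]
  · refine Finset.sum_congr rfl fun T hT => ?_
    have hT' := (Finset.mem_powersetCard.1 hT).2
    rw [← card_image_eq hT', ← Finset.sum_const]
    refine Finset.sum_congr ?_ ?_
    · ext y
      simp only [Finset.mem_filter, Finset.mem_univ, true_and, and_iff_right_iff_imp,
        injective_iff_card_image]
      rintro rfl; exact hT'
    · intro y hy
      rw [(Finset.mem_filter.1 hy).2]
  · intro y hy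
    exact Finset.mem_powersetCard.2
      ⟨Finset.subset_univ _, (injective_iff_card_image y).1 (Finset.mem_filter.1 hy).2⟩

theorem injCount_eq (n t : ℕ) : injCount n t =
    t.factorial * (Finset.univ.powersetCard t : Finset (Finset (Bits n))).card := by
  have h := sum_injective_image (n := n) (t := t) (fun _ => 1)
  simpa [injCount] using h

theorem typeVec_orthonormal {n t : ℕ} {T T' : Finset (Bits n)} (hT : T.card = t) :
    star (typeVec n t T) ⬝ᵥ typeVec n t T' = if T = T' then 1 else 0 := by
  simp only [dotProduct, Pi.star_apply, typeVec]
  split_ifs with h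
  · subst h
    have h0 : (0 : ℝ) ≤ t.factorial := by positivity
    have hs : ((Real.sqrt (t.factorial : ℝ) : ℝ) : ℂ)⁻¹ * ((Real.sqrt (t.factorial : ℝ) : ℝ) : ℂ)⁻¹
        = (t.factorial : ℂ)⁻¹ := by
      rw [← mul_inv, ← Complex.ofReal_mul, Real.mul_self_sqrt h0]; simp
    have : ∀ v : Fin t → Bits n, star (if Finset.univ.image v = T then
        ((Real.sqrt (t.factorial : ℝ) : ℝ) : ℂ)⁻¹ else 0) * (if Finset.univ.image v = T then
        ((Real.sqrt (t.factorial : ℝ) : ℝ) : ℂ)⁻¹ else 0) =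
        if Finset.univ.image v = T then (t.factorial : ℂ)⁻¹ else 0 := by
      intro v
      split_ifs
      · rw [← hs]; simp
      · simp
    simp only [this]
    rw [← Finset.sum_filter, Finset.sum_const, card_image_eq hT, nsmul_eq_mul,
      mul_inv_cancel₀ (by exact_mod_cast t.factorial_ne_zero)]
  · refine Finset.sum_eq_zero fun v _ => ?_
    by_cases h1 : Finset.univ.image v = T
    · rw [if_neg (fun h2 => h (h1.symm.trans h2)), mul_zero]
    · rw [if_neg h1, star_zero, zero_mul]

/-- The projection onto the type state of the rows of a table. -/
noncomputable def typeProj (n t : ℕ) (T : Finset (Bits n)) :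
    Matrix (Fin t → Bits n) (Fin t → Bits n) ℂ :=
  Matrix.vecMulVec (typeVec n t T) (star (typeVec n t T))

theorem rhoUnique_eq_sum_tables (n t : ℕ) :
    rhoUnique n t = (open Classical in (injCount n t : ℂ)⁻¹ •
      ∑ y ∈ Finset.univ.filter fun y : Fin t → Bits n => Function.Injective y,
        typeProj n t (Finset.univ.image y)) := by
  classical
  rw [sum_injective_image (typeProj n t), injCount_eq, rhoUnique, ← Nat.cast_smul_eq_nsmul ℂ,
    smul_smul]
  congr 1
  have : (t.factorial : ℂ) ≠ 0 := by exact_mod_cast t.factorial_ne_zero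
  push_cast
  rw [mul_inv, mul_comm, ← mul_assoc, mul_inv_cancel₀ this, one_mul]

theorem relabel_mulVec_typeVec {n k t : ℕ} {g : Bits k → Bits n} (hg : Function.Injective g)
    (T : Finset (Bits k)) :
    (Matrix.of fun (w : Fin t → Bits n) (v : Fin t → Bits k) =>
      if w = fun a => g (v a) then (1 : ℂ) else 0) *ᵥ typeVec k t T =
      typeVec n t (T.image g) := by
  ext w
  simp only [Matrix.mulVec, dotProduct, Matrix.of_apply, ite_mul, one_mul, zero_mul]
  by_cases hw : ∃ v : Fin t → Bits k, w = fun a => g (v a)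
  · obtain ⟨v, rfl⟩ := hw
    rw [Finset.sum_eq_single v]
    · rw [if_pos rfl, typeVec, typeVec]
      have : Finset.univ.image (fun a => g (v a)) = T.image g ↔ Finset.univ.image v = T := by
        rw [← (Finset.image_injective hg).eq_iff (a := Finset.univ.image v), Finset.image_image]
        rfl
      simp only [this]
    · intro v' _ hv'
      rw [if_neg]
      intro h
      exact hv' (funext fun a => hg (congrFun h a).symm)
    · simp
  · rw [Finset.sum_eq_zero, typeVec, if_neg]
    · intro h
      have : ∀ a, ∃ x, w a = g x := by
        intro a
        have : w a ∈ T.image g := h ▸ Finset.mem_image_of_mem w (Finset.mem_univ a)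
        obtain ⟨x, -, hx⟩ := Finset.mem_image.1 this
        exact ⟨x, hx.symm⟩
      choose v hv using this
      exact hw ⟨v, funext hv⟩
    · intro v _
      rw [if_neg fun h => hw ⟨v, h⟩]

theorem tensorPower_mul_padIsometry {n k t : ℕ} (p : Equiv.Perm (Bits n)) :
    tensorPower t (permUnitary p) * padIsometry n k t =
      Matrix.of fun (w : Fin t → Bits n) (v : Fin t → Bits k) =>
        if w = fun a => p (pad n (v a)) then (1 : ℂ) else 0 := by
  ext w v
  simp only [Matrix.mul_apply, tensorPower, permUnitary, padIsometry, Matrix.of_apply]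
  simp only [mul_ite, mul_one, mul_zero]
  rw [Finset.sum_ite_eq', if_pos (Finset.mem_univ _)]
  by_cases h : w = fun a => p (pad n (v a))
  · rw [if_pos h, Finset.prod_eq_one]
    intro a _
    rw [if_pos (congrFun h a)]
  · rw [if_neg h]
    obtain ⟨a, ha⟩ := Function.ne_iff.1 h
    exact Finset.prod_eq_zero (Finset.mem_univ a) (if_neg ha)

theorem pad_injective {n k : ℕ} (hkn : k ≤ n) : Function.Injective (pad n (k := k)) := by
  intro x y h
  ext s
  have := congrFun h ⟨s, s.isLt.trans_le hkn⟩
  simpa [pad] using this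

/-- Both the padding and `U_p` relabel basis vectors injectively, so the conjugated state is again a
mixture of type states, indexed by the image tables. -/
theorem conj_inputState {n k t : ℕ} (hkn : k ≤ n) (p : Equiv.Perm (Bits n)) :
    tensorPower t (permUnitary p) * inputState n k t * (tensorPower t (permUnitary p))ᴴ =
      (open Classical in (injCount k t : ℂ)⁻¹ •
      ∑ v ∈ Finset.univ.filter fun v : Fin t → Bits k => Function.Injective v,
        typeProj n t (Finset.univ.image fun a => p (pad n (v a)))) := by
  classical
  have h1 : tensorPower t (permUnitary p) * inputState n k t * (tensorPower t (permUnitary p))ᴴ =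
      (tensorPower t (permUnitary p) * padIsometry n k t) * rhoUnique k t *
        (tensorPower t (permUnitary p) * padIsometry n k t)ᴴ := by
    rw [inputState, Matrix.conjTranspose_mul]
    simp only [Matrix.mul_assoc]
  rw [h1, tensorPower_mul_padIsometry, rhoUnique_eq_sum_tables, Matrix.mul_smul, Matrix.smul_mul,
    Matrix.mul_sum, Matrix.sum_mul]
  congr 1
  refine Finset.sum_congr rfl fun v _ => ?_
  rw [typeProj, Matrix.mul_vecMulVec, Matrix.vecMulVec_mul, ← Matrix.star_mulVec,
    relabel_mulVec_typeVec (g := fun x => p (pad n x)) (p.injective.comp (pad_injective hkn)),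
    Finset.image_image]
  rfl

theorem outputState_univ_eq_sum_tables {n k m α t : ℕ} (hkn : k ≤ n) :
    outputState t (Finset.univ : Finset (Seed n k m α)) =
      ∑ y : Fin t → Bits n, (((outcomeCount (k := k) (m := m) (α := α) y : ℝ) /
        (Fintype.card (Seed n k m α) * injCount k t) : ℝ) : ℂ) •
          typeProj n t (Finset.univ.image y) := by
  classical
  have h1 : ∀ y : Fin t → Bits n, (((outcomeCount (k := k) (m := m) (α := α) y : ℝ) /
        (Fintype.card (Seed n k m α) * injCount k t) : ℝ) : ℂ) •
          typeProj n t (Finset.univ.image y) =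
      ((Fintype.card (Seed n k m α) : ℂ)⁻¹ * (injCount k t : ℂ)⁻¹) •
        ((outcomeCount (k := k) (m := m) (α := α) y) • typeProj n t (Finset.univ.image y)) := by
    intro y
    rw [← Nat.cast_smul_eq_nsmul ℂ, smul_smul]
    congr 1
    push_cast
    rw [div_eq_mul_inv, mul_inv, mul_comm]
  rw [Finset.sum_congr rfl fun y _ => h1 y]
  simp only [outcomeCount]
  rw [← Finset.smul_sum, outputState, Finset.card_univ]
  simp only [conj_inputState hkn]
  rw [← Finset.smul_sum, smul_smul]
  congr 1
  rw [← Finset.sum_product', ← Finset.sum_fiberwise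
    (g := fun p : Seed n k m α × (Fin t → Bits k) => fun a => algorithmPerm p.1 (pad n (p.2 a)))]
  refine Finset.sum_congr rfl fun y _ => ?_
  rw [← Finset.sum_const]
  refine Finset.sum_congr ?_ ?_
  · ext p
    simp [funext_iff]
  · intro p hp
    rw [funext (Finset.mem_filter.1 hp).2.2]

/-- Both states are diagonal in the orthonormal type states, so the trace norm is an `ℓ¹` distance,
bounded by the one before merging the orderings of a set. A common minorant `g` gives `|μ - ν| ≤ μ +
ν - 2g`, and both laws have mass 1. -/
theorem traceDist_le_of_lower_bound {n k m α t : ℕ} (hkn : k ≤ n) (hk : 0 < injCount k t)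
    (hn : 0 < injCount n t) (g : (Fin t → Bits n) → ℝ)
    (hg1 : ∀ y, g y ≤ (outcomeCount (k := k) (m := m) (α := α) y : ℝ) /
        (Fintype.card (Seed n k m α) * injCount k t))
    (hg2 : ∀ y, g y ≤ open Classical in if Function.Injective y then 1 / (injCount n t : ℝ) else 0)
    (hS : 0 < Fintype.card (Seed n k m α)) :
    traceDist (outputState t (Finset.univ : Finset (Seed n k m α))) (rhoUnique n t) ≤
      1 - ∑ y, g y := by
  classical
  set μ : (Fin t → Bits n) → ℝ := fun y => (outcomeCount (k := k) (m := m) (α := α) y : ℝ) /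
        (Fintype.card (Seed n k m α) * injCount k t) with hμ
  set ν : (Fin t → Bits n) → ℝ := fun y =>
    if Function.Injective y then 1 / (injCount n t : ℝ) else 0 with hν
  have hμ0 : ∀ y, ¬ Function.Injective y → μ y = 0 := by
    intro y hy
    have : outcomeCount (k := k) (m := m) (α := α) y = 0 := by
      rw [outcomeCount, Finset.card_eq_zero, Finset.filter_eq_empty_iff]
      rintro p - ⟨hp, hpy⟩
      apply hy
      have : y = fun a => algorithmPerm p.1 (pad n (p.2 a)) := funext fun a => (hpy a).symm
      rw [this]
      exact ((algorithmPerm p.1).injective.comp (pad_injective hkn)).comp hp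
    simp [hμ, this]
  have hμ1 : ∑ y, μ y = 1 := by
    have hc : ∑ y : Fin t → Bits n, outcomeCount (k := k) (m := m) (α := α) y =
        Fintype.card (Seed n k m α) * injCount k t := by
      have : Fintype.card (Seed n k m α) * injCount k t = (Finset.univ.filter
          fun p : Seed n k m α × (Fin t → Bits k) => Function.Injective p.2).card := by
        rw [injCount, ← Finset.card_univ, ← Finset.card_product]
        congr 1
        ext p
        simp
      rw [this, Finset.card_eq_sum_card_fiberwise (t := Finset.univ) (f := fun p :
        Seed n k m α × (Fin t → Bits k) => fun a => algorithmPerm p.1 (pad n (p.2 a)))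
        (fun _ _ => by simp)]
      refine Finset.sum_congr rfl fun y _ => ?_
      rw [outcomeCount]
      congr 1
      ext p
      simp [funext_iff]
    simp only [hμ]
    rw [← Finset.sum_div, ← Nat.cast_sum, hc, Nat.cast_mul, div_self]
    positivity
  have hν1 : ∑ y, ν y = 1 := by
    simp only [hν]
    rw [← Finset.sum_filter, Finset.sum_const, nsmul_eq_mul, ← injCount]
    field_simp
  have hrho : rhoUnique n t = ∑ y : Fin t → Bits n, (ν y : ℂ) •
      typeProj n t (Finset.univ.image y) := by
    rw [rhoUnique_eq_sum_tables, Finset.smul_sum, Finset.sum_filter]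
    refine Finset.sum_congr rfl fun y _ => ?_
    simp only [hν]
    split_ifs <;> simp
  have hdiff : outputState t (Finset.univ : Finset (Seed n k m α)) - rhoUnique n t =
      ∑ T ∈ (Finset.univ.powersetCard t : Finset (Finset (Bits n))),
        ((∑ y ∈ Finset.univ.filter (fun y : Fin t → Bits n => Finset.univ.image y = T),
          (μ y - ν y) : ℝ) : ℂ) •
          Matrix.vecMulVec (typeVec n t T) (star (typeVec n t T)) := by
    rw [outputState_univ_eq_sum_tables hkn, hrho, ← Finset.sum_sub_distrib]
    have h2 : ∀ y : Fin t → Bits n, (μ y : ℂ) • typeProj n t (Finset.univ.image y) -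
        (ν y : ℂ) • typeProj n t (Finset.univ.image y) =
        if Function.Injective y then
          ((μ y - ν y : ℝ) : ℂ) • typeProj n t (Finset.univ.image y) else 0 := by
      intro y
      split_ifs with hy
      · rw [← sub_smul]; simp
      · rw [hμ0 y hy]; simp [hν, hy]
    rw [Finset.sum_congr rfl fun y _ => h2 y, ← Finset.sum_filter,
      ← Finset.sum_fiberwise_of_maps_to (t := Finset.univ.powersetCard t)
      (g := fun y : Fin t → Bits n => Finset.univ.image y)
      (fun y hy => Finset.mem_powersetCard.2 ⟨Finset.subset_univ _,
        (injective_iff_card_image y).1 (Finset.mem_filter.1 hy).2⟩)]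
    refine Finset.sum_congr rfl fun T hT => ?_
    have hT' := (Finset.mem_powersetCard.1 hT).2
    rw [Complex.ofReal_sum, Finset.sum_smul, Finset.filter_filter]
    refine Finset.sum_congr ?_ fun y hy => ?_
    · ext y
      simp only [Finset.mem_filter, Finset.mem_univ, true_and, and_iff_right_iff_imp,
        injective_iff_card_image]
      rintro rfl; exact hT'
    · rw [(Finset.mem_filter.1 hy).2, typeProj]
  rw [traceDist, hdiff, traceNorm_sum_smul_vecMulVec _ _
    (fun T hT T' _ => typeVec_orthonormal (Finset.mem_powersetCard.1 hT).2)]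
  have h3 : ∑ T ∈ (Finset.univ.powersetCard t : Finset (Finset (Bits n))),
      |∑ y ∈ Finset.univ.filter (fun y : Fin t → Bits n => Finset.univ.image y = T), (μ y - ν y)| ≤
      ∑ y : Fin t → Bits n, |μ y - ν y| := by
    refine (Finset.sum_le_sum fun T _ => Finset.abs_sum_le_sum_abs _ _).trans ?_
    rw [← Finset.sum_fiberwise (g := fun y : Fin t → Bits n => Finset.univ.image y)
      (f := fun y => |μ y - ν y|)]
    exact Finset.sum_le_sum_of_subset_of_nonneg (Finset.subset_univ _)
      fun T _ _ => Finset.sum_nonneg fun y _ => abs_nonneg _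
  have h4 : ∑ y : Fin t → Bits n, |μ y - ν y| ≤ ∑ y, (μ y + ν y - 2 * g y) := by
    refine Finset.sum_le_sum fun y _ => ?_
    have := hg1 y
    have := hg2 y
    rw [abs_le]
    constructor <;> linarith
  rw [Finset.sum_sub_distrib, Finset.sum_add_distrib, hμ1, hν1, ← Finset.mul_sum] at h4
  linarith

/-! ### Circuits on blocks of qubits -/

/-- A matrix acts on the qubits in `S` only. -/
structure ActsOn {N : ℕ} (S : Finset (Fin N)) (M : Matrix (Bits N) (Bits N) ℂ) : Prop where
  eq_zero : ∀ y x : Bits N, ∀ j, j ∉ S → y j ≠ x j → M y x = 0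
  congr : ∀ y x y' x' : Bits N, (∀ j, j ∉ S → y j = x j) → (∀ j, j ∉ S → y' j = x' j) →
    (∀ j, j ∈ S → y j = y' j) → (∀ j, j ∈ S → x j = x' j) → M y x = M y' x'

/-- Only one intermediate basis state contributes: the second factor cannot change the bits in `S`,
and the first cannot change those outside `S`. -/
theorem ActsOn.mul_apply {N : ℕ} {S S' : Finset (Fin N)} {M M' : Matrix (Bits N) (Bits N) ℂ}
    (hM : ActsOn S M) (hM' : ActsOn S' M') (hS : Disjoint S S') (y x : Bits N) :
    (M * M') y x = M y (fun j => if j ∈ S then x j else y j) *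
      M' (fun j => if j ∈ S then x j else y j) x := by
  rw [Matrix.mul_apply]
  refine Finset.sum_eq_single _ (fun z _ hz => ?_) (by simp)
  obtain ⟨j, hj⟩ := Function.ne_iff.1 hz
  by_cases hjS : j ∈ S
  · rw [if_pos hjS] at hj
    rw [hM'.eq_zero z x j (Finset.disjoint_left.1 hS hjS) hj, mul_zero]
  · rw [if_neg hjS] at hj
    rw [hM.eq_zero y z j hjS hj.symm, zero_mul]

theorem ActsOn.commute {N : ℕ} {S S' : Finset (Fin N)} {M M' : Matrix (Bits N) (Bits N) ℂ}
    (hM : ActsOn S M) (hM' : ActsOn S' M') (hS : Disjoint S S') : Commute M M' := by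
  ext y x
  rw [hM.mul_apply hM' hS, hM'.mul_apply hM hS.symm]
  by_cases h : ∀ j, j ∉ S → j ∉ S' → y j = x j
  · rw [mul_comm]
    congr 1
    · refine hM'.congr _ _ _ _ ?_ ?_ ?_ ?_ <;> intro j hj
      · split_ifs with hjS
        · rfl
        · exact h j hjS hj
      · rw [if_neg hj]
      · rw [if_neg (Finset.disjoint_right.1 hS hj)]
      · rw [if_pos hj]
    · refine hM.congr _ _ _ _ ?_ ?_ ?_ ?_ <;> intro j hj
      · rw [if_neg hj]
      · split_ifs with hjS
        · rfl
        · exact h j hj hjS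
      · rw [if_neg (Finset.disjoint_left.1 hS hj)]
      · rw [if_pos hj]
  · push Not at h
    obtain ⟨j, hj, hj', hne⟩ := h
    rw [hM'.eq_zero _ x j hj' (by rw [if_neg hj]; exact hne),
      hM.eq_zero _ x j hj (by rw [if_neg hj']; exact hne), mul_zero, mul_zero]

theorem Gate.actsOn {N : ℕ} (g : Gate N) : ActsOn g.support g.toMatrix := by
  cases g with
  | single i u =>
    constructor
    · intro y x j hj hne
      simp only [Gate.support, Finset.mem_singleton] at hj
      simp only [Gate.toMatrix, Matrix.of_apply]
      rw [if_neg fun h => hne (h j hj)]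
    · intro y x y' x' h h' hy hx
      simp only [Gate.support, Finset.mem_singleton, forall_eq] at h h' hy hx
      simp only [Gate.toMatrix, Matrix.of_apply]
      rw [if_pos h, if_pos h', hy, hx]
  | cnot c q hcq =>
    constructor
    · intro y x j hj hne
      simp only [Gate.support, Finset.mem_insert, Finset.mem_singleton, not_or] at hj
      simp only [Gate.toMatrix, permUnitary, Matrix.of_apply]
      rw [if_neg]
      rintro rfl
      rw [cnot_apply, Function.update_of_ne hj.2] at hne
      exact hne rfl
    · intro y x y' x' h h' hy hx
      simp only [Gate.support, Finset.mem_insert, Finset.mem_singleton, not_or] at h h' hy hx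
      simp only [Gate.toMatrix, permUnitary, Matrix.of_apply, cnot_apply]
      have key : ∀ {y x y' x' : Bits N}, (∀ j, ¬j = c ∧ ¬j = q → y' j = x' j) →
          (∀ j, j = c ∨ j = q → y j = y' j) → (∀ j, j = c ∨ j = q → x j = x' j) →
          y = Function.update x q (xor (x q) (x c)) →
          y' = Function.update x' q (xor (x' q) (x' c)) := by
        intro y x y' x' h' hy hx he
        ext j
        by_cases hj : j = q
        · subst hj
          rw [Function.update_self, ← hy _ (Or.inr rfl), he, Function.update_self,
            hx _ (Or.inr rfl), hx _ (Or.inl rfl)]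
        · rw [Function.update_of_ne hj]
          by_cases hj' : j = c
          · rw [← hy _ (Or.inl hj'), he, Function.update_of_ne hj, hx _ (Or.inl hj')]
          · exact h' j ⟨hj', hj⟩
      have e : y = Function.update x q (xor (x q) (x c)) ↔
          y' = Function.update x' q (xor (x' q) (x' c)) :=
        ⟨key h' hy hx, key h (fun j hj => (hy j hj).symm) fun j hj => (hx j hj).symm⟩
      simp only [e]

/-- `M` is the unitary of a circuit of depth `d` all of whose gates act inside `B`. -/
def Realizes {N : ℕ} (B : Finset (Fin N)) (d : ℕ) (M : Matrix (Bits N) (Bits N) ℂ) : Prop :=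
  ∃ c : List (Layer N), c.length = d ∧ (∀ L ∈ c, ∀ g ∈ L.gates, g.support ⊆ B) ∧
    circuitMatrix c = M

theorem circuitMatrix_cons {N : ℕ} (L : Layer N) (c : List (Layer N)) :
    circuitMatrix (L :: c) = circuitMatrix c * L.toMatrix := by
  simp [circuitMatrix]

theorem circuitMatrix_append {N : ℕ} (c c' : List (Layer N)) :
    circuitMatrix (c ++ c') = circuitMatrix c' * circuitMatrix c := by
  simp [circuitMatrix]

/-- Empty layers: circuits can be padded to any larger depth, which lets `Realizes` fix the depth
exactly. -/
theorem Realizes.one {N : ℕ} (B : Finset (Fin N)) (d : ℕ) : Realizes B d 1 := by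
  refine ⟨List.replicate d ⟨[], List.Pairwise.nil⟩, by simp, ?_, ?_⟩
  · intro L hL g hg
    rw [List.eq_of_mem_replicate hL] at hg
    simp at hg
  · simp [circuitMatrix, Layer.toMatrix]

theorem Realizes.mul {N : ℕ} {B : Finset (Fin N)} {d d' : ℕ} {M M' : Matrix (Bits N) (Bits N) ℂ}
    (h : Realizes B d M) (h' : Realizes B d' M') : Realizes B (d' + d) (M * M') := by
  obtain ⟨c, hc, hB, rfl⟩ := h
  obtain ⟨c', hc', hB', rfl⟩ := h'
  refine ⟨c' ++ c, by simp [hc, hc'], ?_, circuitMatrix_append _ _⟩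
  intro L hL
  rcases List.mem_append.1 hL with hL | hL
  · exact hB' L hL
  · exact hB L hL

theorem Realizes.mono {N : ℕ} {B B' : Finset (Fin N)} {d d' : ℕ}
    {M : Matrix (Bits N) (Bits N) ℂ} (h : Realizes B d M) (hB : B ⊆ B') (hd : d ≤ d') :
    Realizes B' d' M := by
  have h1 : Realizes B' d M := by
    obtain ⟨c, hc, hcB, hM⟩ := h
    exact ⟨c, hc, fun L hL g hg => (hcB L hL g hg).trans hB, hM⟩
  have h2 := (Realizes.one B' (d' - d)).mul h1
  rwa [one_mul, Nat.add_sub_cancel' hd] at h2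

theorem Realizes.gate {N : ℕ} (g : Gate N) : Realizes g.support 1 g.toMatrix := by
  refine ⟨[⟨[g], List.pairwise_singleton _ _⟩], rfl, ?_, ?_⟩
  · intro L hL g' hg
    rw [List.mem_singleton] at hL
    subst hL
    rw [List.mem_singleton] at hg
    rw [hg]
  · simp [circuitMatrix, Layer.toMatrix]

/-- Two circuits of equal depth on disjoint blocks are merged layer by layer; the first layer of one
commutes past the rest of the other. -/
theorem Realizes.par {N : ℕ} {B B' : Finset (Fin N)} (hBB : Disjoint B B') {d : ℕ}
    {M M' : Matrix (Bits N) (Bits N) ℂ} (h : Realizes B d M) (h' : Realizes B' d M') :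
    Realizes (B ∪ B') d (M * M') := by
  obtain ⟨c, hc, hB, rfl⟩ := h
  obtain ⟨c', hc', hB', rfl⟩ := h'
  induction d generalizing c c' with
  | zero =>
    rw [List.length_eq_zero_iff] at hc hc'
    subst hc hc'
    simpa [circuitMatrix] using Realizes.one (B ∪ B') 0
  | succ d ih =>
    match c, c', hc, hc' with
    | L :: c, L' :: c', hc, hc' =>
      have hcomm : ∀ g ∈ L.gates, Commute (circuitMatrix c') g.toMatrix := by
        intro g hg
        refine Commute.list_prod_left _ _ ?_
        intro A hA
        rw [List.mem_reverse, List.mem_map] at hA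
        obtain ⟨K, hK, rfl⟩ := hA
        refine Commute.list_prod_left _ _ ?_
        intro A hA
        obtain ⟨g', hg', rfl⟩ := List.mem_map.1 hA
        refine (Gate.actsOn g').commute (Gate.actsOn g) ?_
        exact Finset.disjoint_of_subset_left (hB' K (by simp [hK]) g' hg')
          (Finset.disjoint_of_subset_right (hB L (by simp) g hg) hBB.symm)
      have hcomm' : Commute L.toMatrix (circuitMatrix c') := by
        refine Commute.list_prod_left _ _ ?_
        intro A hA
        obtain ⟨g, hg, rfl⟩ := List.mem_map.1 hA
        exact (hcomm g hg).symm
      have hmerge : (L.gates ++ L'.gates).Pairwise fun g g' => Disjoint g.support g'.support := by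
        rw [List.pairwise_append]
        refine ⟨L.disjoint, L'.disjoint, fun g hg g' hg' => ?_⟩
        exact Finset.disjoint_of_subset_left (hB L (by simp) g hg)
          (Finset.disjoint_of_subset_right (hB' L' (by simp) g' hg') hBB)
      have h1 : Realizes (B ∪ B') 1 (L.toMatrix * L'.toMatrix) := by
        refine ⟨[⟨L.gates ++ L'.gates, hmerge⟩], rfl, ?_, ?_⟩
        · intro K hK g hg
          rw [List.mem_singleton] at hK
          subst hK
          rcases List.mem_append.1 hg with hg | hg
          · exact (hB L (by simp) g hg).trans Finset.subset_union_left
          · exact (hB' L' (by simp) g hg).trans Finset.subset_union_right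
        · simp [circuitMatrix, Layer.toMatrix]
      have h2 := ih c (by simpa using hc) (fun K hK => hB K (by simp [hK])) c' (by simpa using hc')
        (fun K hK => hB' K (by simp [hK]))
      have h3 := h2.mul h1
      rw [circuitMatrix_cons, circuitMatrix_cons]
      have h4 : circuitMatrix c * L.toMatrix * (circuitMatrix c' * L'.toMatrix) =
          circuitMatrix c * circuitMatrix c' * (L.toMatrix * L'.toMatrix) := by
        rw [mul_assoc, ← mul_assoc L.toMatrix, hcomm'.eq]
        simp only [mul_assoc]
      rw [h4, Nat.add_comm]
      exact h3

/-! ### Circuits for reversible maps of basis labels. -/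

/-- The matrix that sends the basis vector of `x` to the one of `F x`. -/
def funMatrix {N : ℕ} (F : Bits N → Bits N) : Matrix (Bits N) (Bits N) ℂ :=
  Matrix.of fun y x => if y = F x then 1 else 0

theorem funMatrix_comp {N : ℕ} (F G : Bits N → Bits N) :
    funMatrix (fun x => F (G x)) = funMatrix F * funMatrix G := by
  ext y x
  simp [funMatrix, Matrix.mul_apply]

theorem funMatrix_id {N : ℕ} : funMatrix (fun x : Bits N => x) = 1 := by
  ext y x
  simp [funMatrix, Matrix.one_apply]

theorem Realizes.comp {N : ℕ} {B : Finset (Fin N)} {d d' : ℕ} {F G : Bits N → Bits N}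
    (h : Realizes B d (funMatrix F)) (h' : Realizes B d' (funMatrix G)) :
    Realizes B (d' + d) (funMatrix fun x => F (G x)) := by
  rw [funMatrix_comp]
  exact h.mul h'

theorem Realizes.par_comp {N : ℕ} {B B' : Finset (Fin N)} (hBB : Disjoint B B') {d : ℕ}
    {F G : Bits N → Bits N} (h : Realizes B d (funMatrix F)) (h' : Realizes B' d (funMatrix G)) :
    Realizes (B ∪ B') d (funMatrix fun x => F (G x)) := by
  rw [funMatrix_comp]
  exact h.par hBB h'

theorem Realizes.id {N : ℕ} (B : Finset (Fin N)) (d : ℕ) :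
    Realizes B d (funMatrix fun x : Bits N => x) := by
  rw [funMatrix_id]
  exact Realizes.one B d

/-- The map that adds `f x` to bit `q`. -/
def addTo {N : ℕ} (q : Fin N) (f : Bits N → Bool) (x : Bits N) : Bits N :=
  Function.update x q (xor (x q) (f x))

theorem Realizes.cnot {N : ℕ} {B : Finset (Fin N)} {c q : Fin N} (h : c ≠ q) (hc : c ∈ B)
    (hq : q ∈ B) : Realizes B 1 (funMatrix (addTo q fun x => x c)) := by
  have h1 : Realizes B 1 (Gate.cnot c q h).toMatrix := (Realizes.gate (.cnot c q h)).mono (by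
    simp [Gate.support, Finset.insert_subset_iff, hc, hq]) le_rfl
  have h2 : (Gate.cnot c q h).toMatrix = funMatrix (addTo q fun x => x c) := by
    ext y x
    simp only [Gate.toMatrix, permUnitary, cnot_apply, funMatrix, addTo, Matrix.of_apply]
    congr
  rwa [h2] at h1

/-- The Pauli `X` gate. -/
def pauliX : Matrix.unitaryGroup Bool ℂ :=
  ⟨Matrix.of fun y x => if y = !x then 1 else 0, by
    rw [Matrix.mem_unitaryGroup_iff]
    ext y x
    cases y <;> cases x <;> simp [Matrix.mul_apply, Matrix.star_apply]⟩

theorem Realizes.not {N : ℕ} {B : Finset (Fin N)} {q : Fin N} (hq : q ∈ B) :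
    Realizes B 1 (funMatrix (addTo q fun _ => true)) := by
  have h1 : Realizes B 1 (Gate.single q pauliX).toMatrix := (Realizes.gate (.single q pauliX)).mono
    (by simp [Gate.support, hq]) le_rfl
  have h2 : (Gate.single q pauliX).toMatrix = funMatrix (addTo q fun _ => true) := by
    ext y x
    simp only [Gate.toMatrix, pauliX, Matrix.of_apply, funMatrix, addTo, Bool.xor_true]
    have : y = Function.update x q (!x q) ↔ (∀ j, j ≠ q → y j = x j) ∧ y q = !x q := by
      rw [Function.eq_update_iff, and_comm]
    simp only [this, ite_and]
  rwa [h2] at h1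

/-! ### The Toffoli gate -/

/-- A phase gate. -/
def phaseGate (φ : Bool → ℂ) (hφ : ∀ b, φ b * star (φ b) = 1) : Matrix.unitaryGroup Bool ℂ :=
  ⟨Matrix.diagonal φ, by
    rw [Matrix.mem_unitaryGroup_iff, Matrix.star_eq_conjTranspose, Matrix.diagonal_conjTranspose,
      Matrix.diagonal_mul_diagonal, ← Matrix.diagonal_one]
    congr 1
    ext b
    exact hφ b⟩

theorem Realizes.phase {N : ℕ} {B : Finset (Fin N)} {q : Fin N} (hq : q ∈ B) (φ : Bool → ℂ)
    (hφ : ∀ b, φ b * star (φ b) = 1) :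
    Realizes B 1 (Matrix.diagonal fun x : Bits N => φ (x q)) := by
  have h1 : Realizes B 1 (Gate.single q (phaseGate φ hφ)).toMatrix :=
    (Realizes.gate (.single q (phaseGate φ hφ))).mono (by simp [Gate.support, hq]) le_rfl
  have h2 : (Gate.single q (phaseGate φ hφ)).toMatrix =
      Matrix.diagonal fun x : Bits N => φ (x q) := by
    ext y x
    simp only [Gate.toMatrix, phaseGate, Matrix.of_apply, Matrix.diagonal_apply]
    by_cases h : y = x
    · subst h; simp
    · rw [if_neg h]
      split_ifs with h1 h2
      · exact absurd (funext fun j => by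
          by_cases hj : j = q
          · subst hj; exact h2
          · exact h1 j hj) h
      · rfl
      · rfl
  rwa [h2] at h1

/-- Conjugating a diagonal gate by a reversible involution evaluates its phase at the transformed
bits; with CNOT gates this turns a phase of one bit into a phase of a parity. -/
theorem Realizes.diagonal_conj {N : ℕ} {B : Finset (Fin N)} {d d' : ℕ} {F : Bits N → Bits N}
    (hF : ∀ x, F (F x) = x) {f : Bits N → ℂ} (h : Realizes B d (Matrix.diagonal f))
    (h' : Realizes B d' (funMatrix F)) :
    Realizes B (d' + d + d') (Matrix.diagonal fun x => f (F x)) := by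
  have e : (Matrix.diagonal fun x => f (F x)) = funMatrix F * (Matrix.diagonal f * funMatrix F) := by
    ext y x
    rw [Matrix.mul_apply]
    simp only [Matrix.diagonal_mul]
    simp only [funMatrix, Matrix.of_apply, Matrix.diagonal_apply, mul_ite, mul_one, mul_zero,
      ite_mul, one_mul, zero_mul]
    rw [Finset.sum_ite_eq', if_pos (Finset.mem_univ _), hF]
    by_cases hyx : y = x <;> simp [hyx]
  rw [e]
  exact h'.mul (h.mul h')

theorem Realizes.diagonal_mul {N : ℕ} {B : Finset (Fin N)} {d d' : ℕ} {f g : Bits N → ℂ}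
    (h : Realizes B d (Matrix.diagonal f)) (h' : Realizes B d' (Matrix.diagonal g)) :
    Realizes B (d' + d) (Matrix.diagonal fun x => f x * g x) := by
  rw [← Matrix.diagonal_mul_diagonal]
  exact h.mul h'

theorem addTo_involutive {N : ℕ} {q : Fin N} {f : Bits N → Bool}
    (hf : ∀ x b, f (Function.update x q b) = f x) (x : Bits N) : addTo q f (addTo q f x) = x := by
  simp only [addTo, hf, Function.update_self, Function.update_idem, Bool.xor_assoc, Bool.xor_self,
    Bool.xor_false, Function.update_eq_self]

theorem Realizes.phase_xor {N : ℕ} {B : Finset (Fin N)} {a q : Fin N} (ha : a ∈ B) (hq : q ∈ B)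
    (haq : a ≠ q) (φ : Bool → ℂ) (hφ : ∀ b, φ b * star (φ b) = 1) :
    Realizes B 3 (Matrix.diagonal fun x : Bits N => φ (xor (x q) (x a))) := by
  have h := (Realizes.phase hq φ hφ).diagonal_conj
    (addTo_involutive fun x b => by rw [Function.update_of_ne haq]) (Realizes.cnot haq ha hq)
  simpa only [addTo, Function.update_self] using h

theorem Realizes.phase_xor_xor {N : ℕ} {B : Finset (Fin N)} {a b q : Fin N} (ha : a ∈ B)
    (hb : b ∈ B) (hq : q ∈ B) (haq : a ≠ q) (hbq : b ≠ q) (φ : Bool → ℂ)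
    (hφ : ∀ b, φ b * star (φ b) = 1) :
    Realizes B 5 (Matrix.diagonal fun x : Bits N => φ (xor (xor (x q) (x a)) (x b))) := by
  have h := (Realizes.phase_xor hb hq hbq φ hφ).diagonal_conj
    (addTo_involutive fun x b => by rw [Function.update_of_ne haq]) (Realizes.cnot haq ha hq)
  simpa only [addTo, Function.update_self, Function.update_of_ne hbq] using h

/-- The Hadamard gate. -/
noncomputable def hadamard : Matrix.unitaryGroup Bool ℂ :=
  ⟨Matrix.of fun y x => ((Real.sqrt 2 : ℝ) : ℂ)⁻¹ * if y && x then -1 else 1, by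
    have h : ((Real.sqrt 2 : ℝ) : ℂ)⁻¹ * ((Real.sqrt 2 : ℝ) : ℂ)⁻¹ = 2⁻¹ := by
      rw [← mul_inv, ← Complex.ofReal_mul, Real.mul_self_sqrt (by norm_num)]; simp
    rw [Matrix.mem_unitaryGroup_iff]
    ext y x
    cases y <;> cases x <;> (simp [Matrix.mul_apply, Matrix.star_apply, h]; try norm_num)⟩

theorem hadamard_apply (y x : Bool) : hadamard.1 y x =
    ((Real.sqrt 2 : ℝ) : ℂ)⁻¹ * if y && x then -1 else 1 := rfl

theorem hadamard_mul_self : hadamard.1 * hadamard.1 = 1 := by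
  have h : ((Real.sqrt 2 : ℝ) : ℂ)⁻¹ * ((Real.sqrt 2 : ℝ) : ℂ)⁻¹ = 2⁻¹ := by
    rw [← mul_inv, ← Complex.ofReal_mul, Real.mul_self_sqrt (by norm_num)]; simp
  ext y x
  cases y <;> cases x <;> (simp [Matrix.mul_apply, hadamard_apply, h]; try norm_num)

theorem single_mul_single {N : ℕ} (q : Fin N) {u v : Matrix.unitaryGroup Bool ℂ}
    (h : u.1 * v.1 = 1) : (Gate.single q u).toMatrix * (Gate.single q v).toMatrix = 1 := by
  ext y x
  rw [Matrix.mul_apply]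
  simp only [Gate.toMatrix, Matrix.of_apply]
  have h1 := congrFun (congrFun h (y q)) (x q)
  rw [Matrix.mul_apply] at h1
  by_cases hyx : ∀ j, j ≠ q → y j = x j
  · have h2 : (∑ b, u.1 (y q) b * v.1 b (x q)) = (1 : Matrix (Bits N) (Bits N) ℂ) y x := by
      rw [h1, Matrix.one_apply, Matrix.one_apply]
      have : y q = x q ↔ y = x := by
        refine ⟨fun h => funext fun j => ?_, fun h => by rw [h]⟩
        by_cases hj : j = q
        · rw [hj, h]
        · exact hyx j hj
      simp only [this]
    rw [← h2]
    symm
    refine Finset.sum_of_injOn (fun b => Function.update x q b) ?_ (by simp) ?_ ?_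
    · intro b _ b' _ hb
      simpa using congrFun hb q
    · intro z _ hz
      by_cases hzx : ∀ j, j ≠ q → z j = x j
      · refine absurd ⟨z q, by simp, ?_⟩ hz
        simp only
        symm
        rw [Function.eq_update_iff]
        exact ⟨rfl, hzx⟩
      · rw [if_neg hzx, mul_zero]
    · intro b _
      rw [if_pos, if_pos, Function.update_self]
      · intro j hj; rw [Function.update_of_ne hj]
      · intro j hj; rw [Function.update_of_ne hj, hyx j hj]
  · rw [Matrix.one_apply, if_neg (fun h => hyx fun j _ => by rw [h])]
    refine Finset.sum_eq_zero fun z _ => ?_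
    by_cases h1 : ∀ j, j ≠ q → y j = z j
    · have h2 : ¬ ∀ j, j ≠ q → z j = x j := fun h2 => hyx fun j hj => (h1 j hj).trans (h2 j hj)
      simp only [if_neg h2, mul_zero]
    · simp only [if_neg h1, zero_mul]

/-- Conjugation by the Hadamard gate exchanges a controlled sign flip and a controlled bit flip of
`q`; the condition `hf` keeps the control independent of `q`. -/
theorem Realizes.addTo_of_diagonal {N : ℕ} {B : Finset (Fin N)} {q : Fin N} (hq : q ∈ B) {d : ℕ}
    {f : Bits N → Bool} (hf : ∀ x b, f (Function.update x q b) = f x)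
    (h : Realizes B d (Matrix.diagonal fun x : Bits N => if x q && f x then (-1 : ℂ) else 1)) :
    Realizes B (d + 2) (funMatrix (addTo q f)) := by
  have h1 : Realizes B 1 (Gate.single q hadamard).toMatrix :=
    (Realizes.gate (.single q hadamard)).mono (by simp [Gate.support, hq]) le_rfl
  have h2 : (Matrix.diagonal fun x : Bits N => if x q && f x then (-1 : ℂ) else 1) *
      (Gate.single q hadamard).toMatrix =
      (Gate.single q hadamard).toMatrix * funMatrix (addTo q f) := by
    ext y x
    rw [Matrix.diagonal_mul, Matrix.mul_apply]
    simp only [funMatrix, Matrix.of_apply, mul_ite, mul_one, mul_zero]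
    rw [Finset.sum_ite_eq', if_pos (Finset.mem_univ _)]
    simp only [Gate.toMatrix, Matrix.of_apply, hadamard_apply]
    by_cases hyx : ∀ j, j ≠ q → y j = x j
    · have hfy : f y = f x := by
        rw [← hf x (y q)]
        congr 1
        rw [Function.eq_update_iff]
        exact ⟨rfl, hyx⟩
      have hyF : ∀ j, j ≠ q → y j = addTo q f x j := by
        intro j hj
        rw [addTo, Function.update_of_ne hj, hyx j hj]
      have hFq : addTo q f x q = xor (x q) (f x) := by rw [addTo, Function.update_self]
      simp only [if_pos hyx, if_pos hyF, hfy, hFq]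
      cases y q <;> cases f x <;> cases x q <;> simp
    · have hyF : ¬ ∀ j, j ≠ q → y j = addTo q f x j := by
        intro h
        refine hyx fun j hj => ?_
        rw [h j hj, addTo, Function.update_of_ne hj]
      simp only [if_neg hyx, if_neg hyF, mul_zero]
  have h3 : funMatrix (addTo q f) = (Gate.single q hadamard).toMatrix *
      ((Matrix.diagonal fun x : Bits N => if x q && f x then (-1 : ℂ) else 1) *
      (Gate.single q hadamard).toMatrix) := by
    rw [h2, ← mul_assoc, single_mul_single q hadamard_mul_self, one_mul]
  rw [h3]
  have := h1.mul (h.mul h1)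
  rwa [show 1 + d + 1 = d + 2 by ring] at this

theorem exists_eighth_root : ∃ w : ℂ, w * star w = 1 ∧ w ^ 4 = -1 := by
  refine ⟨Complex.exp ((Real.pi / 4 : ℝ) * Complex.I), ?_, ?_⟩
  · have : star (Complex.exp ((Real.pi / 4 : ℝ) * Complex.I)) =
        Complex.exp (-((Real.pi / 4 : ℝ) * Complex.I)) := by
      show (starRingEnd ℂ) _ = _
      rw [← Complex.exp_conj, map_mul, Complex.conj_ofReal, Complex.conj_I, mul_neg]
    rw [this, ← Complex.exp_add, add_neg_cancel, Complex.exp_zero]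
  · rw [← Complex.exp_nat_mul, ← Complex.exp_pi_mul_I]
    congr 1
    push_cast
    ring

/-- For bits `a`, `b`, `q` the identity `4abq = a + b + q - a⊕b - a⊕q - b⊕q + a⊕b⊕q` writes the sign
`(-1) ^ (abq)` as a product of phases of parities, with a root `w` satisfying `w ^ 4 = -1`. Control
value `false` is absorbed by negating the bit. The depth is `1 + 1 + 1 + 3 + 3 + 3 + 5` plus two
Hadamard gates. -/
theorem Realizes.toffoli {N : ℕ} {B : Finset (Fin N)} {a b q : Fin N} (ha : a ∈ B) (hb : b ∈ B)
    (hq : q ∈ B) (hab : a ≠ b) (haq : a ≠ q) (hbq : b ≠ q) (va vb : Bool) :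
    Realizes B 19 (funMatrix (addTo q fun x => x a == va && x b == vb)) := by
  obtain ⟨w, hw, hw4⟩ := exists_eighth_root
  have hw' : star w * w = 1 := by rw [mul_comm, hw]
  refine Realizes.addTo_of_diagonal hq (d := 17) (fun x b => ?_) ?_
  · rw [Function.update_of_ne haq, Function.update_of_ne hbq]
  set τ : Bool → Bool → ℂ := fun c s => if xor s c then w else 1 with hτ
  set σ : Bool → Bool → ℂ := fun c s => if xor s c then star w else 1 with hσ
  have hτ1 : ∀ c s, τ c s * star (τ c s) = 1 := by
    intro c s
    simp only [hτ]
    split_ifs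
    · exact hw
    · simp
  have hσ1 : ∀ c s, σ c s * star (σ c s) = 1 := by
    intro c s
    simp only [hσ]
    split_ifs
    · rw [star_star, hw']
    · simp
  have h1 := Realizes.phase hq (τ false) (hτ1 _)
  have h2 := Realizes.phase ha (τ !va) (hτ1 _)
  have h3 := Realizes.phase hb (τ !vb) (hτ1 _)
  have h4 := Realizes.phase_xor ha hq haq (σ !va) (hσ1 _)
  have h5 := Realizes.phase_xor hb hq hbq (σ !vb) (hσ1 _)
  have h6 := Realizes.phase_xor ha hb hab (σ (xor (!va) (!vb))) (hσ1 _)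
  have h7 := Realizes.phase_xor_xor ha hb hq haq hbq (τ (xor (!va) (!vb))) (hτ1 _)
  have h := (((((h1.diagonal_mul h2).diagonal_mul h3).diagonal_mul h4).diagonal_mul
    h5).diagonal_mul h6).diagonal_mul h7
  convert h using 3 with x
  simp only [hτ, hσ]
  generalize star w = u at hw
  cases x q <;> cases x a <;> cases x b <;> cases va <;> cases vb <;> simp <;>
    first
      | linear_combination -hw4
      | linear_combination -(1 + w * u) * hw

/-! ### Multi-controlled gates with dirty work bits -/

/-- The ladder: bit `d j`, for `j ≤ i`, is flipped if the first `j` controls are satisfied. -/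
def ladder {N : ℕ} (c : ℕ → Fin N) (v : ℕ → Bool) (d : ℕ → Fin N) (i : ℕ) (x : Bits N) : Bits N :=
  fun q => xor (x q) (decide (∃ j ≤ i, d j = q ∧ ∀ l < j, x (c l) = v l))

section Ladder

variable {N m : ℕ} {c : ℕ → Fin N} {v : ℕ → Bool} {d : ℕ → Fin N}

theorem ladder_apply_of_ne {i : ℕ} {q : Fin N} (hq : ∀ j ≤ i, d j ≠ q) (x : Bits N) :
    ladder c v d i x q = x q := by
  rw [ladder, decide_eq_false, Bool.xor_false]
  rintro ⟨j, hj, hjq, -⟩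
  exact hq j hj hjq

theorem ladder_apply_work (hd : ∀ i ≤ m, ∀ j ≤ m, d i = d j → i = j) {i j : ℕ} (him : i ≤ m)
    (hj : j ≤ i) (x : Bits N) :
    ladder c v d i x (d j) = xor (x (d j)) (decide (∀ l < j, x (c l) = v l)) := by
  rw [ladder]
  congr 1
  rw [decide_eq_decide]
  constructor
  · rintro ⟨j', hj', he, h⟩
    rwa [hd j' (hj'.trans him) j (hj.trans him) he] at h
  · exact fun h => ⟨j, hj, rfl, h⟩

theorem ladder_succ (hd : ∀ i ≤ m, ∀ j ≤ m, d i = d j → i = j) (hcd : ∀ l < m, ∀ j ≤ m, c l ≠ d j)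
    {i : ℕ} (him : i < m) (x : Bits N) :
    ladder c v d (i + 1) x = addTo (d (i + 1)) (fun x => x (c i) == v i && x (d i) == true)
      (ladder c v d i (addTo (d (i + 1)) (fun x => x (c i) == v i && x (d i) == true) x)) := by
  have hne : ∀ j ≤ i, d j ≠ d (i + 1) := fun j hj h => by
    have := hd j (by omega) (i + 1) (by omega) h
    omega
  set T := addTo (d (i + 1)) (fun x => x (c i) == v i && x (d i) == true) with hT
  have hTne : ∀ (y : Bits N) q, q ≠ d (i + 1) → T y q = y q := fun y q hq => by
    rw [hT, addTo, Function.update_of_ne hq]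
  have hTc : ∀ (y : Bits N), ∀ l < m, T y (c l) = y (c l) := fun y l hl =>
    hTne y _ (hcd l hl (i + 1) (by omega))
  have hLc : ∀ (y : Bits N), ∀ l < m, ladder c v d i y (c l) = y (c l) := fun y l hl =>
    ladder_apply_of_ne (fun j hj h => hcd l hl j (by omega) h.symm) y
  have hpre : ∀ j ≤ i, (∀ l < j, T x (c l) = v l) ↔ ∀ l < j, x (c l) = v l := by
    intro j hj
    refine forall₂_congr fun l hl => ?_
    rw [hTc x l (by omega)]
  ext q
  by_cases hq : ∃ j ≤ i, d j = q
  · obtain ⟨j, hj, rfl⟩ := hq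
    rw [ladder_apply_work hd (by omega) (by omega), hTne _ _ (hne j hj),
      ladder_apply_work hd (by omega) hj, hTne _ _ (hne j hj)]
    simp only [hpre j hj]
  · push Not at hq
    by_cases hq' : q = d (i + 1)
    · subst hq'
      have h1 : ladder c v d i (T x) (d (i + 1)) = xor (x (d (i + 1)))
          (x (c i) == v i && x (d i) == true) := by
        rw [ladder_apply_of_ne hq, hT, addTo, Function.update_self]
      have h2 : ladder c v d i (T x) (d i) = xor (x (d i)) (decide (∀ l < i, x (c l) = v l)) := by
        rw [ladder_apply_work hd (by omega) le_rfl, hTne _ _ (hne i le_rfl)]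
        simp only [hpre i le_rfl]
      have h3 : ladder c v d i (T x) (c i) = x (c i) := by rw [hLc _ _ him, hTc _ _ him]
      rw [ladder_apply_work hd (by omega) le_rfl]
      conv_rhs => rw [hT, addTo, Function.update_self, ← hT]
      rw [h1, h2, h3]
      have h4 : decide (∀ l < i + 1, x (c l) = v l) =
          (decide (∀ l < i, x (c l) = v l) && x (c i) == v i) := by
        rw [Bool.eq_iff_iff]
        simp only [decide_eq_true_eq, Bool.and_eq_true, beq_iff_eq]
        exact Nat.forall_lt_succ_right
      rw [h4]
      cases x (d (i + 1)) <;> cases x (d i) <;> cases (x (c i) == v i) <;> simp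
    · rw [hTne _ _ hq', ladder_apply_of_ne hq, hTne _ _ hq', ladder_apply_of_ne]
      intro j hj h
      rcases Nat.lt_or_ge i j with hij | hij
      · obtain rfl : j = i + 1 := by omega
        exact hq' h.symm
      · exact hq j hij h

theorem Realizes.ladder {B : Finset (Fin N)} (hcB : ∀ l < m, c l ∈ B) (hdB : ∀ j ≤ m, d j ∈ B)
    (hd : ∀ i ≤ m, ∀ j ≤ m, d i = d j → i = j) (hcd : ∀ l < m, ∀ j ≤ m, c l ≠ d j)
    {i : ℕ} (him : i ≤ m) : Realizes B (1 + 38 * i) (funMatrix (ladder c v d i)) := by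
  induction i with
  | zero =>
    convert Realizes.not (hdB 0 (Nat.zero_le _)) using 2
    funext x q
    by_cases hq : q = d 0
    · subst hq; simp [RandomMCX.ladder, addTo]
    · rw [addTo, Function.update_of_ne hq, ladder_apply_of_ne]
      intro j hj
      rw [Nat.le_zero.1 hj]
      exact Ne.symm hq
  | succ i ih =>
    have hT := Realizes.toffoli (hcB i him) (hdB i (by omega)) (hdB (i + 1) him)
      (hcd i him i (by omega)) (hcd i him (i + 1) him)
      (fun h => by have := hd i (by omega) (i + 1) him h; omega) (v i) true
    have h := hT.comp ((ih (by omega)).comp hT)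
    rw [show 19 + (1 + 38 * i) + 19 = 1 + 38 * (i + 1) by ring] at h
    convert h using 2
    funext x
    exact ladder_succ hd hcd him x

/-- Two ladders of consecutive lengths undo each other on every work bit and leave only the flip of
the last one. The work bits may hold anything and are restored. -/
theorem Realizes.mcx_ladder {B : Finset (Fin N)} (hcB : ∀ l < m, c l ∈ B) (hdB : ∀ j ≤ m, d j ∈ B)
    (hd : ∀ i ≤ m, ∀ j ≤ m, d i = d j → i = j) (hcd : ∀ l < m, ∀ j ≤ m, c l ≠ d j) :
    Realizes B (2 + 76 * m)
      (funMatrix (addTo (d m) fun x => decide (∀ l < m, x (c l) = v l))) := by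
  have h1 := Realizes.ladder (v := v) hcB hdB hd hcd le_rfl
  cases m with
  | zero =>
    refine Realizes.mono ?_ subset_rfl (by norm_num : 1 + 38 * 0 ≤ 2 + 76 * 0)
    convert h1 using 2
    funext x q
    by_cases hq : q = d 0
    · subst hq; simp [RandomMCX.ladder, addTo]
    · rw [addTo, Function.update_of_ne hq, ladder_apply_of_ne]
      intro j hj
      rw [Nat.le_zero.1 hj]
      exact Ne.symm hq
  | succ m =>
    have h2 := Realizes.ladder (v := v) hcB hdB hd hcd (Nat.le_succ m)
    refine Realizes.mono ?_ subset_rfl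
      (by omega : 1 + 38 * m + (1 + 38 * (m + 1)) ≤ 2 + 76 * (m + 1))
    convert h1.comp h2 using 2
    funext x q
    have hLc : ∀ l < m + 1, RandomMCX.ladder c v d m x (c l) = x (c l) := fun l hl =>
      ladder_apply_of_ne (fun j hj h => hcd l hl j (by omega) h.symm) x
    have hpre : ∀ j ≤ m + 1, (∀ l < j, RandomMCX.ladder c v d m x (c l) = v l) ↔
        ∀ l < j, x (c l) = v l := by
      intro j hj
      refine forall₂_congr fun l hl => ?_
      rw [hLc l (by omega)]
    by_cases hq : ∃ j ≤ m, d j = q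
    · obtain ⟨j, hj, rfl⟩ := hq
      rw [addTo, Function.update_of_ne (fun h => by
        have := hd j (by omega) (m + 1) le_rfl h
        omega), ladder_apply_work hd le_rfl (by omega), ladder_apply_work hd (by omega) hj]
      simp only [hpre j (by omega), Bool.xor_assoc, Bool.xor_self, Bool.xor_false]
    · push Not at hq
      by_cases hq' : q = d (m + 1)
      · subst hq'
        rw [addTo, Function.update_self, ladder_apply_work hd le_rfl le_rfl,
          ladder_apply_of_ne hq]
        simp only [hpre (m + 1) le_rfl]
      · rw [addTo, Function.update_of_ne hq', ladder_apply_of_ne, ladder_apply_of_ne hq]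
        intro j hj h
        rcases Nat.lt_or_ge m j with hij | hij
        · obtain rfl : j = m + 1 := by omega
          exact hq' h.symm
        · exact hq j hij h

end Ladder

theorem Realizes.mcx {N m : ℕ} {B : Finset (Fin N)} {c d : Fin m → Fin N} {v : Fin m → Bool}
    {q : Fin N} (hc : ∀ l, c l ∈ B) (hd : ∀ j, d j ∈ B) (hq : q ∈ B) (hdi : Function.Injective d)
    (hcd : ∀ l j, c l ≠ d j) (hcq : ∀ l, c l ≠ q) (hdq : ∀ j, d j ≠ q) :
    Realizes B (2 + 76 * m) (funMatrix (addTo q fun x => decide (∀ l, x (c l) = v l))) := by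
  have h := Realizes.mcx_ladder (m := m) (B := B) (c := fun l => if h : l < m then c ⟨l, h⟩ else q)
    (v := fun l => if h : l < m then v ⟨l, h⟩ else false)
    (d := fun j => if h : j < m then d ⟨j, h⟩ else q)
    (by intro l hl; simp only [dif_pos hl, hc])
    (by
      intro j _
      by_cases hj : j < m
      · simp only [dif_pos hj, hd]
      · simp only [dif_neg hj, hq])
    (by
      intro i hi j hj
      by_cases hi' : i < m <;> by_cases hj' : j < m
      · simp only [dif_pos hi', dif_pos hj']
        exact fun h => congrArg Fin.val (hdi h)
      · simp only [dif_pos hi', dif_neg hj']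
        exact fun h => absurd h (hdq _)
      · simp only [dif_neg hi', dif_pos hj']
        exact fun h => absurd h.symm (hdq _)
      · omega)
    (by
      intro l hl j _
      by_cases hj : j < m
      · simp only [dif_pos hl, dif_pos hj]; exact hcd _ _
      · simp only [dif_pos hl, dif_neg hj]; exact hcq _)
  convert h using 2
  have : ∀ x : Bits N, (∀ l < m, x (if h : l < m then c ⟨l, h⟩ else q) =
      if h : l < m then v ⟨l, h⟩ else false) ↔ ∀ l, x (c l) = v l := by
    intro x
    constructor
    · intro h l
      simpa using h l l.isLt
    · intro h l hl
      simpa [hl] using h ⟨l, hl⟩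
  simp only [lt_irrefl, dite_false, this]

/-! ### Parallel execution and fan-out -/

theorem xorMap_congr {N : ℕ} {P P' : Fin N → Prop} [DecidablePred P] [DecidablePred P']
    {h h' : Fin N → Bits N → Bool} {x : Bits N} (hP : ∀ q, P q ↔ P' q)
    (hh : ∀ q, P q → h q x = h' q x) : xorMap P h x = xorMap P' h' x := by
  ext q
  by_cases hq : P q
  · rw [xorMap, xorMap, if_pos hq, if_pos ((hP q).1 hq), hh q hq]
  · rw [xorMap, xorMap, if_neg hq, if_neg fun h => hq ((hP q).2 h)]

open Classical in
theorem Realizes.parallel_aux {N : ℕ} {κ : Type} (s : Finset κ) (Bk : κ → Finset (Fin N))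
    (hB : ∀ a ∈ s, ∀ b ∈ s, a ≠ b → Disjoint (Bk a) (Bk b)) (d : ℕ)
    (h : Fin N → Bits N → Bool) (Pk : κ → Fin N → Prop)
    (hP : ∀ a ∈ s, ∀ q, Pk a q → q ∈ Bk a)
    (hloc : ∀ a ∈ s, ∀ q, Pk a q → ∀ x y : Bits N, (∀ j ∈ Bk a, x j = y j) → h q x = h q y)
    (hreal : ∀ a ∈ s, Realizes (Bk a) d (funMatrix (xorMap (Pk a) h))) :
    Realizes (s.biUnion Bk) d (funMatrix (xorMap (fun q => ∃ a ∈ s, Pk a q) h)) := by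
  induction s using Finset.induction_on with
  | empty =>
    convert Realizes.id _ d using 2
    funext x q
    simp [xorMap]
  | insert a s ha ih =>
    have ih' := ih (fun a ha b hb => hB a (by simp [ha]) b (by simp [hb]))
      (fun a ha => hP a (by simp [ha])) (fun a ha => hloc a (by simp [ha]))
      (fun a ha => hreal a (by simp [ha]))
    have hdis : ∀ b ∈ s, Disjoint (Bk a) (Bk b) := fun b hb =>
      hB a (by simp) b (by simp [hb]) (fun h => ha (h ▸ hb))
    have hdis' : Disjoint (Bk a) (s.biUnion Bk) := by
      rw [Finset.disjoint_biUnion_right]; exact hdis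
    rw [Finset.biUnion_insert]
    convert Realizes.par_comp hdis' (hreal a (by simp)) ih' using 2
    funext x q
    have hsame : ∀ j ∈ Bk a, xorMap (fun q => ∃ a ∈ s, Pk a q) h x j = x j := by
      intro j hj
      rw [xorMap, if_neg]
      rintro ⟨b, hb, hbj⟩
      exact Finset.disjoint_left.1 (hdis b hb) hj (hP b (by simp [hb]) j hbj)
    by_cases hq : Pk a q
    · conv_rhs => rw [xorMap, if_pos hq]
      rw [hsame q (hP a (by simp) q hq),
        hloc a (by simp) q hq _ x hsame, xorMap, if_pos ⟨a, by simp, hq⟩]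
    · conv_rhs => rw [xorMap, if_neg hq]
      rw [xorMap, xorMap]
      simp [hq]

theorem Realizes.parallel {N : ℕ} {κ : Type} {B : Finset (Fin N)} (s : Finset κ)
    (Bk : κ → Finset (Fin N)) (hBB : ∀ a ∈ s, Bk a ⊆ B)
    (hB : ∀ a ∈ s, ∀ b ∈ s, a ≠ b → Disjoint (Bk a) (Bk b)) (d : ℕ)
    (h : Fin N → Bits N → Bool) (Pk : κ → Fin N → Prop) [∀ a, DecidablePred (Pk a)]
    (hP : ∀ a ∈ s, ∀ q, Pk a q → q ∈ Bk a)
    (hloc : ∀ a ∈ s, ∀ q, Pk a q → ∀ x y : Bits N, (∀ j ∈ Bk a, x j = y j) → h q x = h q y)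
    (hreal : ∀ a ∈ s, Realizes (Bk a) d (funMatrix (xorMap (Pk a) h)))
    (P : Fin N → Prop) [DecidablePred P] (hPP : ∀ q, P q ↔ ∃ a ∈ s, Pk a q) :
    Realizes B d (funMatrix (xorMap P h)) := by
  classical
  have h1 := Realizes.parallel_aux s Bk hB d h Pk hP hloc (by
    intro a ha
    convert hreal a ha)
  refine Realizes.mono ?_ (Finset.biUnion_subset.2 hBB) le_rfl
  have h2 : P = fun q => ∃ a ∈ s, Pk a q := funext fun q => propext (hPP q)
  subst h2
  convert h1

theorem Realizes.cnotLayer {N : ℕ} {B : Finset (Fin N)} (P : Fin N → Prop) [DecidablePred P]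
    (src : Fin N → Fin N) (hP : ∀ q, P q → q ∈ B ∧ src q ∈ B ∧ ¬ P (src q))
    (hinj : ∀ q q', P q → P q' → src q = src q' → q = q') :
    Realizes B 1 (funMatrix (xorMap P fun q x => x (src q))) := by
  classical
  refine Realizes.parallel (Finset.univ.filter P) (fun q => {q, src q}) ?_ ?_ 1
    (fun q x => x (src q)) (fun a q => q = a) ?_ ?_ ?_ P (fun q => by simp)
  · intro q hq
    have := hP q (Finset.mem_filter.1 hq).2
    simp [Finset.insert_subset_iff, this.1, this.2.1]
  · intro a ha b hb hab
    have ha' := (Finset.mem_filter.1 ha).2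
    have hb' := (Finset.mem_filter.1 hb).2
    rw [Finset.disjoint_left]
    intro z hz hz'
    rw [Finset.mem_insert, Finset.mem_singleton] at hz hz'
    rcases hz with rfl | rfl <;> rcases hz' with h | h
    · exact hab h
    · exact (hP b hb').2.2 (h ▸ ha')
    · exact (hP a ha').2.2 (h ▸ hb')
    · exact hab (hinj a b ha' hb' h)
  · rintro a _ q rfl; simp
  · rintro a _ q rfl x y hxy; exact hxy _ (by simp)
  · intro a ha
    have ha' := (Finset.mem_filter.1 ha).2
    have hne : src a ≠ a := fun h => (hP a ha').2.2 (h.symm ▸ ha')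
    convert Realizes.cnot hne (B := {a, src a}) (by simp) (by simp) using 2
    funext x q
    by_cases hq : q = a
    · subst hq; simp [xorMap, addTo]
    · simp [xorMap, addTo, hq]

/-- Doubling by conjugation: a CNOT layer adds the targets below `2 ^ j` to the next `2 ^ j` both
before and after the flip. Old contents cancel and the flip is copied, at a cost of two layers. -/
theorem Realizes.fanOut {N s d : ℕ} {B : Finset (Fin N)} (hs : 0 < s) {e : Fin s → Fin N}
    (he : Function.Injective e) (heB : ∀ i, e i ∈ B) {f : Bits N → Bool}
    (hf : ∀ x y : Bits N, (∀ q, (∀ i, e i ≠ q) → x q = y q) → f x = f y)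
    (h0 : Realizes B d (funMatrix (addTo (e ⟨0, hs⟩) f))) (j : ℕ) :
    Realizes B (d + 2 * j)
      (funMatrix (xorMap (fun q => ∃ i : Fin s, (i : ℕ) < 2 ^ j ∧ e i = q) fun _ => f)) := by
  induction j with
  | zero =>
    rw [mul_zero, add_zero]
    convert h0 using 2
    funext x q
    by_cases hq : q = e ⟨0, hs⟩
    · subst hq
      rw [addTo, Function.update_self, xorMap, if_pos ⟨_, by simp, rfl⟩]
    · rw [addTo, Function.update_of_ne hq, xorMap, if_neg]
      rintro ⟨i, hi, rfl⟩
      apply hq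
      congr
      exact Fin.ext (Nat.lt_one_iff.1 hi)
  | succ j ih =>
    classical
    have hp : 2 ^ (j + 1) = 2 ^ j + 2 ^ j := by rw [pow_succ]; ring
    set Q : Fin N → Prop := fun q => ∃ i : Fin s, (2 ^ j ≤ (i : ℕ) ∧ (i : ℕ) < 2 ^ (j + 1)) ∧ e i = q
      with hQ
    -- Injectivity of `e` makes the chosen index the only one; the value outside `Q` is never read.
    set src : Fin N → Fin N := fun q =>
      if h : Q q then e ⟨(h.choose : ℕ) - 2 ^ j, lt_of_le_of_lt (Nat.sub_le _ _) h.choose.isLt⟩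
      else q with hsrc
    have hsrc' : ∀ i : Fin s, 2 ^ j ≤ (i : ℕ) → (i : ℕ) < 2 ^ (j + 1) →
        src (e i) = e ⟨(i : ℕ) - 2 ^ j, lt_of_le_of_lt (Nat.sub_le _ _) i.isLt⟩ := by
      intro i h1 h2
      have hQi : Q (e i) := ⟨i, ⟨h1, h2⟩, rfl⟩
      have hch : hQi.choose = i := he hQi.choose_spec.2
      simp only [hsrc, dif_pos hQi, hch]
    have hV : Realizes B 1 (funMatrix (xorMap Q fun q x => x (src q))) := by
      refine Realizes.cnotLayer Q src ?_ ?_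
      · rintro q ⟨i, ⟨h1, h2⟩, rfl⟩
        refine ⟨heB i, by rw [hsrc' i h1 h2]; exact heB _, ?_⟩
        rw [hsrc' i h1 h2]
        rintro ⟨i', ⟨h1', h2'⟩, hi'⟩
        have := congrArg Fin.val (he hi')
        simp only at this
        omega
      · rintro q q' ⟨i, ⟨h1, h2⟩, rfl⟩ ⟨i', ⟨h1', h2'⟩, rfl⟩ h
        rw [hsrc' i h1 h2, hsrc' i' h1' h2'] at h
        have := congrArg Fin.val (he h)
        simp only at this
        congr 1
        ext
        omega
    have h := hV.comp (ih.comp hV)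
    rw [show 1 + (d + 2 * j) + 1 = d + 2 * (j + 1) by ring] at h
    convert h using 2
    funext x q
    set V := xorMap Q fun q x => x (src q) with hVdef
    have hfV : f (V x) = f x := by
      refine hf _ _ fun q hq => ?_
      rw [hVdef, xorMap, if_neg]
      rintro ⟨i, -, hi⟩
      exact hq i hi
    have hlow : ∀ (y : Bits N) (i : Fin s), (i : ℕ) < 2 ^ j → V y (e i) = y (e i) := by
      intro y i hi
      rw [hVdef, xorMap, if_neg]
      rintro ⟨i', ⟨h1, -⟩, hi'⟩
      rw [he hi'] at h1
      omega
    have hF : ∀ (y : Bits N) (i : Fin s), (i : ℕ) < 2 ^ j →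
        xorMap (fun q => ∃ i : Fin s, (i : ℕ) < 2 ^ j ∧ e i = q) (fun _ => f) y (e i) =
          xor (y (e i)) (f y) := fun y i hi => by
      rw [xorMap, if_pos ⟨i, hi, rfl⟩]
    have hF' : ∀ (y : Bits N) q, (∀ i : Fin s, (i : ℕ) < 2 ^ j → e i ≠ q) →
        xorMap (fun q => ∃ i : Fin s, (i : ℕ) < 2 ^ j ∧ e i = q) (fun _ => f) y q = y q :=
      fun y q hq => by
        rw [xorMap, if_neg]
        rintro ⟨i, hi, hiq⟩
        exact hq i hi hiq
    by_cases hq : ∃ i : Fin s, e i = q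
    · obtain ⟨i, rfl⟩ := hq
      rcases Nat.lt_or_ge (i : ℕ) (2 ^ j) with hi | hi
      · rw [hlow _ i hi, hF _ i hi, hlow _ i hi, hfV, xorMap, if_pos ⟨i, by omega, rfl⟩]
      · have hFi : ∀ y : Bits N, xorMap (fun q => ∃ i : Fin s, (i : ℕ) < 2 ^ j ∧ e i = q)
            (fun _ => f) y (e i) = y (e i) := fun y => hF' y _ fun i' hi' h => by
          rw [he h] at hi'
          omega
        by_cases hi2 : (i : ℕ) < 2 ^ (j + 1)
        · have hVi : ∀ y : Bits N, V y (e i) =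
              xor (y (e i)) (y (e ⟨(i : ℕ) - 2 ^ j, lt_of_le_of_lt (Nat.sub_le _ _) i.isLt⟩)) := by
            intro y
            rw [hVdef, xorMap, if_pos ⟨i, ⟨hi, hi2⟩, rfl⟩, hsrc' i hi hi2]
          rw [hVi, hFi, hVi, hF _ _ (by simp only; omega), hlow _ _ (by simp only; omega), hfV,
            xorMap, if_pos ⟨i, hi2, rfl⟩]
          generalize x (e _) = b
          cases x (e i) <;> cases b <;> simp
        · have hVi : ∀ y : Bits N, V y (e i) = y (e i) := by
            intro y
            rw [hVdef, xorMap, if_neg]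
            rintro ⟨i', ⟨-, h2⟩, hi'⟩
            rw [he hi'] at h2
            exact hi2 h2
          rw [hVi, hFi, hVi, xorMap, if_neg]
          rintro ⟨i', h2, hi'⟩
          rw [he hi'] at h2
          exact hi2 h2
    · push Not at hq
      have hVq : ∀ y : Bits N, V y q = y q := by
        intro y
        rw [hVdef, xorMap, if_neg]
        rintro ⟨i', -, hi'⟩
        exact hq i' hi'
      rw [hVq, hF' _ _ (fun i _ => hq i), hVq, xorMap, if_neg]
      rintro ⟨i', -, hi'⟩
      exact hq i' hi'

/-! ### The depth of the random circuit -/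

/-- The bits of the registers `r` and `r'`. -/
def registerPair (n k r r' : ℕ) : Finset (Fin n) :=
  Finset.univ.filter fun q => (q : ℕ) / k = r ∨ (q : ℕ) / k = r'

/-- All selected bits of register `r'` undergo the same flip, so one MCX followed by a fan-out
suffices. The `m` dirty work bits are source positions outside the controls, which exist because `2
* m ≤ k`. -/
theorem Realizes.register {n k m d : ℕ} (hk : 0 < k) (hmk : 2 * m ≤ k) (hd : k ≤ 2 ^ d) {r r' : ℕ}
    (hr : (r + 1) * k ≤ n) (hrr : r' ≠ r) (T : Fin n → Prop) [DecidablePred T]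
    (p : (Fin m ↪ Fin k) × (Fin m → Bool)) :
    Realizes (registerPair n k r r') (2 + 76 * m + 2 * d)
      (funMatrix (xorMap (fun q => (q : ℕ) / k = r' ∧ T q) fun _ x => fires p (regStr k r x))) := by
  classical
  set Q : Finset (Fin n) := Finset.univ.filter fun q => (q : ℕ) / k = r' ∧ T q with hQ
  have hQr : ∀ q ∈ Q, (q : ℕ) / k = r' := fun q hq => (Finset.mem_filter.1 hq).2.1
  have hcard : Q.card ≤ k := by
    have : Q.card ≤ (Finset.range k).card := by
      refine Finset.card_le_card_of_injOn (fun q => (q : ℕ) % k)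
        (fun q _ => by simpa using Nat.mod_lt _ hk) ?_
      intro q hq q' hq' h
      ext
      rw [← Nat.div_add_mod (q : ℕ) k, ← Nat.div_add_mod (q' : ℕ) k, hQr q hq, hQr q' hq']
      simp only at h
      rw [h]
    simpa using this
  have hreg : ∀ s, (regBit r hr s : Fin n) ∈ registerPair n k r r' := fun s => by
    simp [registerPair, regBit_div]
  have hregQ : ∀ s, ∀ q ∈ Q, regBit r hr s ≠ q := by
    rintro s q hq rfl
    have := hQr _ hq
    rw [regBit_div] at this
    exact hrr this.symm
  have hinj : Function.Injective (regBit r hr : Fin k → Fin n) := by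
    intro s s' h
    have := congrArg Fin.val h
    simp only [regBit] at this
    ext
    omega
  rcases Nat.eq_zero_or_pos Q.card with h0 | h0
  · convert Realizes.id _ _ using 2
    funext x q
    rw [xorMap, if_neg]
    intro h
    have : q ∈ Q := by simpa [hQ] using h
    rw [Finset.card_eq_zero.1 h0] at this
    simp at this
  set e : Fin Q.card → Fin n := fun i => (Q.equivFin.symm i : Fin n) with he
  have heQ : ∀ i, e i ∈ Q := fun i => (Q.equivFin.symm i).2
  have hei : Function.Injective e := fun i j h => Q.equivFin.symm.injective (Subtype.ext h)
  have hes : ∀ q ∈ Q, ∃ i, e i = q := fun q hq => ⟨Q.equivFin ⟨q, hq⟩, by simp [he]⟩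
  obtain ⟨w⟩ : Nonempty (Fin m ↪ {s : Fin k // s ∉ Set.range p.1}) := by
    refine Function.Embedding.nonempty_of_card_le ?_
    rw [Fintype.card_subtype_compl]
    have : Fintype.card {s : Fin k // s ∈ Set.range p.1} = m := by
      rw [show Fintype.card {s : Fin k // s ∈ Set.range p.1} = Fintype.card (Set.range p.1) from
        Fintype.card_congr (Equiv.refl _), Set.card_range_of_injective p.1.injective,
        Fintype.card_fin]
    simp only [this, Fintype.card_fin]
    omega
  have hfe : ∀ x : Bits n, fires p (regStr k r x) =
      decide (∀ l, x (regBit r hr (p.1 l)) = p.2 l) := fun x => by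
    simp only [fires, regStr_apply hr]
  have hmcx : Realizes (registerPair n k r r') (2 + 76 * m)
      (funMatrix (addTo (e ⟨0, h0⟩) fun x => fires p (regStr k r x))) := by
    simp only [hfe]
    refine Realizes.mcx (d := fun j => regBit r hr (w j).1) (fun l => hreg _) (fun j => hreg _) ?_ ?_
      ?_ (fun l => hregQ _ _ (heQ _)) (fun l => hregQ _ _ (heQ _))
    · simp [registerPair, hQr _ (heQ _)]
    · intro j j' h
      exact w.injective (Subtype.ext (hinj h))
    · intro l j h
      exact (w j).2 ⟨l, hinj h⟩
  have h := Realizes.fanOut h0 hei (fun i => by simp [registerPair, hQr _ (heQ i)]) (by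
    intro x y hxy
    rw [hfe, hfe]
    have : ∀ l, x (regBit r hr (p.1 l)) = y (regBit r hr (p.1 l)) := fun l =>
      hxy _ fun i => (hregQ _ _ (heQ i)).symm
    simp only [this]) hmcx d
  convert h using 2
  funext x
  refine xorMap_congr (fun q => ?_) fun _ _ => rfl
  constructor
  · intro hq
    obtain ⟨i, hi⟩ := hes q (by simpa [hQ] using hq)
    exact ⟨i, i.isLt.trans_le (hcard.trans hd), hi⟩
  · rintro ⟨i, -, rfl⟩
    exact (Finset.mem_filter.1 (heQ i)).2

/-- The control contents depend only on bits outside `P`, so the MCX gates may be regrouped by gate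
index instead of by target bit. This is what makes the fan-out applicable. -/
theorem Realizes.coins {n k m α D : ℕ} {B : Finset (Fin n)} (ω : Seed n k m α) {P : Fin n → Prop}
    [DecidablePred P] {h : Fin n → Bits n → Bits k}
    (hloc : ∀ q, P q → ∀ x y : Bits n, (∀ j, ¬ P j → x j = y j) → h q x = h q y)
    (hj : ∀ j, Realizes B D (funMatrix
      (xorMap (fun q => P q ∧ ω.2 q j = true) fun q x => fires (ω.1 j) (h q x))))
    (js : List (Fin α)) :
    Realizes B (D * js.length)
      (funMatrix (xorMap P fun q x => coinXor ω.1 js (ω.2 q) (h q x))) := by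
  induction js with
  | nil =>
    convert Realizes.id B _ using 2
    funext x q
    simp [xorMap, coinXor]
  | cons j js ih =>
    have := ih.comp (hj j)
    rw [List.length_cons, Nat.mul_succ, Nat.add_comm]
    convert this using 2
    funext x q
    by_cases hq : P q
    · have hh : h q (xorMap (fun q => P q ∧ ω.2 q j = true) (fun q x => fires (ω.1 j) (h q x)) x) =
          h q x := hloc q hq _ _ fun i hi => by rw [xorMap, if_neg fun h => hi h.1]
      conv_rhs => rw [xorMap, if_pos hq, hh]
      rw [xorMap, if_pos hq, coinXor_cons, xorMap]
      by_cases hb : ω.2 q j = true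
      · rw [if_pos ⟨hq, hb⟩, hb, Bool.true_and, Bool.xor_assoc]
      · rw [if_neg fun h => hb h.2, Bool.eq_false_iff.2 hb, Bool.false_and, Bool.false_xor]
    · conv_rhs => rw [xorMap, if_neg hq]
      rw [xorMap, if_neg hq, xorMap, if_neg fun h => hq h.1]

/-- The pairs of registers `r - 2 ^ i` and `r` are disjoint for `2 ^ i ≤ r < 2 ^ (i + 1)`, so all of
them run in parallel and the depth does not depend on their number. -/
theorem Realizes.randomizeStep {n k m α d : ℕ} (hk : 0 < k) (hmk : 2 * m ≤ k) (hd : k ≤ 2 ^ d)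
    (ω : Seed n k m α) (i : ℕ) :
    Realizes Finset.univ ((2 + 76 * m + 2 * d) * α)
      (funMatrix fun x => (randomizeStep ω i).reverse.prod x) := by
  have hp0 := Nat.two_pow_pos i
  have hp : 2 ^ (i + 1) = 2 ^ i + 2 ^ i := by rw [pow_succ]; ring
  have hloc : ∀ q : Fin n, (2 ^ i ≤ (q : ℕ) / k ∧ (q : ℕ) / k < 2 ^ (i + 1)) →
      ∀ x y : Bits n, (∀ j : Fin n, (j : ℕ) / k = (q : ℕ) / k - 2 ^ i → x j = y j) →
      regStr k ((q : ℕ) / k - 2 ^ i) x = regStr k ((q : ℕ) / k - 2 ^ i) y := by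
    intro q hq x y hxy
    ext s
    rw [regStr_apply (div_sub_lt hq.1), regStr_apply (div_sub_lt hq.1)]
    exact hxy _ (regBit_div _ _ _)
  have h := Realizes.coins (B := Finset.univ) (D := 2 + 76 * m + 2 * d) ω
    (P := fun q => 2 ^ i ≤ (q : ℕ) / k ∧ (q : ℕ) / k < 2 ^ (i + 1))
    (h := fun q x => regStr k ((q : ℕ) / k - 2 ^ i) x)
    (by
      intro q hq x y hxy
      refine hloc q hq x y fun j hj => hxy j ?_
      omega)
    (by
      intro j
      refine Realizes.parallel ((Finset.range (2 ^ (i + 1))).filter fun r => 2 ^ i ≤ r ∧ r * k < n)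
        (fun r => registerPair n k (r - 2 ^ i) r) (fun _ _ => Finset.subset_univ _) ?_ _ _
        (fun r q => (q : ℕ) / k = r ∧ ω.2 q j = true) ?_ ?_ ?_ _ ?_
      · intro a ha b hb hab
        simp only [Finset.mem_filter, Finset.mem_range] at ha hb
        rw [Finset.disjoint_left]
        intro z hz hz'
        simp only [registerPair, Finset.mem_filter, Finset.mem_univ, true_and] at hz hz'
        omega
      · rintro r - q ⟨hq, -⟩
        simp [registerPair, hq]
      · rintro r hr q ⟨rfl, -⟩ x y hxy
        simp only [Finset.mem_filter, Finset.mem_range] at hr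
        rw [hloc q ⟨hr.2.1, hr.1⟩ x y]
        intro j hj
        exact hxy j (by simp [registerPair, hj])
      · intro r hr
        simp only [Finset.mem_filter, Finset.mem_range] at hr
        have hle : (r - 2 ^ i + 1) * k ≤ n :=
          (Nat.mul_le_mul_right k (by omega : r - 2 ^ i + 1 ≤ r)).trans hr.2.2.le
        have h1 := Realizes.register hk hmk hd hle (by omega : r ≠ r - 2 ^ i)
          (fun q => ω.2 q j = true) (ω.1 j)
        convert h1 using 2
        funext x
        refine xorMap_congr (fun _ => Iff.rfl) ?_
        rintro q ⟨rfl, -⟩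
        rfl
      · intro q
        simp only [Finset.mem_filter, Finset.mem_range]
        constructor
        · rintro ⟨⟨h1, h2⟩, hb⟩
          exact ⟨(q : ℕ) / k, ⟨h2, h1, (Nat.div_mul_le_self _ _).trans_lt q.isLt⟩, rfl, hb⟩
        · rintro ⟨r, ⟨h2, h1, -⟩, rfl, hb⟩
          exact ⟨⟨h1, h2⟩, hb⟩)
    (List.finRange α)
  rw [List.length_finRange] at h
  convert h using 2
  funext x
  exact randomizeStep_apply ω i x

theorem Realizes.finalStep {n k m α d : ℕ} (hk : 0 < k) (hmk : 2 * m ≤ k) (hd : k ≤ 2 ^ d)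
    (ω : Seed n k m α) :
    Realizes Finset.univ ((2 + 76 * m + 2 * d) * α)
      (funMatrix fun x => (finalStep ω).reverse.prod x) := by
  by_cases hn : (1 + 1) * k ≤ n
  · have h := Realizes.coins (B := Finset.univ) (D := 2 + 76 * m + 2 * d) ω
      (P := fun q => (q : ℕ) < k ∧ (1 + 1) * k ≤ n) (h := fun _ x => regStr k 1 x)
      (by
        intro q hq x y hxy
        ext s
        rw [regStr_apply hn, regStr_apply hn]
        refine hxy _ ?_
        simp only [regBit]
        omega)
      (by
        intro j
        refine Realizes.mono ?_ (Finset.subset_univ (registerPair n k 1 0)) le_rfl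
        convert Realizes.register hk hmk hd hn zero_ne_one (fun q => ω.2 q j = true) (ω.1 j) using 2
        funext x
        refine xorMap_congr (fun q => ?_) fun _ _ => rfl
        rw [Nat.div_eq_zero_iff_lt hk]
        simp [hn])
      (List.finRange α)
    rw [List.length_finRange] at h
    convert h using 2
    funext x
    exact finalStep_apply ω x
  · convert Realizes.id _ _ using 2
    funext x
    rw [finalStep_apply]
    funext q
    rw [xorMap, if_neg fun h => hn h.2]

theorem Realizes.copyStep {n k : ℕ} (hk : 0 < k) (i : ℕ) :
    Realizes Finset.univ 1 (funMatrix fun x => (copyStep n k i).reverse.prod x) := by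
  have hp : 2 ^ (i + 1) = 2 ^ i + 2 ^ i := by rw [pow_succ]; ring
  have hsub : ∀ q : ℕ, 2 ^ i ≤ q / k → 2 ^ i * k ≤ q := fun q h => (Nat.le_div_iff_mul_le hk).1 h
  convert Realizes.cnotLayer (B := (Finset.univ : Finset (Fin n)))
    (fun q => 2 ^ i ≤ (q : ℕ) / k ∧ (q : ℕ) / k < 2 ^ (i + 1))
    (fun q => ⟨q - 2 ^ i * k, by omega⟩) ?_ ?_ using 2
  · funext x
    exact copyStep_apply x
  · rintro q ⟨h1, h2⟩
    refine ⟨Finset.mem_univ _, Finset.mem_univ _, ?_⟩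
    simp only [not_and, not_lt]
    rw [Nat.mul_comm, Nat.sub_mul_div]
    omega
  · rintro q q' ⟨h1, -⟩ ⟨h1', -⟩ h
    have h3 := congrArg Fin.val h
    have := hsub q h1
    have := hsub q' h1'
    simp only at h3
    ext
    omega

theorem Realizes.flatMap {n D : ℕ} {B : Finset (Fin n)} (step : ℕ → List (Equiv.Perm (Bits n)))
    (hstep : ∀ i, Realizes B D (funMatrix fun x => (step i).reverse.prod x)) (l : List ℕ) :
    Realizes B (D * l.length) (funMatrix fun x => (l.flatMap step).reverse.prod x) := by
  induction l with
  | nil => simpa using Realizes.id B 0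
  | cons i l ih =>
    have h := ih.comp (hstep i)
    rw [List.length_cons, Nat.mul_succ, Nat.add_comm]
    simpa only [List.flatMap_cons, reverse_prod_append] using h

theorem realizes_algorithmPerm {n k m α d : ℕ} (hk : 0 < k) (hmk : 2 * m ≤ k) (hd : k ≤ 2 ^ d)
    (ω : Seed n k m α) :
    Realizes Finset.univ (numRounds n k + (2 + 76 * m + 2 * d) * α * (numRounds n k + 1))
      (permUnitary (algorithmPerm ω)) := by
  have h1 := Realizes.flatMap _ (fun i => Realizes.copyStep (n := n) hk i)
    (List.range (numRounds n k - 1))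
  have h2 := Realizes.flatMap _ (fun i => Realizes.randomizeStep hk hmk hd ω i)
    (List.range (numRounds n k)).reverse
  have h := ((Realizes.finalStep hk hmk hd ω).comp h2).comp h1
  rw [List.length_reverse, List.length_range, List.length_range, ← Nat.mul_succ] at h
  refine Realizes.mono ?_ subset_rfl (Nat.add_le_add_right (by omega) _ :
    1 * (numRounds n k - 1) + (2 + 76 * m + 2 * d) * α * (numRounds n k + 1) ≤ _)
  convert h using 1
  ext y x
  simp only [permUnitary, funMatrix, algorithmPerm, algorithmGates, reverse_prod_append]

/-! ### Idle ancillas -/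

/-- The matrix `M ⊗ 1`, with `a` idle qubits. -/
def withIdle {n : ℕ} (a : ℕ) (M : Matrix (Bits n) (Bits n) ℂ) :
    Matrix (Bits (n + a)) (Bits (n + a)) ℂ :=
  Matrix.of fun Y X => if ∀ j, Y (Fin.natAdd n j) = X (Fin.natAdd n j) then
    M (fun i => Y (Fin.castAdd a i)) (fun i => X (Fin.castAdd a i)) else 0

theorem withIdle_one {n a : ℕ} : withIdle a (1 : Matrix (Bits n) (Bits n) ℂ) = 1 := by
  ext Y X
  simp only [withIdle, Matrix.of_apply, Matrix.one_apply]
  by_cases h : Y = X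
  · subst h; simp
  · rw [if_neg h]
    split_ifs with h1 h2
    · refine absurd (funext fun i => ?_) h
      refine Fin.addCases (fun i => congrFun h2 i) h1 i
    · rfl
    · rfl

theorem withIdle_mul {n a : ℕ} (M M' : Matrix (Bits n) (Bits n) ℂ) :
    withIdle a (M * M') = withIdle a M * withIdle a M' := by
  ext Y X
  rw [Matrix.mul_apply]
  simp only [withIdle, Matrix.of_apply]
  by_cases h : ∀ j, Y (Fin.natAdd n j) = X (Fin.natAdd n j)
  · rw [if_pos h, Matrix.mul_apply]
    refine Finset.sum_of_injOn (fun z => Fin.append z fun j => X (Fin.natAdd n j)) ?_ (by simp) ?_ ?_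
    · intro z _ z' _ hz
      funext i
      simpa using congrFun hz (Fin.castAdd a i)
    · intro Z _ hZ
      by_cases h1 : ∀ j, Z (Fin.natAdd n j) = X (Fin.natAdd n j)
      · refine absurd ⟨fun i => Z (Fin.castAdd a i), by simp, ?_⟩ hZ
        funext i
        refine Fin.addCases (fun i => ?_) (fun j => ?_) i
        · simp
        · simp [h1]
      · rw [if_neg h1, mul_zero]
    · intro z _
      simp [h]
  · rw [if_neg h]
    symm
    refine Finset.sum_eq_zero fun Z _ => ?_
    by_cases h1 : ∀ j, Y (Fin.natAdd n j) = Z (Fin.natAdd n j)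
    · have h2 : ¬ ∀ j, Z (Fin.natAdd n j) = X (Fin.natAdd n j) := fun h2 =>
        h fun j => (h1 j).trans (h2 j)
      rw [if_neg h2, mul_zero]
    · rw [if_neg h1, zero_mul]

/-- The same gate on a larger set of qubits. -/
def Gate.lift {n : ℕ} (a : ℕ) : Gate n → Gate (n + a)
  | .single i u => .single (Fin.castAdd a i) u
  | .cnot c q h => .cnot (Fin.castAdd a c) (Fin.castAdd a q)
      fun e => h (Fin.castAdd_injective n a e)

theorem Gate.lift_support {n a : ℕ} (g : Gate n) :
    (g.lift a).support = g.support.map (Fin.castAddEmb a) := by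
  cases g <;> simp [Gate.lift, Gate.support]

theorem Gate.lift_toMatrix {n a : ℕ} (g : Gate n) :
    (g.lift a).toMatrix = withIdle a g.toMatrix := by
  ext Y X
  cases g with
  | single i u =>
    simp only [Gate.lift, Gate.toMatrix, withIdle, Matrix.of_apply, ← ite_and]
    have : (∀ j, j ≠ Fin.castAdd a i → Y j = X j) ↔
        (∀ j, Y (Fin.natAdd n j) = X (Fin.natAdd n j)) ∧
          ∀ j, j ≠ i → Y (Fin.castAdd a j) = X (Fin.castAdd a j) := by
      constructor
      · intro h
        refine ⟨fun j => h _ ?_, fun j hj => h _ fun e => hj (Fin.castAdd_injective n a e)⟩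
        intro e
        have := congrArg Fin.val e
        simp at this
        omega
      · rintro ⟨h1, h2⟩ j
        refine Fin.addCases (fun j hj => h2 j fun e => hj (by rw [e])) (fun j _ => h1 j) j
    simp only [this]
  | cnot c q hcq =>
    simp only [Gate.lift, Gate.toMatrix, permUnitary, withIdle, Matrix.of_apply, cnot_apply,
      ← ite_and]
    have : Y = Function.update X (Fin.castAdd a q)
          (xor (X (Fin.castAdd a q)) (X (Fin.castAdd a c))) ↔
        (∀ j, Y (Fin.natAdd n j) = X (Fin.natAdd n j)) ∧ (fun i => Y (Fin.castAdd a i)) =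
          Function.update (fun i => X (Fin.castAdd a i)) q
            (xor (X (Fin.castAdd a q)) (X (Fin.castAdd a c))) := by
      simp only [Function.eq_update_iff]
      constructor
      · rintro ⟨h1, h⟩
        refine ⟨fun j => h _ ?_, h1, fun j hj => h _ fun e => hj (Fin.castAdd_injective n a e)⟩
        intro e
        have := congrArg Fin.val e
        simp at this
        omega
      · rintro ⟨h1, h2, h3⟩
        refine ⟨h2, fun j => ?_⟩
        refine Fin.addCases (fun j hj => h3 j fun e => hj (by rw [e])) (fun j _ => h1 j) j
    simp only [this]

theorem Realizes.implementable {n d : ℕ} {B : Finset (Fin n)} {M : Matrix (Bits n) (Bits n) ℂ}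
    (h : Realizes B d M) (a : ℕ) {D : ℝ} (hD : (d : ℝ) ≤ D) : ImplementableInDepth M a D := by
  obtain ⟨c, hc, -, rfl⟩ := h
  have hdisj : ∀ L : Layer n, (L.gates.map (Gate.lift a)).Pairwise
      fun g g' => Disjoint g.support g'.support := by
    intro L
    rw [List.pairwise_map]
    refine L.disjoint.imp fun {g g'} h => ?_
    rw [Gate.lift_support, Gate.lift_support, Finset.disjoint_map]
    exact h
  have hlist : ∀ l : List (Gate n), ((l.map (Gate.lift a)).map Gate.toMatrix).prod =
      withIdle a (l.map Gate.toMatrix).prod := by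
    intro l
    induction l with
    | nil => simp [withIdle_one]
    | cons g l ih =>
      simp only [List.map_cons, List.prod_cons, ih, withIdle_mul, Gate.lift_toMatrix]
  have hcirc : ∀ c : List (Layer n),
      circuitMatrix (c.map fun L => (⟨L.gates.map (Gate.lift a), hdisj L⟩ : Layer (n + a))) =
        withIdle a (circuitMatrix c) := by
    intro c
    induction c with
    | nil => simp [circuitMatrix, withIdle_one]
    | cons L c ih =>
      rw [List.map_cons, circuitMatrix_cons, circuitMatrix_cons, ih, withIdle_mul]
      congr 1
      exact hlist L.gates
  refine ⟨c.map fun L => ⟨L.gates.map (Gate.lift a), hdisj L⟩, by simpa [hc] using hD, ?_⟩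
  intro x y z
  rw [hcirc]
  simp [withIdle, funext_iff]

/-! ### Choice of the parameters -/

theorem clog_le_log {a : ℕ} (ha : 2 ≤ a) : (Nat.clog 2 a : ℝ) ≤ 3 * Real.log a := by
  have h2 := Real.log_two_gt_d9
  have ha' : Real.log 2 ≤ Real.log a := Real.log_le_log (by norm_num) (by exact_mod_cast ha)
  have h := Nat.pow_pred_clog_lt_self (b := 2) (by norm_num) (by omega : 1 < a)
  have h1 : ((2 : ℝ) ^ (Nat.clog 2 a - 1)) ≤ a := by exact_mod_cast h.le
  have h3 := Real.log_le_log (by positivity) h1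
  rw [Real.log_pow] at h3
  have h4 : (Nat.clog 2 a : ℝ) ≤ (Nat.clog 2 a - 1 : ℕ) + 1 := by
    exact_mod_cast (by omega : Nat.clog 2 a ≤ Nat.clog 2 a - 1 + 1)
  nlinarith

section Parameters

variable {t k : ℕ} {ε : ℝ}

theorem three_mul_logb_le (ht : 2 ≤ t) (htε : (t : ℝ) < 1 / ε) :
    Real.logb 2 6 + 3 * Real.logb 2 t ≤ Real.logb 2 (6 * (t : ℝ) ^ 2 / ε) := by
  have ht0 : (0 : ℝ) < t := by exact_mod_cast (by omega : 0 < t)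
  have h1 : Real.logb 2 6 + 3 * Real.logb 2 t = Real.logb 2 (6 * (t : ℝ) ^ 3) := by
    rw [Real.logb_mul (by norm_num) (by positivity), Real.logb_pow]; norm_num
  rw [h1]
  refine Real.logb_le_logb_of_le (by norm_num) (by positivity) ?_
  rw [show 6 * (t : ℝ) ^ 3 = 6 * (t : ℝ) ^ 2 * t by ring,
    show 6 * (t : ℝ) ^ 2 / ε = 6 * (t : ℝ) ^ 2 * (1 / ε) by ring]
  gcongr

theorem le_two_rpow_of_width (ht : 2 ≤ t) (htε : (t : ℝ) < 1 / ε)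
    (hk : k = ⌈8 * Real.logb 2 (6 * (t : ℝ) ^ 2 / ε)⌉₊) : (t : ℝ) ≤ 2 ^ ((k : ℝ) / 24) := by
  have ht0 : (0 : ℝ) < t := by exact_mod_cast (by omega : 0 < t)
  have h := three_mul_logb_le ht htε
  have h6 : 0 ≤ Real.logb 2 6 := Real.logb_nonneg (by norm_num) (by norm_num)
  have hk' : 8 * Real.logb 2 (6 * (t : ℝ) ^ 2 / ε) ≤ k := hk ▸ Nat.le_ceil _
  rw [← Real.logb_le_iff_le_rpow (by norm_num) ht0]
  linarith

/-- Since `1 / ε > t`, the width is at least `8 log₂ 6 + 24 log₂ t`, and `8 log₂ 6 ≥ 20`. This room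
serves both the agreement estimates and the dirty work bits. -/
theorem clog_le_width (ht : 2 ≤ t) (htε : (t : ℝ) < 1 / ε)
    (hk : k = ⌈8 * Real.logb 2 (6 * (t : ℝ) ^ 2 / ε)⌉₊) : 24 * (Nat.clog 2 t - 1) + 20 ≤ k := by
  have h := three_mul_logb_le ht htε
  have hk' : 8 * Real.logb 2 (6 * (t : ℝ) ^ 2 / ε) ≤ k := hk ▸ Nat.le_ceil _
  have h6 : 2.5 ≤ Real.logb 2 6 := by
    rw [Real.le_logb_iff_rpow_le (by norm_num) (by norm_num)]
    refine le_of_pow_le_pow_left₀ (n := 2) (by norm_num) (by norm_num) ?_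
    rw [← Real.rpow_mul_natCast (by norm_num)]
    norm_num
  have h1 := Nat.pow_pred_clog_lt_self (b := 2) (by norm_num) (by omega : 1 < t)
  have h2 : ((Nat.clog 2 t - 1 : ℕ) : ℝ) ≤ Real.logb 2 t := by
    rw [Real.le_logb_iff_rpow_le (by norm_num) (by exact_mod_cast (by omega : 0 < t)),
      Real.rpow_natCast]
    exact_mod_cast h1.le
  have h3 : ((24 * (Nat.clog 2 t - 1) + 20 : ℕ) : ℝ) ≤ k := by
    push_cast
    linarith
  exact_mod_cast h3

theorem two_rpow_neg_width_le (ht : 2 ≤ t) (hε : 0 < ε)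
    (hk : k = ⌈8 * Real.logb 2 (6 * (t : ℝ) ^ 2 / ε)⌉₊) :
    (2 : ℝ) ^ (-((k : ℝ) / 8)) ≤ ε / (6 * (t : ℝ) ^ 2) := by
  have ht0 : (0 : ℝ) < t := by exact_mod_cast (by omega : 0 < t)
  have hk' : 8 * Real.logb 2 (6 * (t : ℝ) ^ 2 / ε) ≤ k := hk ▸ Nat.le_ceil _
  have h1 : 6 * (t : ℝ) ^ 2 / ε ≤ 2 ^ ((k : ℝ) / 8) := by
    rw [← Real.logb_le_iff_le_rpow (by norm_num) (by positivity)]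
    linarith
  rw [Real.rpow_neg (by norm_num), inv_le_comm₀ (by positivity) (by positivity), inv_div]
  exact h1

/-- Rounding up the logarithm gives `2 ^ m ≤ 2t`, whence the factor 2 in `α`; then `1 - x ≤ exp
(-x)`. -/
theorem numGates_pow_le {α : ℕ} (ht : 2 ≤ t) (hε : 0 < ε)
    (hα : α = ⌈2 * (28 * 72 ^ 3) * t * Real.log (8 * t / ε)⌉₊) :
    (1 - 1 / (28 * 72 ^ 3 * 2 ^ Nat.clog 2 t) : ℝ) ^ α ≤ ε / (8 * t) := by
  have ht0 : (0 : ℝ) < t := by exact_mod_cast (by omega : 0 < t)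
  have hα' : 2 * (28 * 72 ^ 3) * t * Real.log (8 * t / ε) ≤ α := hα ▸ Nat.le_ceil _
  have hm : (2 : ℝ) ^ Nat.clog 2 t ≤ 2 * t := by
    have h1 := Nat.pow_pred_clog_lt_self (b := 2) (by norm_num) (by omega : 1 < t)
    rw [Nat.pred_eq_sub_one] at h1
    have h2 : 2 ^ Nat.clog 2 t ≤ 2 * t := by
      calc 2 ^ Nat.clog 2 t ≤ 2 ^ (1 + (Nat.clog 2 t - 1)) :=
            Nat.pow_le_pow_right (by norm_num) (by omega)
        _ = 2 * 2 ^ (Nat.clog 2 t - 1) := by rw [pow_add, pow_one]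
        _ ≤ 2 * t := by omega
    exact_mod_cast h2
  set x : ℝ := 1 / (28 * 72 ^ 3 * 2 ^ Nat.clog 2 t) with hx
  have hx1 : x ≤ 1 := by
    rw [hx, div_le_one (by positivity)]
    have : (1 : ℝ) ≤ 2 ^ Nat.clog 2 t := one_le_pow₀ (by norm_num)
    linarith
  have hx2 : 1 / (2 * (28 * 72 ^ 3) * t) ≤ x := by
    rw [hx]
    refine one_div_le_one_div_of_le (by positivity) ?_
    linarith
  have hlog : Real.log (8 * t / ε) ≤ α * x := by
    have h1 : Real.log (8 * t / ε) ≤ α * (1 / (2 * (28 * 72 ^ 3) * t)) := by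
      rw [mul_one_div, le_div_iff₀ (by positivity)]
      linarith
    exact h1.trans (by gcongr)
  calc (1 - x) ^ α ≤ Real.exp (-x) ^ α := by
        refine pow_le_pow_left₀ (by linarith) ?_ _
        have := Real.add_one_le_exp (-x)
        linarith
    _ = Real.exp (-(α * x)) := by rw [← Real.exp_nat_mul]; ring_nf
    _ ≤ Real.exp (-Real.log (8 * t / ε)) := Real.exp_le_exp.2 (by linarith)
    _ = ε / (8 * t) := by
        rw [Real.exp_neg, Real.exp_log (by positivity), inv_div]

/-- The two parts are at most `5 / 24` and `3 / 24` of `ε`; the first uses `3 + t ≤ 5 / 4 * t ^ 2`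
for `t ≥ 2`. -/
theorem error_le {α : ℕ} (ht : 2 ≤ t) (hε : 0 < ε)
    (hk : k = ⌈8 * Real.logb 2 (6 * (t : ℝ) ^ 2 / ε)⌉₊)
    (hα : α = ⌈2 * (28 * 72 ^ 3) * t * Real.log (8 * t / ε)⌉₊) :
    (3 + t) * (2 : ℝ) ^ (-((k : ℝ) / 8)) +
      t * (1 - 1 / (28 * 72 ^ 3 * 2 ^ Nat.clog 2 t)) ^ α ≤ ε / 3 := by
  have ht2 : (2 : ℝ) ≤ t := by exact_mod_cast ht
  have h1 : (3 + t) * (2 : ℝ) ^ (-((k : ℝ) / 8)) ≤ (3 + t) * (ε / (6 * (t : ℝ) ^ 2)) := by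
    gcongr
    exact two_rpow_neg_width_le ht hε hk
  have h2 : (t : ℝ) * (1 - 1 / (28 * 72 ^ 3 * 2 ^ Nat.clog 2 t)) ^ α ≤ t * (ε / (8 * t)) := by
    gcongr
    exact numGates_pow_le ht hε hα
  have h3 : (t : ℝ) * (ε / (8 * t)) = ε / 8 := by field_simp
  have h4 : (3 + t) * (ε / (6 * (t : ℝ) ^ 2)) ≤ 5 / 24 * ε := by
    rw [← mul_div_assoc, div_le_iff₀ (by positivity)]
    have : (3 + t) ≤ 5 / 4 * (t : ℝ) ^ 2 := by nlinarith
    nlinarith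
  linarith

theorem log_div_le (ht : 2 ≤ t) (hε : 0 < ε) (htε : (t : ℝ) < 1 / ε) :
    Real.log (t / ε) ≤ 2 * Real.log (1 / ε) ∧ 2 * Real.log 2 ≤ Real.log (t / ε) ∧
      Real.log t ≤ Real.log (1 / ε) ∧ Real.log 2 ≤ Real.log t := by
  have ht2 : (2 : ℝ) ≤ t := by exact_mod_cast ht
  have h1 : Real.log t ≤ Real.log (1 / ε) := Real.log_le_log (by linarith) htε.le
  have h2 : Real.log 2 ≤ Real.log t := Real.log_le_log (by norm_num) ht2
  have h3 : Real.log (t / ε) = Real.log t + Real.log (1 / ε) := by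
    rw [← Real.log_mul (by positivity) (by positivity)]; ring_nf
  refine ⟨?_, ?_, h1, h2⟩ <;> linarith

theorem numGates_le {α : ℕ} (ht : 2 ≤ t) (hε : 0 < ε) (htε : (t : ℝ) < 1 / ε)
    (hα : α = ⌈2 * (28 * 72 ^ 3) * t * Real.log (8 * t / ε)⌉₊) :
    (α : ℝ) ≤ 6 * (28 * 72 ^ 3) * (t * Real.log (t / ε)) := by
  have ht2 : (2 : ℝ) ≤ t := by exact_mod_cast ht
  obtain ⟨-, h2, -, -⟩ := log_div_le ht hε htε
  have hl2 := Real.log_two_gt_d9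
  have h8 : Real.log (8 * t / ε) = 3 * Real.log 2 + Real.log (t / ε) := by
    rw [mul_div_assoc, Real.log_mul (by norm_num) (by positivity),
      show (8 : ℝ) = 2 ^ 3 by norm_num, Real.log_pow]
    norm_num
  have h1 : (α : ℝ) ≤ 2 * (28 * 72 ^ 3) * t * Real.log (8 * t / ε) + 1 := by
    rw [hα]
    refine (Nat.ceil_lt_add_one ?_).le
    rw [h8]
    have : 0 ≤ 3 * Real.log 2 + Real.log (t / ε) := by linarith
    positivity
  rw [h8] at h1
  have h3 : (t : ℝ) * (3 * Real.log 2 + Real.log (t / ε)) ≤ t * (2.5 * Real.log (t / ε)) := by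
    gcongr
    linarith
  have h4 : 1 ≤ (t : ℝ) * Real.log (t / ε) := by nlinarith
  nlinarith

/-- The hypothesis `log (1 / ε) ≤ t log t` enters here: it makes `k` polynomial in `t`, at most `2 ^
7 * t ^ 2`, so the fan-out costs `O(log t)` layers. -/
theorem log_width_le (ht : 2 ≤ t) (hε : 0 < ε) (htε : (t : ℝ) < 1 / ε)
    (hlog : Real.log (1 / ε) ≤ t * Real.log t)
    (hk : k = ⌈8 * Real.logb 2 (6 * (t : ℝ) ^ 2 / ε)⌉₊) : Real.log k ≤ 9 * Real.log t := by
  have ht2 : (2 : ℝ) ≤ t := by exact_mod_cast ht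
  obtain ⟨-, -, h1, h2⟩ := log_div_le ht hε htε
  have hl2 := Real.log_two_gt_d9
  have h3 := three_mul_logb_le ht htε
  have hlt : 0 ≤ Real.logb 2 t := Real.logb_nonneg (by norm_num) (by linarith)
  have hl6 : 0 ≤ Real.logb 2 6 := Real.logb_nonneg (by norm_num) (by norm_num)
  have hk1 : (k : ℝ) ≤ 8 * Real.logb 2 (6 * (t : ℝ) ^ 2 / ε) + 1 := by
    rw [hk]
    exact (Nat.ceil_lt_add_one (by linarith)).le
  have hk0 : (0 : ℝ) < k := by
    have := clog_le_width ht htε hk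
    exact_mod_cast (by omega : 0 < k)
  have hlt' : Real.log t ≤ t := (Real.log_le_sub_one_of_pos (by linarith)).trans (by linarith)
  have h4 : Real.log (6 * (t : ℝ) ^ 2 / ε) ≤ 5 * (t : ℝ) ^ 2 := by
    have e : Real.log (6 * (t : ℝ) ^ 2 / ε) =
        Real.log 6 + 2 * Real.log t + Real.log (1 / ε) := by
      rw [show 6 * (t : ℝ) ^ 2 / ε = 6 * (t : ℝ) ^ 2 * (1 / ε) by ring,
        Real.log_mul (by positivity) (by positivity), Real.log_mul (by norm_num) (by positivity),
        Real.log_pow]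
      norm_num
    have h6 : Real.log 6 ≤ 5 := (Real.log_le_sub_one_of_pos (by norm_num)).trans (by norm_num)
    rw [e]
    nlinarith
  have h5 : Real.logb 2 (6 * (t : ℝ) ^ 2 / ε) ≤ 8 * (t : ℝ) ^ 2 := by
    rw [Real.logb, div_le_iff₀ (by linarith)]
    nlinarith [sq_nonneg (t : ℝ)]
  have h6 : (k : ℝ) ≤ 2 ^ 7 * (t : ℝ) ^ 2 := by nlinarith
  calc Real.log k ≤ Real.log (2 ^ 7 * (t : ℝ) ^ 2) := Real.log_le_log hk0 h6
    _ = 7 * Real.log 2 + 2 * Real.log t := by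
        rw [Real.log_mul (by positivity) (by positivity), Real.log_pow, Real.log_pow]; norm_num
    _ ≤ 9 * Real.log t := by linarith

/-- The factors are `285 log t` layers per gate (`76 * 3 + 2 * 27` plus rounding), `12 * (28 * 72 ^
3) t log (1 / ε)` gates and `5 log n` steps. The gap between `285 * 12 * 5 = 17100` and `18000`
absorbs the copying layers. -/
theorem depth_le {α n : ℕ} (ht : 2 ≤ t) (hε : 0 < ε) (htε : (t : ℝ) < 1 / ε)
    (hlog : Real.log (1 / ε) ≤ t * Real.log t)
    (hk : k = ⌈8 * Real.logb 2 (6 * (t : ℝ) ^ 2 / ε)⌉₊) (hkn : k ≤ n)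
    (hα : α = ⌈2 * (28 * 72 ^ 3) * t * Real.log (8 * t / ε)⌉₊) :
    ((numRounds n k + (2 + 76 * Nat.clog 2 t + 2 * Nat.clog 2 k) * α * (numRounds n k + 1) : ℕ)
      : ℝ) ≤ 18000 * (28 * 72 ^ 3) * (t * Real.log t * Real.log n * Real.log (1 / ε)) := by
  have ht2 : (2 : ℝ) ≤ t := by exact_mod_cast ht
  obtain ⟨h0, -, h1, h2⟩ := log_div_le ht hε htε
  have hl2 := Real.log_two_gt_d9
  have hk20 : 20 ≤ k := by have := clog_le_width ht htε hk; omega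
  have hn2 : Real.log 2 ≤ Real.log n :=
    Real.log_le_log (by norm_num) (by exact_mod_cast (by omega : 2 ≤ n))
  have hR : (numRounds n k : ℝ) ≤ 3 * Real.log n := by
    refine le_trans ?_ (clog_le_log (by omega : 2 ≤ n))
    have : numReg n k ≤ n := by
      rw [numReg, Nat.ceilDiv_eq_add_pred_div]
      refine Nat.div_le_of_le_mul ?_
      obtain ⟨k', rfl⟩ : ∃ k', k = k' + 1 := ⟨k - 1, by omega⟩
      obtain ⟨n', rfl⟩ : ∃ n', n = n' + 1 := ⟨n - 1, by omega⟩
      rw [show (k' + 1) * (n' + 1) = k' * n' + k' + n' + 1 by ring]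
      omega
    exact_mod_cast Nat.clog_mono_right 2 this
  have hm := clog_le_log ht
  have hd : (Nat.clog 2 k : ℝ) ≤ 27 * Real.log t := by
    have := clog_le_log (by omega : 2 ≤ k)
    have := log_width_le ht hε htε hlog hk
    linarith
  have hα' : (α : ℝ) ≤ 12 * (28 * 72 ^ 3) * (t * Real.log (1 / ε)) := by
    refine (numGates_le ht hε htε hα).trans ?_
    have : (t : ℝ) * Real.log (t / ε) ≤ t * (2 * Real.log (1 / ε)) := by gcongr
    linarith
  have hD : (2 + 76 * Nat.clog 2 t + 2 * Nat.clog 2 k : ℝ) ≤ 285 * Real.log t := by linarith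
  have hR1 : (numRounds n k : ℝ) + 1 ≤ 5 * Real.log n := by linarith
  have hlt0 : 0 ≤ Real.log t := by linarith
  have hle0 : 0 ≤ Real.log (1 / ε) := by linarith
  have hln0 : 0 ≤ Real.log n := by linarith
  have hprod : (2 + 76 * Nat.clog 2 t + 2 * Nat.clog 2 k : ℝ) * α * (numRounds n k + 1) ≤
      285 * Real.log t * (12 * (28 * 72 ^ 3) * (t * Real.log (1 / ε))) * (5 * Real.log n) := by
    gcongr
  have hone : 0.9 ≤ t * Real.log t * Real.log (1 / ε) := by
    have h3 : 0.69 ≤ Real.log t := by linarith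
    have h4 : 0.69 ≤ Real.log (1 / ε) := by linarith
    calc (0.9 : ℝ) ≤ 2 * 0.69 * 0.69 := by norm_num
      _ ≤ t * Real.log t * Real.log (1 / ε) := by gcongr
  have hone' : 0.9 * Real.log n ≤ t * Real.log t * Real.log (1 / ε) * Real.log n := by gcongr
  push_cast
  linarith

end Parameters

/-! ### Assembly of the error and depth bounds. -/

theorem injCount_pos {n t : ℕ} (h : t ≤ 2 ^ n) : 0 < injCount n t := by
  rw [injCount_eq, Finset.card_powersetCard]
  refine Nat.mul_pos t.factorial_pos (Nat.choose_pos ?_)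
  simpa using h

theorem traceDist_lt {n t k α : ℕ} {ε : ℝ} (ht : 2 ≤ t) (hε : 0 < ε) (htε : (t : ℝ) < 1 / ε)
    (hk : k = ⌈8 * Real.logb 2 (6 * (t : ℝ) ^ 2 / ε)⌉₊) (hkn : k ≤ n)
    (hα : α = ⌈2 * (28 * 72 ^ 3) * t * Real.log (8 * t / ε)⌉₊) :
    traceDist (outputState t (Finset.univ : Finset (Seed n k (Nat.clog 2 t) α)))
      (rhoUnique n t) < ε := by
  have hmk := clog_le_width ht htε hk
  have htm : t ≤ 2 ^ Nat.clog 2 t := Nat.le_pow_clog (by norm_num) _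
  have htk : t ≤ 2 ^ k := htm.trans (Nat.pow_le_pow_right (by norm_num) (by omega))
  have htn : t ≤ 2 ^ n := htk.trans (Nat.pow_le_pow_right (by norm_num) hkn)
  have : Nonempty (Fin (Nat.clog 2 t) ↪ Fin k) := ⟨Fin.castLEEmb (by omega)⟩
  have hS : 0 < Fintype.card (Fin α → (Fin (Nat.clog 2 t) ↪ Fin k) × (Fin (Nat.clog 2 t) → Bool)) :=
    Fintype.card_pos
  have hS' : 0 < Fintype.card (Seed n k (Nat.clog 2 t) α) := Fintype.card_pos
  have hβ := (card_pairs_not_isSeparating_le (α := α) (le_two_rpow_of_width ht htε hk) hmk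
    htm).trans (mul_le_mul_of_nonneg_right (error_le ht hε hk hα) (by positivity))
  have key : ∃ g : (Fin t → Bits n) → ℝ,
      (∀ y, g y ≤ outcomeCount (k := k) (m := Nat.clog 2 t) (α := α) y /
        (Fintype.card (Seed n k (Nat.clog 2 t) α) * injCount k t)) ∧
      (∀ y, g y ≤ open Classical in if Function.Injective y then (1 : ℝ) / injCount n t else 0) ∧
      1 - 2 * (ε / 3) ≤ ∑ y, g y := by
    by_cases hn : (1 + 1) * k ≤ n
    · exact exists_lower_bound_wide (by omega) hn (injCount_pos htk) hS hβ
    · obtain ⟨g, hg1, hg2, hg3⟩ :=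
        exists_lower_bound_narrow (by omega) hkn hn (injCount_pos htk) hS hβ
      exact ⟨g, hg1, hg2, by linarith⟩
  obtain ⟨g, hg1, hg2, hg3⟩ := key
  have := traceDist_le_of_lower_bound hkn (injCount_pos htk) (injCount_pos htn) g hg1 hg2 hS'
  linarith

end RandomMCX

theorem mainTheorem5 :
    ∃ (C : ℝ) (c : ℕ), 0 < C ∧
      ∀ (t n k : ℕ) (ε : ℝ), 1 ≤ t → 0 < ε → ε ≤ 1 → (t : ℝ) < 1 / ε →
        Real.log (1 / ε) ≤ t * Real.log t →
        k = ⌈8 * Real.logb 2 (6 * (t : ℝ) ^ 2 / ε)⌉₊ → k ≤ n →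
        ∃ α : ℕ, (α : ℝ) ≤ C * t * Real.log (t / ε) ∧
          RandomMCX.traceDist
            (RandomMCX.outputState t
              (Finset.univ : Finset (RandomMCX.Seed n k (Nat.clog 2 t) α)))
            (RandomMCX.rhoUnique n t) < ε ∧
          ∃ G : Finset (RandomMCX.Seed n k (Nat.clog 2 t) α),
            (1 - ε) * Fintype.card (RandomMCX.Seed n k (Nat.clog 2 t) α) < G.card ∧
            RandomMCX.traceDist (RandomMCX.outputState t G) (RandomMCX.rhoUnique n t) < ε ∧
            ∀ ω ∈ G,
              RandomMCX.ImplementableInDepth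
                (RandomMCX.permUnitary (RandomMCX.algorithmPerm ω)) 0
                (C * (t * Real.log t ^ 3 * Real.log n * Real.log (1 / ε))) ∧
              RandomMCX.ImplementableInDepth
                (RandomMCX.permUnitary (RandomMCX.algorithmPerm ω)) ⌈(n : ℝ) / k⌉₊
                (C * (t * Real.log t ^ 2 * Real.log n * Real.log (1 / ε) *
                  Real.log (2 + Real.log t) ^ c)) := by
  -- The exponent `c = 0` works because the depth has a single factor `log t`. As `log t ≥ log 2`,
  -- that factor is at most `20 / 9 * (log t) ^ 3`, and `18000 * 20 / 9 = 40000`.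
  refine ⟨40000 * (28 * 72 ^ 3), 0, by norm_num, ?_⟩
  intro t n k ε ht1 hε _ htε hlog hk hkn
  -- For `t = 1` the hypotheses would give both `log (1 / ε) > 0` and `log (1 / ε) ≤ 0`.
  have ht : 2 ≤ t := by
    by_contra h
    obtain rfl : t = 1 := by omega
    rw [Nat.cast_one] at htε hlog
    rw [Real.log_one, mul_zero] at hlog
    exact absurd (Real.log_pos htε) (not_lt.2 hlog)
  have ht2 : (2 : ℝ) ≤ t := by exact_mod_cast ht
  obtain ⟨-, h2, hle, hlt⟩ := RandomMCX.log_div_le ht hε htε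
  have hl2 := Real.log_two_gt_d9
  have hmk := RandomMCX.clog_le_width ht htε hk
  obtain ⟨α, hα⟩ : ∃ α : ℕ, α = ⌈2 * (28 * 72 ^ 3) * t * Real.log (8 * t / ε)⌉₊ := ⟨_, rfl⟩
  have hTD := RandomMCX.traceDist_lt ht hε htε hk hkn hα
  refine ⟨α, ?_, hTD, Finset.univ, ?_, hTD, fun ω _ => ?_⟩
  · refine (RandomMCX.numGates_le ht hε htε hα).trans ?_
    have : 0 ≤ (t : ℝ) * Real.log (t / ε) := mul_nonneg (by linarith) (by linarith)
    linarith
  · have : Nonempty (Fin (Nat.clog 2 t) ↪ Fin k) := ⟨Fin.castLEEmb (by omega)⟩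
    have : (0 : ℝ) < Fintype.card (RandomMCX.Seed n k (Nat.clog 2 t) α) := by
      exact_mod_cast Fintype.card_pos
    rw [Finset.card_univ]
    nlinarith
  · have hR := RandomMCX.realizes_algorithmPerm (by omega) (by omega : 2 * Nat.clog 2 t ≤ k)
      (Nat.le_pow_clog (by norm_num) k) ω
    have hD := RandomMCX.depth_le ht hε htε hlog hk hkn hα
    have hn0 : 0 ≤ Real.log n := Real.log_natCast_nonneg n
    have hw : 0 ≤ t * Real.log n * Real.log (1 / ε) := by
      have : 0 ≤ Real.log (1 / ε) := by linarith
      positivity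
    have hsq : Real.log t ≤ 2 * Real.log t ^ 2 := by nlinarith
    have hcube : Real.log t ≤ 20 / 9 * Real.log t ^ 3 := by
      nlinarith [mul_nonneg (by linarith : 0 ≤ Real.log t)
        (by nlinarith : 0 ≤ Real.log t ^ 2 - 9 / 20)]
    refine ⟨hR.implementable 0 (hD.trans ?_), hR.implementable _ (hD.trans ?_)⟩
    · have := mul_le_mul_of_nonneg_left hcube hw
      linarith
    · rw [pow_zero, mul_one]
      have := mul_le_mul_of_nonneg_left hsq hw
      linarith
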